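/- Let $k$ be a field of characteristic $0$ (e.g. $\mathbb R$ or $\mathbb C$). Coefficient functions $g(n,t)$, $n\in\mathbb Z$, are formal power series in $t=(t_1,t_2,\dots)$ for each $n$; $(\Gamma g)(n)=g(n+1)$, $\Delta=\Gamma-1$, $\Delta^*=\Gamma^{-1}-1$. Pseudo-difference operators $\sum_{m\ll\infty}a_m\Delta^m$ are multiplied by the Leibniz rule $\Delta^j\circ g=\sum_{i\ge0}\binom ji(\Delta^ig)(n+j-i)\,\Delta^{j-i}$; the formal adjoint is $(\sum a_m\Delta^m)^*=\sum(\Delta^*)^m\circ a_m$, and $\operatorname{res}_\Delta\sum a_m\Delta^m=a_{-1}$. Subscripts $\ge1$, $\le0$ denote the parts with powers $\Delta^m$, $m\ge1$, respectively $m\le0$. Let $Z=z_0+z_1\Delta^{-1}+z_2\Delta^{-2}+\cdots$, with $z_0$ invertible, be a dressing operator of the discrete modified KP hierarchy: with $L=Z\Delta Z^{-1}$ it satisfies $\partial_{t_i}Z=-(L^i)_{\le0}Z$ for all $i\ge1$. Put $\xi(t,\lambda)=\sum_{l\ge1}t_l\lambda^l$, and let $$w(n,t,\lambda)=Z(n)(1+\lambda)^ne^{\xi(t,\lambda)},\qquad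 w^*(n,t,\lambda)=\bigl(Z^{-1}(n-1)\Delta^{-1}\bigr)^*(1+\lambda)^{-n}e^{-\xi(t,\lambda)}$$ be the wave and adjoint wave functions; here $(1+\lambda)^{\pm n}$ is expanded in powers of $\lambda^{-1}$, and $Z(n-1)$ etc. means that the coefficients are evaluated at $n-1$. Let $[x]=(x,x^2/2,x^3/3,\dots)$, and let $f(t\pm[x])=\exp\bigl(\pm\sum_{l\ge1}\tfrac{x^l}{l}\partial_{t_l}\bigr)f(t)$, expanded in powers of $x$. A squared eigenfunction potential $S(\phi,\Delta\psi)$ is a function $S$ with $$\Delta S=\phi\,(\Delta\psi),\qquad \partial_{t_i}S=\operatorname{res}_\Delta\bigl(\Delta^{-1}\circ(\Delta\psi)\circ(L^i)_{\ge1}\circ\phi\circ\Delta^{-1}\bigr)\quad(i\ge1),$$ and a potential $\hat S(\Delta\phi,\Gamma\psi)$ is a function of the form $\phi\psi-S$ with such an $S$. **Theorem.** 1. Among functions of $(n,t)$ with coefficients in $k((\mu^{-1}))((\lambda^{-1}))$ (expansions for $|\mu|<|\lambda|$), the potentials $S\bigl(w(n,t,\mu),\Delta w^*(n,t,\lambda)\bigr)$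 are exactly the functions $$w(n,t+[\lambda^{-1}],\mu)\,w^*(n,t,\lambda)+c,$$ where $c\in k((\mu^{-1}))((\lambda^{-1}))$ is independent of $n$ and $t$. 2. Among functions of $(n,t)$ with coefficients in $k((\lambda^{-1}))((\mu^{-1}))$ (expansions for $|\lambda|<|\mu|$), the potentials $\hat S\bigl(\Delta w(n,t,\mu),w^*(n+1,t,\lambda)\bigr)$ are exactly the functions $$w(n,t,\mu)\,w^*(n,t-[\mu^{-1}],\lambda)+c,$$ where $c\in k((\lambda^{-1}))((\mu^{-1}))$ is independent of $n$ and $t$. -/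

import Mathlib

noncomputable section

namespace DMKP

/-- Coefficient functions `g(n, t)`: for every lattice point `n : ℤ` a formal power series in the
time variables `t₁, t₂, …` (indexed by `ℕ+`) with coefficients in `K`. -/
abbrev Coef (K : Type*) : Type _ := ℤ → MvPowerSeries ℕ+ K

section Coefficients

variable {K : Type*} [Field K]

/-- The power `Γ^k` of the shift operator: `(Γ^k g)(n) = g(n + k)`, `k : ℤ`. -/
def shift (k : ℤ) (g : Coef K) : Coef K := fun n => g (n + k)

/-- The forward difference `(Δ g)(n) = g(n + 1) - g(n)`. -/
def diff (g : Coef K) : Coef K := shift 1 g - g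

/-- The adjoint difference `Δ^* = Γ⁻¹ - I`, that is `(Δ^* g)(n) = g(n - 1) - g(n)`. -/
def diffAdj (g : Coef K) : Coef K := shift (-1) g - g

/-- The partial derivative `∂ g / ∂ t_i`. -/
def dt (i : ℕ+) (g : Coef K) : Coef K := fun n => MvPowerSeries.pderiv K i (g n)

/-- The functions which depend neither on `n` nor on `t`. -/
def const (c : K) : Coef K := fun _ => MvPowerSeries.C c

end Coefficients

/-- Families `(a_m)`, `m : ℤ`, of coefficient functions which vanish for all large `m`.  They are
the coefficients of a pseudo-difference operator `∑ a_m Δ^m`, and also the coefficients of the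
formal adjoint of such an operator, which is a series `∑ a_m (Δ^*)^m`. -/
@[ext]
structure OpSeries (K : Type*) [Field K] where
  /-- the coefficient of the `m`-th power -/
  coeff : ℤ → Coef K
  /-- only finitely many positive powers occur -/
  bdd : ∃ N : ℤ, ∀ m, N < m → coeff m = 0

/-- The set `G` of pseudo-difference operators `∑_{m ≪ ∞} a_m(n, t) Δ^m`. -/
abbrev PDO (K : Type*) [Field K] : Type _ := OpSeries K

/-- Series `∑_{m ≪ ∞} a_m(n, t) (Δ^*)^m` in the adjoint difference operator. -/
abbrev AdjPDO (K : Type*) [Field K] : Type _ := OpSeries K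

namespace PDO

variable {K : Type*} [Field K]

/-- The operator `g Δ^k`. -/
def mono (g : Coef K) (k : ℤ) : PDO K where
  coeff m := if m = k then g else 0
  bdd := ⟨k, fun _ hm => if_neg hm.ne'⟩

/-- The operator `Δ^k`, `k : ℤ`. -/
def delta (k : ℤ) : PDO K := mono 1 k

/-- The operator of multiplication by `g`. -/
def mulOp (g : Coef K) : PDO K := mono g 0

/-- The product of pseudo-difference operators, given by the Leibniz rule
`Δ^k ∘ g = ∑_{i ≥ 0} binom(k, i) (Δ^i g)(n + k - i) Δ^{k - i}`: the coefficient of `Δ^m` in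
`(∑ a_k Δ^k) ∘ (∑ b_l Δ^l)` collects the terms with `k - i + l = m`. There are only finitely many
nonzero ones. -/
def comp (A B : PDO K) : PDO K where
  coeff m := ∑ᶠ k : ℤ, ∑ᶠ i : ℕ,
    Ring.choose k i • (A.coeff k * diff^[i] (shift (k - i) (B.coeff (m - k + i))))
  bdd := by
    obtain ⟨N, hN⟩ := A.bdd
    obtain ⟨M, hM⟩ := B.bdd
    refine ⟨N + M, fun m hm => ?_⟩
    have hdiff : ∀ i : ℕ, diff^[i] (0 : Coef K) = 0 := by
      intro i
      induction i with
      | zero => rfl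
      | succ i ih => rw [Function.iterate_succ_apply', ih]; funext n; simp [diff, shift]
    rw [← finsum_zero (α := ℤ)]
    refine finsum_congr fun k => ?_
    rw [← finsum_zero (α := ℕ)]
    refine finsum_congr fun i => ?_
    by_cases hk : N < k
    · rw [hN k hk, zero_mul, smul_zero]
    · have h0 : B.coeff (m - k + i) = 0 := hM _ (by omega)
      have h1 : shift (k - i) (0 : Coef K) = 0 := rfl
      rw [h0, h1, hdiff, mul_zero, smul_zero]

/-- Powers `A^i = A ∘ ⋯ ∘ A`. -/
def npow (A : PDO K) : ℕ → PDO K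
  | 0 => delta 0
  | i + 1 => comp A (npow A i)

/-- The part `A_{≥ 1} = ∑_{m ≥ 1} a_m Δ^m`. -/
def posPart (A : PDO K) : PDO K where
  coeff m := if 1 ≤ m then A.coeff m else 0
  bdd := by
    obtain ⟨N, hN⟩ := A.bdd
    exact ⟨N, fun m hm => by simp [hN m hm]⟩

/-- The part `A_{≤ 0} = ∑_{m ≤ 0} a_m Δ^m`. -/
def nonposPart (A : PDO K) : PDO K where
  coeff m := if m ≤ 0 then A.coeff m else 0
  bdd := ⟨0, fun _ hm => if_neg (not_le.mpr hm)⟩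

/-- The residue `res_Δ ∑ a_m Δ^m = a_{-1}`. -/
def res (A : PDO K) : Coef K := A.coeff (-1)

/-- The operator `A(n + k)`, with all coefficients evaluated at `n + k`. -/
def translate (k : ℤ) (A : PDO K) : PDO K where
  coeff m := shift k (A.coeff m)
  bdd := by
    obtain ⟨N, hN⟩ := A.bdd
    exact ⟨N, fun m hm => by rw [hN m hm]; rfl⟩

/-- Extension of scalars of the coefficients along `f : K → K'`. -/
def mapScalars {K' : Type*} [Field K'] (f : K →+* K') (A : PDO K) : PDO K' where
  coeff m n := MvPowerSeries.map f (A.coeff m n)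
  bdd := by
    obtain ⟨N, hN⟩ := A.bdd
    exact ⟨N, fun m hm => by funext n; simp [hN m hm]⟩

/-- The formal adjoint `(∑ a_k Δ^k)^* = ∑ (Δ^*)^k ∘ a_k`, brought to the form `∑ b_m (Δ^*)^m` by
the Leibniz rule of `Δ^*`,
`(Δ^*)^k ∘ g = ∑_{i ≥ 0} binom(k, i) ((Δ^*)^i g)(n - (k - i)) (Δ^*)^{k - i}`. -/
def adjoint (A : PDO K) : AdjPDO K where
  coeff m := ∑ᶠ i : ℕ, Ring.choose (m + i) i • diffAdj^[i] (shift (-m) (A.coeff (m + i)))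
  bdd := by
    obtain ⟨N, hN⟩ := A.bdd
    refine ⟨N, fun m hm => ?_⟩
    have hdiff : ∀ i : ℕ, diffAdj^[i] (0 : Coef K) = 0 := by
      intro i
      induction i with
      | zero => rfl
      | succ i ih => rw [Function.iterate_succ_apply', ih]; funext n; simp [diffAdj, shift]
    rw [← finsum_zero (α := ℕ)]
    refine finsum_congr fun i => ?_
    have h0 : A.coeff (m + i) = 0 := hN _ (by omega)
    have h1 : shift (-m) (0 : Coef K) = 0 := rfl
    rw [h0, h1, hdiff, smul_zero]

end PDO

open PDO

/-- `Z` is a dressing operator of the discrete modified KP hierarchy, `Zinv` is its inverse in the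
algebra `G`, and `L = Z Δ Z⁻¹` is its Lax operator: `Z = z₀ + z₁ Δ⁻¹ + z₂ Δ⁻² + ⋯` with invertible
`z₀`, subject to the Sato equations `∂ Z / ∂ t_i = - (L^i)_{≤ 0} Z` for all `i ≥ 1`. -/
structure IsDressing {K : Type*} [Field K] (Z Zinv L : PDO K) : Prop where
  order_le : ∀ m : ℤ, 0 < m → Z.coeff m = 0
  isUnit_lead : IsUnit (Z.coeff 0)
  mul_inv : comp Z Zinv = delta 0
  inv_mul : comp Zinv Z = delta 0
  lax : L = comp (comp Z (delta 1)) Zinv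
  sato : ∀ (i : ℕ+) (m : ℤ), dt i (Z.coeff m) = - (comp (nonposPart (npow L i)) Z).coeff m

section WaveFunctions

variable {K : Type*} [Field K]

/-- The spectral variable `λ`. Formal Laurent series in `λ⁻¹` are written as Mathlib's Laurent
series in `X`, with `X = λ⁻¹`; thus `λ = X⁻¹`. -/
def spec : LaurentSeries K := HahnSeries.single (-1 : ℤ) 1

/-- `exp(ε ξ(t, λ)) = ∏_l exp(ε λ^l t_l)`, `ξ(t, λ) = ∑_{l ≥ 1} t_l λ^l`, as a power series in `t`:
the coefficient of `∏ t_l^{γ_l}` is `∏ (ε λ^l)^{γ_l} / γ_l !`. -/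
def expXi (ε : LaurentSeries K) : MvPowerSeries ℕ+ (LaurentSeries K) :=
  fun γ => γ.prod fun l m => (ε * spec ^ (l : ℕ)) ^ m / (Nat.factorial m : LaurentSeries K)

/-- The series `∑_m a_m(n, t) λ^m` attached to a family `(a_m)`. -/
def symbol (A : OpSeries K) (n : ℤ) : MvPowerSeries ℕ+ (LaurentSeries K) :=
  fun α => HahnSeries.ofSuppBddBelow
    (fun j : ℤ => MvPowerSeries.coeff α (A.coeff (-j) n)) (by
      obtain ⟨N, hN⟩ := A.bdd
      refine ⟨-N, fun j hj => ?_⟩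
      by_contra hlt
      apply hj
      have h0 : A.coeff (-j) = 0 := hN _ (by omega)
      simp [h0])

/-- The wave function `w(n, t, λ) = Z (1 + λ)^n e^{ξ(t, λ)}`. Since `Δ^m (1 + λ)^n = λ^m (1 + λ)^n`,
the operator `∑ a_m Δ^m` multiplies `(1 + λ)^n e^{ξ(t, λ)}` by `∑ a_m λ^m`. -/
def wave (Z : PDO K) : Coef (LaurentSeries K) :=
  fun n => symbol Z n * MvPowerSeries.C ((1 + spec) ^ n) * expXi 1

/-- The adjoint wave function `w^*(n, t, λ) = (Z⁻¹(n - 1) Δ⁻¹)^* (1 + λ)^{-n} e^{-ξ(t, λ)}`.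
Since `(Δ^*)^m (1 + λ)^{-n} = λ^m (1 + λ)^{-n}`, the operator `∑ a_m (Δ^*)^m` multiplies
`(1 + λ)^{-n} e^{-ξ(t, λ)}` by `∑ a_m λ^m`. -/
def waveAdj (Zinv : PDO K) : Coef (LaurentSeries K) :=
  fun n => symbol (adjoint (comp (translate (-1) Zinv) (delta (-1)))) n
    * MvPowerSeries.C ((1 + spec) ^ (-n)) * expXi (-1)

/-- The coefficient of `x^k` in
`f(t + ε [x]) = exp(ε ∑_{l ≥ 1} (x^l / l) ∂/∂t_l) f`, where `[x] = (x, x²/2, x³/3, …)`.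
By `x d/dx f(t + ε [x]) = ε ∑_{l ≥ 1} x^l (∂f/∂t_l)(t + ε [x])`, these coefficients `h_k f` are
determined by `h_0 f = f` and `k h_k f = ε ∑_{l = 1}^k h_{k - l} (∂f/∂t_l)`. -/
def timeShiftCoeff (ε : K) : ℕ → MvPowerSeries ℕ+ K → MvPowerSeries ℕ+ K
  | 0, f => f
  | k + 1, f => (ε / ((k : K) + 1)) •
      ∑ l : Fin (k + 1), timeShiftCoeff ε (k - l.1) (MvPowerSeries.pderiv K l.1.succPNat f)
  termination_by k => k

/-- The time shift `f(t) ↦ f(t + ε [λ⁻¹])`, expanded in powers of the new variable `λ⁻¹`. -/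
def timeShift (ε : K) (f : MvPowerSeries ℕ+ K) : MvPowerSeries ℕ+ (LaurentSeries K) :=
  fun α => HahnSeries.ofPowerSeries ℤ K
    (PowerSeries.mk fun k => MvPowerSeries.coeff α (timeShiftCoeff ε k f))

end WaveFunctions

section TwoVariables

variable (k : Type*) [Field k]

/-- Iterated Laurent series: Laurent series in the inverse of an "outer" spectral variable, whose
coefficients are Laurent series in the inverse of an "inner" spectral variable. Rational functions
of the two variables are expanded in the region `|inner| < |outer|`. -/
abbrev Laurent2 : Type _ := LaurentSeries (LaurentSeries k)

variable {k}

/-- The inclusion of the scalars. -/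
def scalar : k →+* Laurent2 k := HahnSeries.C.comp HahnSeries.C

/-- A function whose spectral variable is taken to be the inner one. -/
def inner (g : Coef (LaurentSeries k)) : Coef (Laurent2 k) :=
  fun n α => HahnSeries.C (MvPowerSeries.coeff α (g n))

/-- A function whose spectral variable is taken to be the outer one. -/
def outer (g : Coef (LaurentSeries k)) : Coef (Laurent2 k) :=
  fun n α => (MvPowerSeries.coeff α (g n)).map (HahnSeries.C : k →+* LaurentSeries k)

/-- The function `g(n, t + ε [z⁻¹], y)`, where `y`, the spectral variable of `g`, is the inner
variable and `z` is the outer one. -/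
def shiftedInner (ε : LaurentSeries k) (g : Coef (LaurentSeries k)) : Coef (Laurent2 k) :=
  fun n => timeShift ε (g n)

end TwoVariables

section Potentials

variable {K : Type*} [Field K]

/-- `S` is a squared eigenfunction potential `S(φ, Δψ)`: `Δ S = φ (Δψ)` and
`∂ S / ∂ t_i = res_Δ (Δ⁻¹ (Δψ) (L^i)_{≥ 1} φ Δ⁻¹)` for all `i ≥ 1`. -/
structure IsPotential (L : PDO K) (φ ψ S : Coef K) : Prop where
  diff_eq : diff S = φ * diff ψ
  dt_eq : ∀ i : ℕ+, dt i S =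
    res (comp (delta (-1)) (comp (mulOp (diff ψ))
      (comp (posPart (npow L i)) (comp (mulOp φ) (delta (-1))))))

/-- `T` is a squared eigenfunction potential `Ŝ(Δφ, Γψ)`, that is `T = φ ψ - S(φ, Δψ)`. -/
def IsPotentialHat (L : PDO K) (φ ψ T : Coef K) : Prop :=
  ∃ S, IsPotential L φ ψ S ∧ T = φ * ψ - S

end Potentials

end DMKP

end

set_option linter.unusedSectionVars false

noncomputable section

namespace DMKP

/-! ### Action of pseudo-difference operators on sequences that vanish near -∞ -/

section Representation

variable {K : Type*} [Field K]

/-! Write `B_i = (L^i)_{≥1}`, `z_0` for the leading coefficient of `Z`, and `f^±` for the function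
`f(t ± [x])`. The Sato equation reads `∂_i Z = B_i Z - Z Δ^i`, so the wave function satisfies `∂_i w
= B_i(w)` and the difference of the adjoint wave function satisfies `∂_i(Δw^*) = -B_i^*(Δw^*)`.

The heart is a computation of Miwa shifts of such eigenfunctions. Expanding in `x`, `φ^-` is `φ +
∑_{k≥1} x^k W_k(φ)`, where each `W_k` is built from the `B_i` and so contains only powers `Δ^m`, `m
≥ 1`. On the other hand `W_k Z` is the `x^k`-coefficient of `Z^- (1 - xΔ)`, because `exp(-∑ x^l Δ^l
/ l) = 1 - xΔ`; so `W_k` has order at most 1. Hence `W_k` is a multiple of `Δ`, with a coefficient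
read off from `z_0` (`schur_evol`, and `schur_evol_left` for the adjoint side). This gives `φ^- = φ
- x z_0^- (Γ z_0^{-1}) Δφ` for every eigenfunction `φ`.

If the shift parameter equals the inverse of the function's own spectral variable, the factor `1 -
xλ` vanishes, which yields `λ w = z_0^- (Γ z_0^{-1}) Δw` and `λ Γw^* = -z_0 (Γ z_0^{-1})^+ Δw^*` at
`x = λ^{-1}` (`const_spec_mul_wave`, `const_spec_mul_shift_waveAdj`). Formally this is a telescoping
sum over coefficients. Combined with the shift formula in the other spectral variable, these
relations give the difference equations `ΔS = φ Δψ` of the theorem by elimination of the common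
factor.

The time equations then come for free: both sides have the same difference by `diff_res_potential`,
and both grow in the outer variable like `(1+λ)^{±n}`, a type that contains no nonzero function
independent of `n` (`Growth.eq_zero`). Finally, two potentials differ by something killed by `Δ` and
all `∂_i`, hence by a constant.

The ring structure on operators is obtained from a faithful action: on sequences vanishing near
`-∞`, `Δ` is invertible and `act_comp` turns the Leibniz product into composition, so associativity
follows. -/

@[simp] lemma shift_apply (k : ℤ) (g : Coef K) (n : ℤ) : shift k g n = g (n + k) := rfl

@[simp] lemma diff_apply (g : Coef K) (n : ℤ) : diff g n = g (n + 1) - g n := rfl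

@[simp] lemma diffAdj_apply (g : Coef K) (n : ℤ) : diffAdj g n = g (n - 1) - g n := rfl

lemma shift_shift (a b : ℤ) (g : Coef K) : shift a (shift b g) = shift (a + b) g := by
  funext n; simp [add_assoc]

@[simp] lemma shift_zero_left (g : Coef K) : shift 0 g = g := by funext n; simp

/-- The shift by `k` as a ring homomorphism. -/
def shiftHom (k : ℤ) : Coef K →+* Coef K where
  toFun := shift k
  map_zero' := rfl
  map_one' := rfl
  map_add' _ _ := rfl
  map_mul' _ _ := rfl

/-- The forward difference as a linear map. -/
def diffHom : Coef K →ₗ[K] Coef K where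
  toFun := diff
  map_add' f g := by funext n; simp; ring
  map_smul' c f := by funext n; simp [smul_sub]

@[simp] lemma shift_zero (k : ℤ) : shift k (0 : Coef K) = 0 := rfl
@[simp] lemma shift_one (k : ℤ) : shift k (1 : Coef K) = 1 := rfl
lemma shift_add (k : ℤ) (f g : Coef K) : shift k (f + g) = shift k f + shift k g := rfl
lemma shift_sub (k : ℤ) (f g : Coef K) : shift k (f - g) = shift k f - shift k g := rfl
lemma shift_mul (k : ℤ) (f g : Coef K) : shift k (f * g) = shift k f * shift k g := rfl
lemma shift_neg (k : ℤ) (f : Coef K) : shift k (-f) = -shift k f := rfl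

lemma diff_add (f g : Coef K) : diff (f + g) = diff f + diff g := diffHom.map_add f g
lemma diff_sub (f g : Coef K) : diff (f - g) = diff f - diff g := diffHom.map_sub f g
lemma diff_neg (f : Coef K) : diff (-f) = -diff f := diffHom.map_neg f
@[simp] lemma diff_zero : diff (0 : Coef K) = 0 := diffHom.map_zero
@[simp] lemma diff_one : diff (1 : Coef K) = 0 := by funext n; simp

lemma diff_eq (f : Coef K) : diff f = shift 1 f - f := rfl

lemma diff_mul (f g : Coef K) : diff (f * g) = shift 1 f * diff g + diff f * g := by
  funext n; simp; ring

lemma diff_shift (k : ℤ) (f : Coef K) : diff (shift k f) = shift k (diff f) := by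
  funext n; simp [add_right_comm]

@[simp] lemma diff_iterate_zero (i : ℕ) : diff^[i] (0 : Coef K) = 0 := by
  induction i with
  | zero => rfl
  | succ i ih => rw [Function.iterate_succ_apply', ih, diff_zero]

/-- Laurent series over the power series in `t`; they are regarded as functions of the lattice
point which vanish near `-∞`, and pseudo-difference operators act on them. -/
abbrev Fun (K : Type*) [Field K] : Type _ := HahnSeries ℤ (MvPowerSeries ℕ+ K)

lemma Fun.exists_vanish (f : Fun K) : ∃ n₀ : ℤ, ∀ n < n₀, f.coeff n = 0 :=
  ⟨f.order, fun _ h => HahnSeries.coeff_eq_zero_of_lt_order h⟩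

/-- The forward difference as an invertible element of the ring of Laurent series. -/
def deltaUnit : (Fun K)ˣ where
  val := HahnSeries.single (-1 : ℤ) 1 - 1
  inv := HahnSeries.single (1 : ℤ) 1 * HahnSeries.ofPowerSeries ℤ _ (PowerSeries.mk 1)
  val_inv := by
    have h := congrArg (HahnSeries.ofPowerSeries ℤ (MvPowerSeries ℕ+ K))
      (PowerSeries.mk_one_mul_one_sub_eq_one (MvPowerSeries ℕ+ K))
    rw [map_mul, map_sub, map_one, HahnSeries.ofPowerSeries_X] at h
    have h1 : (HahnSeries.single (-1 : ℤ) (1 : MvPowerSeries ℕ+ K)) *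
        HahnSeries.single (1 : ℤ) (1 : MvPowerSeries ℕ+ K) = 1 := by
      rw [HahnSeries.single_mul_single]; simp
    linear_combination h + HahnSeries.ofPowerSeries ℤ _ (PowerSeries.mk 1) * h1
  inv_val := by
    have h := congrArg (HahnSeries.ofPowerSeries ℤ (MvPowerSeries ℕ+ K))
      (PowerSeries.mk_one_mul_one_sub_eq_one (MvPowerSeries ℕ+ K))
    rw [map_mul, map_sub, map_one, HahnSeries.ofPowerSeries_X] at h
    have h1 : (HahnSeries.single (-1 : ℤ) (1 : MvPowerSeries ℕ+ K)) *
        HahnSeries.single (1 : ℤ) (1 : MvPowerSeries ℕ+ K) = 1 := by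
      rw [HahnSeries.single_mul_single]; simp
    linear_combination h + HahnSeries.ofPowerSeries ℤ _ (PowerSeries.mk 1) * h1

/-- The powers of the forward difference on functions which vanish near `-∞`. -/
def dpow (m : ℤ) (f : Fun K) : Fun K := ((deltaUnit ^ m : (Fun K)ˣ) : Fun K) * f

lemma dpow_dpow (a b : ℤ) (f : Fun K) : dpow a (dpow b f) = dpow (a + b) f := by
  simp [dpow, zpow_add, mul_assoc]

@[simp] lemma dpow_zero (f : Fun K) : dpow 0 f = f := by simp [dpow]

lemma dpow_sub (m : ℤ) (f g : Fun K) : dpow m (f - g) = dpow m f - dpow m g := mul_sub _ _ _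

lemma dpow_sum {ι : Type*} (s : Finset ι) (m : ℤ) (f : ι → Fun K) :
    dpow m (∑ i ∈ s, f i) = ∑ i ∈ s, dpow m (f i) := Finset.mul_sum _ _ _

lemma coeff_dpow_succ (m : ℤ) (f : Fun K) (n : ℤ) :
    (dpow (m + 1) f).coeff n = (dpow m f).coeff (n + 1) - (dpow m f).coeff n := by
  rw [add_comm m 1, ← dpow_dpow]
  have : ((deltaUnit : (Fun K)ˣ) : Fun K) = HahnSeries.single (-1 : ℤ) 1 - 1 := rfl
  rw [dpow, zpow_one, this, sub_mul, one_mul, HahnSeries.coeff_sub,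
    HahnSeries.coeff_single_mul, one_mul, sub_neg_eq_add]

/-- Injectivity of `Δ` on sequences vanishing near `-∞`, in a local form: only the steps below `p`
are needed. It drives the inductions towards negative powers of `Δ`. -/
lemma eq_zero_of_step {R : Type*} [AddGroup R] {g : ℤ → R} {n₁ p : ℤ} (h₁ : ∀ n < n₁, g n = 0)
    (h : ∀ n < p, g (n + 1) = g n) {n : ℤ} (hn : n ≤ p) : g n = 0 := by
  rcases lt_or_ge n n₁ with h' | h'
  · exact h₁ n h'
  · have key : ∀ m, n₁ - 1 ≤ m → m ≤ p → g m = 0 := by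
      intro m hm
      induction m, hm using Int.leInduction with
      | base => intro _; exact h₁ _ (by omega)
      | succ m hm ih => intro hp; rw [h m (by omega)]; exact ih (by omega)
    exact key n (by omega) hn

/-- Causality: the value of `Δ^m f` at `n` depends only on the sites up to `n + m`, for negative `m`
as well. This makes every infinite sum below finite at each site. -/
lemma coeff_dpow_eq_zero {f : Fun K} {n₀ : ℤ} (hf : ∀ n < n₀, f.coeff n = 0) (m : ℤ) :
    ∀ n < n₀ - m, (dpow m f).coeff n = 0 := by
  induction m using Int.induction_on with
  | zero => simpa using hf
  | succ i ih =>
    intro n hn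
    rw [coeff_dpow_succ, ih _ (by omega), ih _ (by omega), sub_zero]
  | pred i ih =>
    intro n hn
    obtain ⟨n₁, h₁⟩ := (dpow (-(i : ℤ) - 1) f).exists_vanish
    refine eq_zero_of_step (p := n₀ - (-(i : ℤ) - 1) - 1) h₁ (fun k hk => ?_) (by omega)
    have := coeff_dpow_succ (-(i : ℤ) - 1) f k
    rw [sub_add_cancel, ih k (by omega)] at this
    exact (sub_eq_zero.mp this.symm)

/-- Pointwise multiplication of a function which vanishes near `-∞` by a coefficient. -/
def had (g : Coef K) (f : Fun K) : Fun K :=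
  HahnSeries.ofSuppBddBelow (fun n => g n * f.coeff n) (by
    obtain ⟨n₀, h⟩ := f.exists_vanish
    refine ⟨n₀, fun n hn => ?_⟩
    by_contra hlt
    exact hn (by simp [h n (not_le.mp hlt)]))

@[simp] lemma coeff_had (g : Coef K) (f : Fun K) (n : ℤ) :
    (had g f).coeff n = g n * f.coeff n := rfl

/-- Partial sums of the right hand side of the Leibniz rule. -/
def leibnizSum (k : ℤ) (g : Coef K) (f : Fun K) (n : ℤ) (I : ℕ) : MvPowerSeries ℕ+ K :=
  ∑ i ∈ Finset.range I,
    Ring.choose k i • ((diff^[i] (shift (k - i) g)) n * (dpow (k - i) f).coeff n)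

/-- Pascal's rule: the product rule for `Δ` splits each term in two, and the second half is
reindexed by `i + 1`. -/
lemma leibnizSum_succ {f : Fun K} {n₀ : ℤ} (hf : ∀ n < n₀, f.coeff n = 0) (g : Coef K)
    (k n : ℤ) (I : ℕ) (hI : n + 1 - n₀ + k < I) :
    leibnizSum (k + 1) g f n I = leibnizSum k g f (n + 1) I - leibnizSum k g f n I := by
  have e1 : ∀ i : ℕ, (diff^[i] (shift (k - i) g)) (n + 1) = (diff^[i] (shift (k + 1 - i) g)) n := by
    intro i
    have : shift (k + 1 - i) g = shift 1 (shift (k - i) g) := by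
      rw [shift_shift]; congr 1; ring
    rw [this]
    have comm : Function.Commute (diff (K := K)) (shift 1) := fun h => by
      simp only [diff_shift]
    rw [(comm.iterate_left i) (shift (k - i) g)]
    rfl
  have e2 : ∀ i : ℕ, (diff^[i+1] (shift (k - i) g)) n
      = (diff^[i] (shift (k - i) g)) (n + 1) - (diff^[i] (shift (k - i) g)) n := by
    intro i; rw [Function.iterate_succ_apply']; rfl
  have e3 : ∀ i : ℕ, (dpow (k + 1 - i) f).coeff n
      = (dpow (k - i) f).coeff (n + 1) - (dpow (k - i) f).coeff n := by
    intro i; rw [← coeff_dpow_succ]; congr 2; ring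
  have h1 : leibnizSum k g f (n + 1) I - leibnizSum k g f n I
      = ∑ i ∈ Finset.range I, Ring.choose k i •
          ((diff^[i] (shift (k + 1 - i) g)) n * (dpow (k + 1 - i) f).coeff n)
        + ∑ i ∈ Finset.range I, Ring.choose k i •
          ((diff^[i+1] (shift (k - i) g)) n * (dpow (k - i) f).coeff n) := by
    rw [leibnizSum, leibnizSum, ← Finset.sum_sub_distrib, ← Finset.sum_add_distrib]
    refine Finset.sum_congr rfl fun i _ => ?_
    rw [← smul_sub, ← smul_add, e2, e3, ← e1]
    congr 1; ring
  have h2 : ∑ i ∈ Finset.range I, Ring.choose k i •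
          ((diff^[i+1] (shift (k - i) g)) n * (dpow (k - i) f).coeff n)
      = ∑ i ∈ Finset.range (I + 1), (if i = 0 then 0 else Ring.choose k (i - 1)) •
          ((diff^[i] (shift (k + 1 - i) g)) n * (dpow (k + 1 - i) f).coeff n) := by
    rw [Finset.sum_range_succ']
    simp only [Nat.add_eq_zero_iff, one_ne_zero, and_false, if_false, Nat.add_sub_cancel, if_true,
      zero_smul, add_zero, Nat.cast_add, Nat.cast_one, add_sub_add_right_eq_sub]
  -- The reindexing creates one surplus term, with `i = I`; the bound on `I` places the support of
  -- its factor to the right of `n`.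
  have h3 : (dpow (k + 1 - I) f).coeff n = 0 := coeff_dpow_eq_zero hf _ _ (by omega)
  rw [h1, h2, Finset.sum_range_succ, h3, mul_zero, smul_zero, add_zero, leibnizSum,
    ← Finset.sum_add_distrib]
  refine Finset.sum_congr rfl fun i _ => ?_
  rw [← add_smul]
  congr 1
  cases i with
  | zero => simp
  | succ i => simp [Ring.choose_succ_succ, add_comm]

/-- The Leibniz rule as an identity of sequences. Induction on `k` in both directions: upwards by
applying `Δ`, downwards because both sides vanish near `-∞` and have the same difference. -/
lemma coeff_dpow_had {f : Fun K} {n₀ : ℤ} (hf : ∀ n < n₀, f.coeff n = 0) (g : Coef K) (k : ℤ) :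
    ∀ (n : ℤ) (I : ℕ), n - n₀ + k < I →
      (dpow k (had g f)).coeff n = leibnizSum k g f n I := by
  have hg : ∀ n < n₀, (had g f).coeff n = 0 := fun n hn => by simp [hf n hn]
  have hzero : ∀ (k : ℤ) (I : ℕ), ∀ n < n₀ - k, leibnizSum k g f n I = 0 := by
    intro k I n hn
    refine Finset.sum_eq_zero fun i _ => ?_
    rw [coeff_dpow_eq_zero hf _ _ (by omega), mul_zero, smul_zero]
  induction k using Int.induction_on with
  | zero =>
    intro n I hI
    rcases lt_or_ge n n₀ with hn | hn
    · rw [hzero _ _ _ (by omega), dpow_zero, hg n hn]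
    · rw [leibnizSum, Finset.sum_eq_single_of_mem 0 (Finset.mem_range.mpr (by omega))]
      · simp
      · intro i _ hi
        rw [Ring.choose_zero_pos ℤ (Nat.pos_of_ne_zero hi), zero_smul]
  | succ i ih =>
    intro n I hI
    rw [coeff_dpow_succ, ih _ I (by omega), ih _ I (by omega),
      leibnizSum_succ hf _ _ _ _ (by omega)]
  | pred i ih =>
    intro n I hI
    have := eq_zero_of_step (g := fun n' => (dpow (-(i : ℤ) - 1) (had g f)).coeff n'
      - leibnizSum (-(i : ℤ) - 1) g f n' I) (n₁ := n₀ - (-(i : ℤ) - 1)) (p := n) (n := n)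
      (fun n' hn' => by
        rw [hzero _ _ _ hn', coeff_dpow_eq_zero hg _ _ hn', sub_zero])
      (fun n' hn' => by
        have a := coeff_dpow_succ (-(i : ℤ) - 1) (had g f) n'
        have b := leibnizSum_succ hf g (-(i : ℤ) - 1) n' I (by omega)
        rw [sub_add_cancel] at a b
        rw [ih n' I (by omega), b] at a
        linear_combination -a) le_rfl
    exact sub_eq_zero.mp this

/-- The action of a pseudo-difference operator on functions which vanish near `-∞`. -/
def act (A : PDO K) (f : Fun K) : Fun K :=
  HahnSeries.ofSuppBddBelow (fun n => ∑ᶠ m : ℤ, A.coeff m n * (dpow m f).coeff n) (by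
    obtain ⟨n₀, h⟩ := f.exists_vanish
    obtain ⟨N, hN⟩ := A.bdd
    refine ⟨n₀ - N, fun n hn => ?_⟩
    by_contra hlt
    refine hn ?_
    change (∑ᶠ m : ℤ, A.coeff m n * (dpow m f).coeff n) = 0
    rw [← finsum_zero (α := ℤ)]
    refine finsum_congr fun m => ?_
    by_cases hm : N < m
    · simp [hN m hm]
    · rw [coeff_dpow_eq_zero h _ _ (by omega), mul_zero])

lemma coeff_act {A : PDO K} {N : ℤ} (hA : ∀ m, N < m → A.coeff m = 0) {f : Fun K} {n₀ : ℤ}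
    (hf : ∀ n < n₀, f.coeff n = 0) {n a b : ℤ} (ha : a ≤ n₀ - n) (hb : N ≤ b) :
    (act A f).coeff n = ∑ m ∈ Finset.Icc a b, A.coeff m n * (dpow m f).coeff n := by
  refine finsum_eq_sum_of_support_subset _ fun m hm => ?_
  simp only [Finset.coe_Icc, Set.mem_Icc]
  by_contra hlt
  refine hm ?_
  change A.coeff m n * (dpow m f).coeff n = 0
  by_cases h : N < m
  · simp [hA m h]
  · rw [coeff_dpow_eq_zero hf _ _ (by omega), mul_zero]

lemma act_vanish {A : PDO K} {N : ℤ} (hA : ∀ m, N < m → A.coeff m = 0) {f : Fun K} {n₀ : ℤ}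
    (hf : ∀ n < n₀, f.coeff n = 0) : ∀ n < n₀ - N, (act A f).coeff n = 0 := by
  intro n hn
  rw [coeff_act hA hf le_rfl le_rfl, Finset.Icc_eq_empty (by omega), Finset.sum_empty]

/-- Replaces the double `finsum` by a sum over any sufficiently large box, so that sums for
different operators can be compared over a common index set. -/
lemma comp_coeff_eq {A B : PDO K} {N M : ℤ} (hA : ∀ m, N < m → A.coeff m = 0)
    (hB : ∀ m, M < m → B.coeff m = 0) {m k₀ k₁ : ℤ} {I : ℕ} (hk : k₀ ≤ m - M) (hk₁ : N ≤ k₁)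
    (hI : N - m + M < I) :
    (PDO.comp A B).coeff m = ∑ k ∈ Finset.Icc k₀ k₁, ∑ i ∈ Finset.range I,
      Ring.choose k i • (A.coeff k * diff^[i] (shift (k - i) (B.coeff (m - k + i)))) := by
  have inner_zero : ∀ (k : ℤ) (i : ℕ), (N < k ∨ M < m - k + i) →
      Ring.choose k i • (A.coeff k * diff^[i] (shift (k - i) (B.coeff (m - k + i)))) = 0 := by
    rintro k i (h | h)
    · rw [hA _ h, zero_mul, smul_zero]
    · rw [hB _ h, shift_zero, diff_iterate_zero, mul_zero, smul_zero]
  have h1 : ∀ k : ℤ, (∑ᶠ i : ℕ,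
      Ring.choose k i • (A.coeff k * diff^[i] (shift (k - i) (B.coeff (m - k + i)))))
      = ∑ i ∈ Finset.range I,
      Ring.choose k i • (A.coeff k * diff^[i] (shift (k - i) (B.coeff (m - k + i)))) := by
    intro k
    refine finsum_eq_sum_of_support_subset _ fun i hi => ?_
    simp only [Finset.coe_range, Set.mem_Iio]
    by_contra hlt
    exact hi (inner_zero k i (by omega))
  change (∑ᶠ k : ℤ, ∑ᶠ i : ℕ, _) = _
  rw [finsum_congr h1]
  refine finsum_eq_sum_of_support_subset _ fun k hk' => ?_
  simp only [Finset.coe_Icc, Set.mem_Icc]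
  by_contra hlt
  exact hk' (Finset.sum_eq_zero fun i _ => inner_zero k i (by omega))

/-- Both sides become one triple sum of terms `F k l i`. The left side groups them by the total
power `m = k - i + l`; the right side obtains them from the Leibniz rule for `Δ^k` applied to `b_l
Δ^l f`. -/
lemma act_comp (A B : PDO K) (f : Fun K) : act (PDO.comp A B) f = act A (act B f) := by
  obtain ⟨N, hN⟩ := A.bdd
  obtain ⟨M, hM⟩ := B.bdd
  obtain ⟨n₀, hf⟩ := f.exists_vanish
  ext1; funext n
  have hNM : ∀ m, N + M < m → (PDO.comp A B).coeff m = 0 := by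
    intro m hm
    rw [comp_coeff_eq hN hM (k₀ := m - M) (I := 0) le_rfl le_rfl (by push_cast; omega)]
    simp
  obtain ⟨I, hI⟩ : ∃ I : ℕ, n - n₀ + N + M < I := ⟨(n - n₀ + N + M + 1).toNat, by omega⟩
  set F : ℤ → ℤ → ℕ → MvPowerSeries ℕ+ K := fun k l i =>
    Ring.choose k i • (A.coeff k n * (diff^[i] (shift (k - i) (B.coeff l)) n *
      (dpow (k - i + l) f).coeff n)) with hF
  have Fzero : ∀ (k l : ℤ) (i : ℕ), M < l ∨ n < n₀ - (k - i + l) → F k l i = 0 := by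
    rintro k l i (h | h)
    · simp [hF, hM l h]
    · simp [hF, coeff_dpow_eq_zero hf _ _ h]
  have lhs : (act (PDO.comp A B) f).coeff n = ∑ k ∈ Finset.Icc (n₀ - n - M) N,
      ∑ i ∈ Finset.range I, ∑ᶠ l : ℤ, F k l i := by
    rw [coeff_act hNM hf le_rfl le_rfl]
    have : ∀ m ∈ Finset.Icc (n₀ - n) (N + M),
        (PDO.comp A B).coeff m n * (dpow m f).coeff n
        = ∑ k ∈ Finset.Icc (n₀ - n - M) N, ∑ i ∈ Finset.range I, F k (m - k + i) i := by
      intro m hm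
      rw [Finset.mem_Icc] at hm
      rw [comp_coeff_eq hN hM (k₀ := n₀ - n - M) (I := I) (by omega) le_rfl (by omega),
        Finset.sum_apply, Finset.sum_mul]
      refine Finset.sum_congr rfl fun k _ => ?_
      rw [Finset.sum_apply, Finset.sum_mul]
      refine Finset.sum_congr rfl fun i _ => ?_
      have : k - i + (m - k + i) = m := by ring
      simp only [hF, this, Pi.smul_apply, Pi.mul_apply, smul_mul_assoc, mul_assoc]
    rw [Finset.sum_congr rfl this, Finset.sum_comm]
    refine Finset.sum_congr rfl fun k hk => ?_
    rw [Finset.mem_Icc] at hk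
    rw [Finset.sum_comm]
    refine Finset.sum_congr rfl fun i hi => ?_
    have e : (∑ᶠ l : ℤ, F k l i) = ∑ᶠ m : ℤ, F k (m - k + i) i := by
      rw [← finsum_comp_equiv (Equiv.addRight (-k + i : ℤ))]
      refine finsum_congr fun m => ?_
      simp only [Equiv.coe_addRight]
      congr 1; ring
    rw [e]
    symm
    refine finsum_eq_sum_of_support_subset _ fun m hm => ?_
    simp only [Finset.coe_Icc, Set.mem_Icc]
    by_contra hlt
    exact hm (Fzero _ _ _ (by omega))
  have rhs : (act A (act B f)).coeff n = ∑ k ∈ Finset.Icc (n₀ - n - M) N,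
      ∑ i ∈ Finset.range I, ∑ᶠ l : ℤ, F k l i := by
    rw [coeff_act hN (act_vanish hM hf) (a := n₀ - n - M) (by omega) le_rfl]
    refine Finset.sum_congr rfl fun k hk => ?_
    rw [Finset.mem_Icc] at hk
    have hg : (dpow k (act B f)).coeff n
        = ∑ l ∈ Finset.Icc (n₀ - n - N) M,
          (dpow k (had (B.coeff l) (dpow l f))).coeff n := by
      -- The truncated sum over `l` agrees with `act B f` only on sites up to `n + N`; by causality
      -- that is all `Δ^k`, `k ≤ N`, sees from `n`.
      have hv : ∀ n' < n₀ - (n₀ - n - N) + 1,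
          (act B f - ∑ l ∈ Finset.Icc (n₀ - n - N) M, had (B.coeff l) (dpow l f)).coeff n' = 0 := by
        intro n' hn'
        rw [HahnSeries.coeff_sub, coeff_act hM hf (a := n₀ - n - N) (by omega) le_rfl,
          HahnSeries.coeff_sum]
        simp
      have := coeff_dpow_eq_zero hv k n (by omega)
      rw [dpow_sub, HahnSeries.coeff_sub, dpow_sum, HahnSeries.coeff_sum] at this
      exact sub_eq_zero.mp this
    rw [hg, Finset.mul_sum]
    have : ∀ l ∈ Finset.Icc (n₀ - n - N) M,
        A.coeff k n * (dpow k (had (B.coeff l) (dpow l f))).coeff n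
        = ∑ i ∈ Finset.range I, F k l i := by
      intro l hl
      rw [Finset.mem_Icc] at hl
      rw [coeff_dpow_had (coeff_dpow_eq_zero hf l) (B.coeff l) k n I (by omega), leibnizSum,
        Finset.mul_sum]
      refine Finset.sum_congr rfl fun i _ => ?_
      simp only [hF, dpow_dpow, mul_smul_comm]
    rw [Finset.sum_congr rfl this, Finset.sum_comm]
    refine Finset.sum_congr rfl fun i hi => ?_
    symm
    refine finsum_eq_sum_of_support_subset _ fun l hl => ?_
    simp only [Finset.coe_Icc, Set.mem_Icc]
    by_contra hlt
    exact hl (Fzero _ _ _ (by omega))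
  rw [lhs, rhs]

lemma coeff_dpow_single (p m : ℤ) :
    (dpow m (HahnSeries.single p (1 : MvPowerSeries ℕ+ K))).coeff (p - m) = 1 := by
  have hs : ∀ n < p, (HahnSeries.single p (1 : MvPowerSeries ℕ+ K)).coeff n = 0 :=
    fun n hn => HahnSeries.coeff_single_of_ne (by omega)
  induction m using Int.induction_on with
  | zero => simp
  | succ i ih =>
    rw [coeff_dpow_succ, coeff_dpow_eq_zero hs _ (p - (i + 1)) (by omega), sub_zero,
      show p - ((i : ℤ) + 1) + 1 = p - i by ring, ih]
  | pred i ih =>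
    have := coeff_dpow_succ (-(i : ℤ) - 1) (HahnSeries.single p (1 : MvPowerSeries ℕ+ K))
      (p - -(i : ℤ))
    rw [sub_add_cancel, ih, coeff_dpow_eq_zero hs _ (p - -(i : ℤ)) (by omega), sub_zero] at this
    rw [show p - (-(i : ℤ) - 1) = p - -(i : ℤ) + 1 by ring, ← this]

/-- Faithfulness. At site `n`, the delta function at `n + m` is sent to 1 by `Δ^m` and to 0 by all
lower powers, so the coefficients can be read off one after another from the top. -/
lemma eq_of_act {A B : PDO K} (h : ∀ f, act A f = act B f) : A = B := by
  obtain ⟨N₁, h₁⟩ := A.bdd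
  obtain ⟨N₂, h₂⟩ := B.bdd
  set N := max N₁ N₂ with hN
  have hA : ∀ m, N < m → A.coeff m = 0 := fun m hm => h₁ m (by omega)
  have hB : ∀ m, N < m → B.coeff m = 0 := fun m hm => h₂ m (by omega)
  have key : ∀ j : ℕ, ∀ m, N - j < m → A.coeff m = B.coeff m := by
    intro j
    induction j with
    | zero => intro m hm; rw [hA m (by simpa using hm), hB m (by simpa using hm)]
    | succ j ih =>
      intro m hm
      rcases lt_or_ge (N - j) m with hm' | hm'
      · exact ih m hm'
      · funext n
        have hs : ∀ n' < n + m, (HahnSeries.single (n + m) (1 : MvPowerSeries ℕ+ K)).coeff n' = 0 :=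
          fun n' hn => HahnSeries.coeff_single_of_ne (by omega)
        have := congrArg (fun f => HahnSeries.coeff f n) (h (HahnSeries.single (n + m) 1))
        rw [coeff_act hA hs (a := m) (b := N) (by omega) le_rfl,
          coeff_act hB hs (a := m) (b := N) (by omega) le_rfl,
          ← Finset.add_sum_erase _ _ (Finset.left_mem_Icc.mpr (by push_cast at hm; omega)),
          ← Finset.add_sum_erase _ _ (Finset.left_mem_Icc.mpr (by push_cast at hm; omega))] at this
        have e : ∑ x ∈ (Finset.Icc m N).erase m, A.coeff x n *
            (dpow x (HahnSeries.single (n + m) (1 : MvPowerSeries ℕ+ K))).coeff n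
            = ∑ x ∈ (Finset.Icc m N).erase m, B.coeff x n *
            (dpow x (HahnSeries.single (n + m) (1 : MvPowerSeries ℕ+ K))).coeff n := by
          refine Finset.sum_congr rfl fun x hx => ?_
          rw [Finset.mem_erase, Finset.mem_Icc] at hx
          rw [ih x (by push_cast at hm; omega)]
        have d := coeff_dpow_single (K := K) (n + m) m
        rw [add_sub_cancel_right] at d
        rw [e, d, mul_one, mul_one] at this
        exact add_right_cancel this
  ext1; funext m
  exact key (N - m + 1).toNat m (by omega)

end Representation

end DMKP

end

noncomputable section

namespace DMKP

/-! ### The ring of pseudo-difference operators and its derivations -/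

section OperatorAlgebra

variable {K : Type*} [Field K]

namespace OpSeries

instance : Zero (OpSeries K) := ⟨⟨fun _ => 0, 0, fun _ _ => rfl⟩⟩

instance : Add (OpSeries K) := ⟨fun A B => ⟨fun m => A.coeff m + B.coeff m, by
  obtain ⟨N, hN⟩ := A.bdd
  obtain ⟨M, hM⟩ := B.bdd
  exact ⟨max N M, fun m hm => by rw [hN m (by omega), hM m (by omega), add_zero]⟩⟩⟩

instance : Neg (OpSeries K) := ⟨fun A => ⟨fun m => -A.coeff m, by
  obtain ⟨N, hN⟩ := A.bdd
  exact ⟨N, fun m hm => by rw [hN m hm, neg_zero]⟩⟩⟩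

instance : Sub (OpSeries K) := ⟨fun A B => ⟨fun m => A.coeff m - B.coeff m, by
  obtain ⟨N, hN⟩ := A.bdd
  obtain ⟨M, hM⟩ := B.bdd
  exact ⟨max N M, fun m hm => by rw [hN m (by omega), hM m (by omega), sub_zero]⟩⟩⟩

instance {S : Type*} [SMulZeroClass S (Coef K)] : SMul S (OpSeries K) :=
  ⟨fun c A => ⟨fun m => c • A.coeff m, by
    obtain ⟨N, hN⟩ := A.bdd
    exact ⟨N, fun m hm => by rw [hN m hm, smul_zero]⟩⟩⟩

lemma coeff_injective : Function.Injective (coeff : OpSeries K → ℤ → Coef K) :=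
  fun _ _ h => OpSeries.ext h

instance : AddCommGroup (OpSeries K) :=
  coeff_injective.addCommGroup coeff rfl (fun _ _ => rfl) (fun _ => rfl) (fun _ _ => rfl)
    (fun _ _ => rfl) (fun _ _ => rfl)

/-- The coefficients, as an additive homomorphism. -/
def coeffAddHom : OpSeries K →+ (ℤ → Coef K) where
  toFun := coeff
  map_zero' := rfl
  map_add' _ _ := rfl

instance : Module K (OpSeries K) :=
  coeff_injective.module K coeffAddHom (fun _ _ => rfl)

@[simp] lemma coeff_zero (m : ℤ) : (0 : OpSeries K).coeff m = 0 := rfl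
@[simp] lemma coeff_add (A B : OpSeries K) (m : ℤ) :
    (A + B).coeff m = A.coeff m + B.coeff m := rfl
@[simp] lemma coeff_neg (A : OpSeries K) (m : ℤ) : (-A).coeff m = -A.coeff m := rfl
@[simp] lemma coeff_sub (A B : OpSeries K) (m : ℤ) :
    (A - B).coeff m = A.coeff m - B.coeff m := rfl
@[simp] lemma coeff_smul (c : K) (A : OpSeries K) (m : ℤ) :
    (c • A).coeff m = c • A.coeff m := rfl

/-- The coefficient of the `m`-th power as a linear map. -/
def coeffHom (m : ℤ) : OpSeries K →ₗ[K] Coef K where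
  toFun A := A.coeff m
  map_add' _ _ := rfl
  map_smul' _ _ := rfl

/-- The operator has no powers above the `N`-th. -/
def OrdLE (A : OpSeries K) (N : ℤ) : Prop := ∀ m, N < m → A.coeff m = 0

/-- The operator has no powers below the `p`-th. -/
def OrdGE (A : OpSeries K) (p : ℤ) : Prop := ∀ m, m < p → A.coeff m = 0

lemma OrdLE.mono {A : OpSeries K} {N M : ℤ} (h : A.OrdLE N) (hNM : N ≤ M) : A.OrdLE M :=
  fun m hm => h m (by omega)

lemma OrdGE.mono {A : OpSeries K} {N M : ℤ} (h : A.OrdGE N) (hNM : M ≤ N) : A.OrdGE M :=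
  fun m hm => h m (by omega)

lemma OrdLE.add {A B : OpSeries K} {N : ℤ} (hA : A.OrdLE N) (hB : B.OrdLE N) :
    (A + B).OrdLE N := fun m hm => by rw [coeff_add, hA m hm, hB m hm, add_zero]

lemma OrdLE.sub {A B : OpSeries K} {N : ℤ} (hA : A.OrdLE N) (hB : B.OrdLE N) :
    (A - B).OrdLE N := fun m hm => by rw [coeff_sub, hA m hm, hB m hm, sub_zero]

lemma OrdGE.add {A B : OpSeries K} {N : ℤ} (hA : A.OrdGE N) (hB : B.OrdGE N) :
    (A + B).OrdGE N := fun m hm => by rw [coeff_add, hA m hm, hB m hm, add_zero]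

lemma OrdGE.sub {A B : OpSeries K} {N : ℤ} (hA : A.OrdGE N) (hB : B.OrdGE N) :
    (A - B).OrdGE N := fun m hm => by rw [coeff_sub, hA m hm, hB m hm, sub_zero]

end OpSeries

open OpSeries

/-- `Δ^i Γ^j` as a linear map. -/
def diffShift (i : ℕ) (j : ℤ) : Coef K →ₗ[K] Coef K where
  toFun f := diff^[i] (shift j f)
  map_add' f g := by
    rw [shift_add]
    have : (diff : Coef K → Coef K) = diffHom := rfl
    rw [this, ← Module.End.pow_apply, ← Module.End.pow_apply, ← Module.End.pow_apply, map_add]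
  map_smul' c f := by
    have h : shift j (c • f) = c • shift j f := rfl
    have : (diff : Coef K → Coef K) = diffHom := rfl
    rw [h, this, ← Module.End.pow_apply, ← Module.End.pow_apply, map_smul, RingHom.id_apply]

lemma diffShift_apply (i : ℕ) (j : ℤ) (f : Coef K) :
    diffShift i j f = diff^[i] (shift j f) := rfl

lemma comp_coeff_diffShift {A B : PDO K} {N M : ℤ} (hA : A.OrdLE N)
    (hB : B.OrdLE M) {m k₀ k₁ : ℤ} {I : ℕ} (hk : k₀ ≤ m - M) (hk₁ : N ≤ k₁)
    (hI : N - m + M < I) :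
    (PDO.comp A B).coeff m = ∑ k ∈ Finset.Icc k₀ k₁, ∑ i ∈ Finset.range I,
      Ring.choose k i • (A.coeff k * diffShift i (k - i) (B.coeff (m - k + i))) :=
  comp_coeff_eq hA hB hk hk₁ hI

lemma exists_ordLE₂ (A B : PDO K) : ∃ N, A.OrdLE N ∧ B.OrdLE N := by
  obtain ⟨N, hN⟩ := A.bdd
  obtain ⟨M, hM⟩ := B.bdd
  exact ⟨max N M, fun m hm => hN m (by omega), fun m hm => hM m (by omega)⟩

namespace PDO

lemma coeff_comp_mono (g : Coef K) (k : ℤ) (B : PDO K) (m : ℤ) :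
    (comp (mono g k) B).coeff m = ∑ᶠ i : ℕ,
      Ring.choose k i • (g * diffShift i (k - i) (B.coeff (m - k + i))) := by
  change (∑ᶠ k' : ℤ, ∑ᶠ i : ℕ, _) = _
  rw [finsum_eq_single _ k]
  · refine finsum_congr fun i => ?_
    simp [mono, diffShift_apply]
  · intro k' hk'
    rw [← finsum_zero (α := ℕ)]
    refine finsum_congr fun i => ?_
    simp [mono, hk']

lemma coeff_comp_mulOp_left (g : Coef K) (B : PDO K) (m : ℤ) :
    (comp (mulOp g) B).coeff m = g * B.coeff m := by
  rw [mulOp, coeff_comp_mono, finsum_eq_single _ 0]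
  · simp [diffShift_apply]
  · intro i hi
    rw [Ring.choose_zero_pos ℤ (Nat.pos_of_ne_zero hi), zero_smul]

lemma coeff_comp_delta_one_left (B : PDO K) (m : ℤ) :
    (comp (delta 1) B).coeff m = shift 1 (B.coeff (m - 1)) + diff (B.coeff m) := by
  rw [delta, coeff_comp_mono, finsum_eq_sum_of_support_subset (s := Finset.range 2)]
  · simp [Finset.sum_range_succ, diffShift_apply]
  · intro i hi
    simp only [Finset.coe_range, Set.mem_Iio]
    by_contra hlt
    refine hi ?_
    have : Ring.choose (1 : ℤ) i = 0 := by
      have h := Ring.choose_natCast (R := ℤ) 1 i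
      rw [Nat.choose_eq_zero_of_lt (by omega)] at h
      simpa using h
    simp only [this, zero_smul]

lemma diff_iterate_one {i : ℕ} (hi : i ≠ 0) : diff^[i] (1 : Coef K) = 0 := by
  obtain ⟨j, rfl⟩ := Nat.exists_eq_succ_of_ne_zero hi
  rw [Function.iterate_succ_apply, diff_one, diff_iterate_zero]

lemma coeff_comp_delta_right (A : PDO K) (j m : ℤ) :
    (comp A (delta j)).coeff m = A.coeff (m - j) := by
  change (∑ᶠ k : ℤ, ∑ᶠ i : ℕ, _) = _
  have h : ∀ k : ℤ, ∀ i : ℕ, i ≠ 0 ∨ k ≠ m - j → Ring.choose k i •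
      (A.coeff k * diff^[i] (shift (k - i) ((delta (K := K) j).coeff (m - k + i)))) = 0 := by
    intro k i hki
    by_cases hm : m - k + i = j
    · have hi : i ≠ 0 := by omega
      simp [delta, mono, hm, diff_iterate_one hi]
    · simp [delta, mono, hm]
  rw [finsum_eq_single _ (m - j), finsum_eq_single _ 0]
  · simp [delta, mono]
  · intro i hi
    exact h _ _ (Or.inl hi)
  · intro k hk
    rw [← finsum_zero (α := ℕ)]
    exact finsum_congr fun i => h _ _ (Or.inr hk)

lemma delta_zero_eq : (delta 0 : PDO K) = mulOp 1 := rfl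

end PDO

open PDO

instance : Mul (OpSeries K) := ⟨PDO.comp⟩
instance : One (OpSeries K) := ⟨PDO.delta 0⟩

lemma mul_def (A B : PDO K) : A * B = PDO.comp A B := rfl
lemma one_def : (1 : PDO K) = PDO.delta 0 := rfl

lemma op_mul_add (A B C : PDO K) : A * (B + C) = A * B + A * C := by
  obtain ⟨N, hN⟩ := A.bdd
  obtain ⟨M, hB, hC⟩ := exists_ordLE₂ B C
  ext1; funext m
  obtain ⟨I, hI⟩ : ∃ I : ℕ, N - m + M < I := ⟨(N - m + M + 1).toNat, by omega⟩
  simp only [mul_def, coeff_add,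
    comp_coeff_diffShift hN hB (k₀ := m - M) le_rfl le_rfl hI,
    comp_coeff_diffShift hN hC (k₀ := m - M) le_rfl le_rfl hI,
    comp_coeff_diffShift hN (hB.add hC) (k₀ := m - M) le_rfl le_rfl hI,
    map_add, mul_add, smul_add, Finset.sum_add_distrib]

lemma op_add_mul (A B C : PDO K) : (A + B) * C = A * C + B * C := by
  obtain ⟨N, hN⟩ := C.bdd
  obtain ⟨M, hA, hB⟩ := exists_ordLE₂ A B
  ext1; funext m
  obtain ⟨I, hI⟩ : ∃ I : ℕ, M - m + N < I := ⟨(M - m + N + 1).toNat, by omega⟩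
  simp only [mul_def, coeff_add,
    comp_coeff_diffShift hA hN (k₀ := m - N) le_rfl le_rfl hI,
    comp_coeff_diffShift hB hN (k₀ := m - N) le_rfl le_rfl hI,
    comp_coeff_diffShift (hA.add hB) hN (k₀ := m - N) le_rfl le_rfl hI,
    add_mul, smul_add, Finset.sum_add_distrib]

instance : Ring (OpSeries K) where
  __ := (inferInstance : AddCommGroup (OpSeries K))
  -- Composition of maps is associative and the action is faithful, so no identity between triple
  -- sums of binomials is needed.
  mul_assoc A B C := eq_of_act fun f => by
    simp only [mul_def, act_comp]
  one_mul A := by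
    ext1; funext m
    rw [mul_def, one_def, delta_zero_eq, coeff_comp_mulOp_left, one_mul]
  mul_one A := by
    ext1; funext m
    rw [mul_def, one_def, coeff_comp_delta_right, sub_zero]
  left_distrib := op_mul_add
  right_distrib := op_add_mul
  zero_mul A := by
    have h := op_add_mul 0 0 A
    rw [add_zero] at h
    exact left_eq_add.mp h
  mul_zero A := by
    have h := op_mul_add A 0 0
    rw [add_zero] at h
    exact left_eq_add.mp h
  zsmul := (inferInstance : AddCommGroup (OpSeries K)).zsmul
  zsmul_zero' := (inferInstance : AddCommGroup (OpSeries K)).zsmul_zero'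
  zsmul_succ' := (inferInstance : AddCommGroup (OpSeries K)).zsmul_succ'
  zsmul_neg' := (inferInstance : AddCommGroup (OpSeries K)).zsmul_neg'
  neg_add_cancel := neg_add_cancel

instance : IsScalarTower K (OpSeries K) (OpSeries K) := ⟨fun c A B => by
  obtain ⟨N, hA, hB⟩ := exists_ordLE₂ A B
  have hcA : (c • A).OrdLE N := fun m hm => by rw [coeff_smul, hA m hm, smul_zero]
  ext1; funext m
  obtain ⟨I, hI⟩ : ∃ I : ℕ, N - m + N < I := ⟨(N - m + N + 1).toNat, by omega⟩
  simp only [smul_eq_mul, mul_def, coeff_smul,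
    comp_coeff_diffShift hA hB (k₀ := m - N) le_rfl le_rfl hI,
    comp_coeff_diffShift hcA hB (k₀ := m - N) le_rfl le_rfl hI,
    smul_mul_assoc, Finset.smul_sum, smul_comm c]⟩

instance : SMulCommClass K (OpSeries K) (OpSeries K) := ⟨fun c A B => by
  obtain ⟨N, hA, hB⟩ := exists_ordLE₂ A B
  have hcB : (c • B).OrdLE N := fun m hm => by rw [coeff_smul, hB m hm, smul_zero]
  ext1; funext m
  obtain ⟨I, hI⟩ : ∃ I : ℕ, N - m + N < I := ⟨(N - m + N + 1).toNat, by omega⟩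
  simp only [smul_eq_mul, mul_def, coeff_smul,
    comp_coeff_diffShift hA hB (k₀ := m - N) le_rfl le_rfl hI,
    comp_coeff_diffShift hA hcB (k₀ := m - N) le_rfl le_rfl hI,
    map_smul, mul_smul_comm, Finset.smul_sum, smul_comm c]⟩

lemma npow_eq_pow (A : PDO K) (i : ℕ) : PDO.npow A i = A ^ i := by
  induction i with
  | zero => rw [pow_zero]; rfl
  | succ i ih => rw [pow_succ', ← ih]; rfl

lemma coeff_mul_delta (A : PDO K) (j m : ℤ) : (A * delta j).coeff m = A.coeff (m - j) :=
  coeff_comp_delta_right A j m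

lemma coeff_mulOp_mul (g : Coef K) (A : PDO K) (m : ℤ) :
    (mulOp g * A).coeff m = g * A.coeff m := coeff_comp_mulOp_left g A m

lemma coeff_delta_one_mul (B : PDO K) (m : ℤ) :
    (delta 1 * B).coeff m = shift 1 (B.coeff (m - 1)) + diff (B.coeff m) :=
  coeff_comp_delta_one_left B m

lemma coeff_mono (g : Coef K) (k m : ℤ) : (mono g k).coeff m = if m = k then g else 0 := rfl

lemma coeff_delta (k m : ℤ) : (delta k : PDO K).coeff m = if m = k then 1 else 0 := rfl

lemma coeff_mulOp (g : Coef K) (m : ℤ) : (mulOp g).coeff m = if m = 0 then g else 0 := rfl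

lemma mulOp_mul_delta (g : Coef K) (k : ℤ) : mulOp g * delta k = mono g k := by
  ext1; funext m
  rw [coeff_mulOp_mul, coeff_delta, coeff_mono]
  split_ifs <;> simp

lemma delta_mul_delta (a b : ℤ) : (delta a * delta b : PDO K) = delta (a + b) := by
  ext1; funext m
  rw [coeff_mul_delta, coeff_delta, coeff_delta]
  congr 1
  simp [sub_eq_iff_eq_add]

lemma delta_pow (i : ℕ) : (delta 1 : PDO K) ^ i = delta i := by
  induction i with
  | zero => rw [pow_zero]; rfl
  | succ i ih => rw [pow_succ, ih, delta_mul_delta]; simp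

lemma mulOp_mul_mulOp (f g : Coef K) : mulOp f * mulOp g = mulOp (f * g) := by
  ext1; funext m
  rw [coeff_mulOp_mul, coeff_mulOp, coeff_mulOp]
  split_ifs <;> simp

lemma delta_one_mul_mulOp (f : Coef K) :
    delta 1 * mulOp f = mulOp (shift 1 f) * delta 1 + mulOp (diff f) := by
  ext1; funext m
  rw [coeff_delta_one_mul, coeff_add, coeff_mulOp_mul, coeff_mulOp, coeff_mulOp, coeff_mulOp,
    coeff_delta]
  by_cases h1 : m = 1
  · simp [h1]
  · by_cases h0 : m = 0
    · simp [h0]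
    · have : m - 1 ≠ 0 := by omega
      simp [h1, h0, this]

lemma OpSeries.OrdLE.mul {A B : PDO K} {N M : ℤ} (hA : A.OrdLE N) (hB : B.OrdLE M) :
    (A * B).OrdLE (N + M) := by
  intro m hm
  rw [mul_def, comp_coeff_eq hA hB (k₀ := m - M) (I := 0) le_rfl le_rfl (by push_cast; omega)]
  simp

lemma coeff_mul_top {A B : PDO K} {N M : ℤ} (hA : A.OrdLE N) (hB : B.OrdLE M) :
    (A * B).coeff (N + M) = A.coeff N * shift N (B.coeff M) := by
  rw [mul_def, comp_coeff_eq hA hB (k₀ := N) (I := 1) (by omega) le_rfl (by push_cast; omega)]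
  simp

lemma ringChoose_natCast (k i : ℕ) : Ring.choose (k : ℤ) i = (k.choose i : ℤ) := by
  simpa using Ring.choose_natCast (R := ℤ) k i

/-- For `k ≥ 0` the Leibniz expansion of `Δ^k ∘ g` stops at `i = k`, since the binomial coefficient
vanishes beyond; no negative powers are created. -/
lemma OpSeries.OrdGE.mul {A B : PDO K} {p : ℤ} (hA : A.OrdGE 0) (hB : B.OrdGE p) :
    (A * B).OrdGE p := by
  intro m hm
  change (∑ᶠ k : ℤ, ∑ᶠ i : ℕ, _) = _
  rw [← finsum_zero (α := ℤ)]
  refine finsum_congr fun k => ?_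
  rw [← finsum_zero (α := ℕ)]
  refine finsum_congr fun i => ?_
  rcases lt_or_ge k 0 with hk | hk
  · rw [hA k hk, zero_mul, smul_zero]
  · lift k to ℕ using hk
    rcases lt_or_ge k i with hi | hi
    · rw [ringChoose_natCast, Nat.choose_eq_zero_of_lt hi]; simp
    · rw [hB _ (by omega), shift_zero, diff_iterate_zero, mul_zero, smul_zero]

lemma ordLE_delta (k : ℤ) : (delta k : PDO K).OrdLE k := fun _ hm => if_neg hm.ne'

lemma ordGE_delta (k : ℤ) : (delta k : PDO K).OrdGE k := fun _ hm => if_neg hm.ne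

lemma ordGE_mulOp (g : Coef K) : (mulOp g).OrdGE 0 := fun _ hm => if_neg hm.ne

lemma ordGE_posPart (A : PDO K) : (PDO.posPart A).OrdGE 1 := fun _ hm => if_neg (not_le.mpr hm)

lemma nonposPart_eq (A : PDO K) : nonposPart A = A - PDO.posPart A := by
  ext1; funext m
  change (if m ≤ 0 then A.coeff m else 0) = A.coeff m - (if 1 ≤ m then A.coeff m else 0)
  rcases le_or_gt m 0 with h | h
  · rw [if_pos h, if_neg (by omega), sub_zero]
  · rw [if_neg (by omega), if_pos (by omega), sub_self]

/-- Induction for difference operators with non-negative powers only. -/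
lemma nonneg_induction {P : PDO K → Prop} (hadd : ∀ A B, P A → P B → P (A + B))
    (hmul : ∀ g, P (mulOp g)) (hdelta : ∀ A, A.OrdGE 0 → P A → P (A * delta 1))
    (A : PDO K) (hA : A.OrdGE 0) : P A := by
  obtain ⟨N, hN⟩ := A.bdd
  have key : ∀ (N : ℕ) (A : PDO K), A.OrdGE 0 → A.OrdLE N → P A := by
    intro N
    induction N with
    | zero =>
      intro A hA hN
      have : A = mulOp (A.coeff 0) := by
        ext1; funext m
        rw [coeff_mulOp]
        split_ifs with h
        · rw [h]
        · rcases lt_or_gt_of_ne h with h | h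
          · exact hA m h
          · exact hN m (by simpa using h)
      rw [this]
      exact hmul _
    | succ N ih =>
      intro A hA hN
      let A' : PDO K := ⟨fun m => if 0 ≤ m then A.coeff (m + 1) else 0, N, fun m hm => by
        rw [hN (m + 1) (by push_cast; omega)]; simp⟩
      have hA' : A'.OrdGE 0 := fun m hm => if_neg (not_le.mpr hm)
      have hA'N : A'.OrdLE N := fun m hm => by
        change (if 0 ≤ m then A.coeff (m + 1) else 0) = 0
        rw [hN (m + 1) (by push_cast; omega)]; simp
      have : A = mulOp (A.coeff 0) + A' * delta 1 := by
        ext1; funext m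
        rw [coeff_add, coeff_mulOp, coeff_mul_delta]
        change _ = _ + (if 0 ≤ m - 1 then A.coeff (m - 1 + 1) else 0)
        rw [sub_add_cancel]
        rcases lt_trichotomy m 0 with h | h | h
        · rw [hA m h, if_neg h.ne, if_neg (by omega), add_zero]
        · rw [if_pos h, if_neg (by omega), add_zero, h]
        · rw [if_neg h.ne', if_pos (by omega), zero_add]
      rw [this]
      exact hadd _ _ (hmul _) (hdelta _ hA' (ih _ hA' hA'N))
  exact key N.toNat A hA fun m hm => hN m (by omega)

/-- The derivation `∂ / ∂ t_i` of coefficient functions, as a linear map. -/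
def dtHom (i : ℕ+) : Coef K →ₗ[K] Coef K where
  toFun := dt i
  map_add' f g := by funext n; simp [dt]
  map_smul' c f := by funext n; simp [dt]

lemma dtHom_apply (i : ℕ+) (f : Coef K) : dtHom i f = dt i f := rfl

lemma dt_mul (i : ℕ+) (f g : Coef K) : dt i (f * g) = dt i f * g + f * dt i g := by
  funext n
  simp only [dt, Pi.mul_apply, Pi.add_apply, Derivation.leibniz, smul_eq_mul]
  ring

lemma dt_add (i : ℕ+) (f g : Coef K) : dt i (f + g) = dt i f + dt i g := (dtHom i).map_add f g
lemma dt_sub (i : ℕ+) (f g : Coef K) : dt i (f - g) = dt i f - dt i g := (dtHom i).map_sub f g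
lemma dt_neg (i : ℕ+) (f : Coef K) : dt i (-f) = -dt i f := (dtHom i).map_neg f
@[simp] lemma dt_zero (i : ℕ+) : dt i (0 : Coef K) = 0 := (dtHom i).map_zero
@[simp] lemma dt_one (i : ℕ+) : dt i (1 : Coef K) = 0 := by
  funext n; exact MvPowerSeries.pderiv_one

lemma dt_shift (i : ℕ+) (k : ℤ) (f : Coef K) : dt i (shift k f) = shift k (dt i f) := rfl

lemma dt_diff (i : ℕ+) (f : Coef K) : dt i (diff f) = diff (dt i f) := by
  rw [diff_eq, dt_sub, dt_shift, ← diff_eq]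

lemma dt_diffShift (i : ℕ+) (j : ℕ) (k : ℤ) (f : Coef K) :
    dt i (diffShift j k f) = diffShift j k (dt i f) := by
  rw [diffShift_apply, diffShift_apply, ← dt_shift]
  have comm : Function.Commute (diff (K := K)) (dt i) := fun h => (dt_diff i h).symm
  exact ((comm.iterate_left j) (shift k f)).symm

lemma dt_const (i : ℕ+) (c : K) : dt i (const c) = 0 := by
  funext n; exact MvPowerSeries.pderiv_C

/-- The derivation `∂ / ∂ t_i` of the coefficients of an operator. -/
def dtOp (i : ℕ+) : OpSeries K →ₗ[K] OpSeries K where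
  toFun A := ⟨fun m => dt i (A.coeff m), by
    obtain ⟨N, hN⟩ := A.bdd
    exact ⟨N, fun m hm => by rw [hN m hm, dt_zero]⟩⟩
  map_add' A B := by ext1; funext m; exact dt_add i _ _
  map_smul' c A := by ext1; funext m; exact (dtHom i).map_smul c _

@[simp] lemma coeff_dtOp (i : ℕ+) (A : OpSeries K) (m : ℤ) :
    (dtOp i A).coeff m = dt i (A.coeff m) := rfl

lemma OpSeries.OrdLE.deriv {A : OpSeries K} {N : ℤ} (h : A.OrdLE N) (i : ℕ+) : (dtOp i A).OrdLE N :=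
  fun m hm => by rw [coeff_dtOp, h m hm, dt_zero]

lemma OpSeries.OrdGE.deriv {A : OpSeries K} {N : ℤ} (h : A.OrdGE N) (i : ℕ+) : (dtOp i A).OrdGE N :=
  fun m hm => by rw [coeff_dtOp, h m hm, dt_zero]

lemma dtOp_mul (i : ℕ+) (A B : PDO K) : dtOp i (A * B) = dtOp i A * B + A * dtOp i B := by
  obtain ⟨N, hA, hB⟩ := exists_ordLE₂ A B
  ext1; funext m
  obtain ⟨I, hI⟩ : ∃ I : ℕ, N - m + N < I := ⟨(N - m + N + 1).toNat, by omega⟩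
  simp only [mul_def, coeff_add, coeff_dtOp,
    comp_coeff_diffShift hA hB (k₀ := m - N) le_rfl le_rfl hI,
    comp_coeff_diffShift (hA.deriv i) hB (k₀ := m - N) le_rfl le_rfl hI,
    comp_coeff_diffShift hA (hB.deriv i) (k₀ := m - N) le_rfl le_rfl hI, ← dtHom_apply, map_sum,
    map_zsmul, ← Finset.sum_add_distrib]
  refine Finset.sum_congr rfl fun k _ => Finset.sum_congr rfl fun j _ => ?_
  rw [dtHom_apply, dt_mul, smul_add, dt_diffShift]
  rfl

lemma dtOp_delta (i : ℕ+) (k : ℤ) : dtOp i (delta k : PDO K) = 0 := by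
  ext1; funext m
  rw [coeff_dtOp, coeff_delta]
  split_ifs <;> simp

lemma dtOp_one (i : ℕ+) : dtOp i (1 : PDO K) = 0 := dtOp_delta i 0

end OperatorAlgebra

end DMKP

end

noncomputable section

namespace DMKP

/-! ### Reindexing of sums over antidiagonals -/

section Antidiagonal

open Finset in
lemma snd_le_of_mem_antidiagonal {k : ℕ} {p : ℕ × ℕ} (hp : p ∈ antidiagonal k) : p.2 ≤ k := by
  rw [HasAntidiagonal.mem_antidiagonal] at hp
  omega

variable {M : Type*} [AddCommMonoid M]

open Finset in
lemma sum_antidiagonal_assoc (F : ℕ → ℕ → ℕ → M) (k : ℕ) :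
    ∑ p ∈ antidiagonal k, ∑ q ∈ antidiagonal p.1, F q.1 q.2 p.2 =
      ∑ p ∈ antidiagonal k, ∑ q ∈ antidiagonal p.2, F p.1 q.1 q.2 := by
  rw [sum_sigma', sum_sigma']
  refine sum_nbij' (fun a => ⟨(a.2.1, a.2.2 + a.1.2), (a.2.2, a.1.2)⟩)
    (fun a => ⟨(a.1.1 + a.2.1, a.2.2), (a.1.1, a.2.1)⟩) ?_ ?_ ?_ ?_ ?_
  all_goals
    rintro ⟨⟨a, b⟩, ⟨c, d⟩⟩ h
    simp only [mem_sigma, HasAntidiagonal.mem_antidiagonal] at h ⊢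
    try (obtain ⟨h1, h2⟩ := h; subst h1; subst h2)
    try simp
    try omega

open Finset in
lemma sum_antidiagonal_left_comm (F : ℕ → ℕ → ℕ → M) (k : ℕ) :
    ∑ p ∈ antidiagonal k, ∑ q ∈ antidiagonal p.2, F p.1 q.1 q.2 =
      ∑ p ∈ antidiagonal k, ∑ q ∈ antidiagonal p.2, F q.1 p.1 q.2 := by
  rw [← sum_antidiagonal_assoc, ← sum_antidiagonal_assoc (fun a b c => F b a c)]
  refine sum_congr rfl fun p _ => ?_
  exact Nat.sum_antidiagonal_swap (f := fun q : ℕ × ℕ => F q.2 q.1 p.2)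

end Antidiagonal

/-! ### Exponentials of families of derivations -/

section Schur

variable {K : Type*} [Field K] {M N P : Type*} [AddCommGroup M] [Module K M]
  [AddCommGroup N] [Module K N] [AddCommGroup P] [Module K P]

/-- The coefficients of `exp(ε ∑_l (x^l / l) D_l)`, in the order of factors which is fixed by the
recursion for `timeShiftCoeff`. -/
def schur (D : ℕ+ → M →ₗ[K] M) (ε : K) : ℕ → M →ₗ[K] M
  | 0 => LinearMap.id
  | k + 1 => (ε / ((k : K) + 1)) •
      ∑ l : Fin (k + 1), schur D ε (k - l.1) ∘ₗ D l.1.succPNat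
  termination_by k => k

@[simp] lemma schur_zero (D : ℕ+ → M →ₗ[K] M) (ε : K) (x : M) : schur D ε 0 x = x := by
  rw [schur]; rfl

open Finset in
lemma schur_succ (D : ℕ+ → M →ₗ[K] M) (ε : K) (k : ℕ) (x : M) :
    schur D ε (k + 1) x = (ε / ((k : K) + 1)) •
      ∑ p ∈ antidiagonal k, schur D ε p.2 (D p.1.succPNat x) := by
  rw [schur, Nat.sum_antidiagonal_eq_sum_range_succ
    (fun i j => schur D ε j (D i.succPNat x)), sum_range]
  simp

lemma timeShiftCoeff_eq_schur (ε : K) (k : ℕ) (f : MvPowerSeries ℕ+ K) :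
    timeShiftCoeff ε k f
      = schur (fun i => (MvPowerSeries.pderiv K i).toLinearMap) ε k f := by
  induction k using Nat.strong_induction_on generalizing f with
  | _ k ih =>
    cases k with
    | zero => rw [timeShiftCoeff, schur_zero]
    | succ k =>
      rw [timeShiftCoeff, schur]
      simp only [LinearMap.smul_apply, LinearMap.sum_apply, LinearMap.comp_apply]
      congr 1
      refine Finset.sum_congr rfl fun l _ => ?_
      exact ih _ (by omega) _

lemma schur_mem {D : ℕ+ → M →ₗ[K] M} {S : Submodule K M} (hS : ∀ l, ∀ x ∈ S, D l x ∈ S) (ε : K)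
    (k : ℕ) : ∀ x ∈ S, schur D ε k x ∈ S := by
  induction k using Nat.strong_induction_on with
  | _ k ih =>
    intro x hx
    cases k with
    | zero => simpa using hx
    | succ k =>
      rw [schur_succ]
      refine S.smul_mem _ (S.sum_mem fun p hp => ih _ ?_ _ (hS _ _ hx))
      have := snd_le_of_mem_antidiagonal hp
      omega

/-- Maps which intertwine the derivations intertwine the exponentials. -/
lemma schur_map {D : ℕ+ → M →ₗ[K] M} {D' : ℕ+ → N →ₗ[K] N} (f : M →ₗ[K] N) {p : M → Prop}
    (hp : ∀ l x, p x → p (D l x)) (hf : ∀ l x, p x → f (D l x) = D' l (f x)) (ε : K) (k : ℕ) :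
    ∀ x, p x → f (schur D ε k x) = schur D' ε k (f x) := by
  induction k using Nat.strong_induction_on with
  | _ k ih =>
    intro x hx
    cases k with
    | zero => simp
    | succ k =>
      rw [schur_succ, schur_succ, map_smul, map_sum]
      congr 1
      refine Finset.sum_congr rfl fun q hq => ?_
      have := snd_le_of_mem_antidiagonal hq
      rw [ih _ (by omega) _ (hp _ _ hx), hf _ _ hx]

lemma schur_comm {D : ℕ+ → M →ₗ[K] M} (f : M →ₗ[K] M) (hf : ∀ l x, f (D l x) = D l (f x))
    (ε : K) (k : ℕ) (x : M) : f (schur D ε k x) = schur D ε k (f x) :=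
  schur_map f (p := fun _ => True) (fun _ _ _ => trivial) (fun l x _ => hf l x) ε k x trivial

variable [CharZero K]

open Finset in
lemma succ_smul_schur (D : ℕ+ → M →ₗ[K] M) (ε : K) (k : ℕ) (x : M) :
    ((k : K) + 1) • schur D ε (k + 1) x =
      ε • ∑ p ∈ antidiagonal k, schur D ε p.2 (D p.1.succPNat x) := by
  have : (k : K) + 1 ≠ 0 := Nat.cast_add_one_ne_zero k
  rw [schur_succ, smul_smul]
  congr 1
  field_simp

open Finset in
lemma succ_smul_sum_antidiagonal (F : ℕ → ℕ → M) (k : ℕ) :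
    ((k : K) + 1) • ∑ p ∈ antidiagonal (k + 1), F p.1 p.2 =
      ∑ p ∈ antidiagonal k, ((p.1 : K) + 1) • F (p.1 + 1) p.2 +
      ∑ p ∈ antidiagonal k, ((p.2 : K) + 1) • F p.1 (p.2 + 1) := by
  have h : ((k : K) + 1) • ∑ p ∈ antidiagonal (k + 1), F p.1 p.2
      = ∑ p ∈ antidiagonal (k + 1), (p.1 : K) • F p.1 p.2
        + ∑ p ∈ antidiagonal (k + 1), (p.2 : K) • F p.1 p.2 := by
    rw [smul_sum, ← sum_add_distrib]
    refine sum_congr rfl fun p hp => ?_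
    rw [HasAntidiagonal.mem_antidiagonal] at hp
    rw [← add_smul]
    congr 1
    exact_mod_cast hp.symm
  rw [h, Nat.sum_antidiagonal_succ, Nat.sum_antidiagonal_succ']
  simp

open Finset in
/-- If the derivations satisfy the product rule for a pairing, then the exponentials are
multiplicative. -/
lemma schur_pairing {D₁ : ℕ+ → M →ₗ[K] M} {D₂ : ℕ+ → N →ₗ[K] N} {D₃ : ℕ+ → P →ₗ[K] P}
    (B : M →ₗ[K] N →ₗ[K] P)
    (hB : ∀ l x y, D₃ l (B x y) = B (D₁ l x) y + B x (D₂ l y)) (ε : K) (k : ℕ) :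
    ∀ x y, schur D₃ ε k (B x y)
      = ∑ p ∈ antidiagonal k, B (schur D₁ ε p.1 x) (schur D₂ ε p.2 y) := by
  induction k using Nat.strong_induction_on with
  | _ k ih =>
    intro x y
    cases k with
    | zero => simp
    | succ k =>
      have hk : (k : K) + 1 ≠ 0 := Nat.cast_add_one_ne_zero k
      refine smul_right_injective P hk ?_
      simp only
      rw [succ_smul_schur, succ_smul_sum_antidiagonal
        (fun i j => B (schur D₁ ε i x) (schur D₂ ε j y))]
      have e1 : ∀ p ∈ antidiagonal k, schur D₃ ε p.2 (D₃ p.1.succPNat (B x y))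
          = ∑ q ∈ antidiagonal p.2, B (schur D₁ ε q.1 (D₁ p.1.succPNat x)) (schur D₂ ε q.2 y)
          + ∑ q ∈ antidiagonal p.2, B (schur D₁ ε q.1 x) (schur D₂ ε q.2 (D₂ p.1.succPNat y)) := by
        intro p hp
        have := snd_le_of_mem_antidiagonal hp
        rw [hB, map_add, ih _ (by omega), ih _ (by omega)]
      rw [sum_congr rfl e1, sum_add_distrib, smul_add]
      congr 1
      · rw [← sum_antidiagonal_assoc
          (fun a b c => B (schur D₁ ε b (D₁ a.succPNat x)) (schur D₂ ε c y)), smul_sum]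
        refine sum_congr rfl fun p _ => ?_
        rw [← LinearMap.smul_apply, ← map_smul, succ_smul_schur, map_smul, map_sum]
        simp
      · rw [sum_antidiagonal_left_comm
          (fun a b c => B (schur D₁ ε b x) (schur D₂ ε c (D₂ a.succPNat y))), smul_sum]
        refine sum_congr rfl fun p _ => ?_
        rw [← map_smul, succ_smul_schur, map_smul, map_sum]

open Finset in
/-- For commuting derivations the exponentials with opposite signs are inverse to each other. -/
lemma sum_schur_schur_neg {D : ℕ+ → M →ₗ[K] M} (hD : ∀ l l' x, D l (D l' x) = D l' (D l x))
    (ε : K) (k : ℕ) (x : M) :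
    ∑ p ∈ antidiagonal k, schur D ε p.1 (schur D (-ε) p.2 x) = if k = 0 then x else 0 := by
  cases k with
  | zero => simp
  | succ k =>
    rw [if_neg (Nat.succ_ne_zero k)]
    have hk : (k : K) + 1 ≠ 0 := Nat.cast_add_one_ne_zero k
    refine smul_right_injective M hk ?_
    simp only
    rw [succ_smul_sum_antidiagonal (fun i j => schur D ε i (schur D (-ε) j x)), smul_zero]
    simp only [← map_smul]
    simp only [succ_smul_schur, map_smul, map_sum, neg_smul, sum_neg_distrib, map_neg]
    rw [← smul_sum, ← smul_sum, ← sub_eq_add_neg, sub_eq_zero]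
    congr 1
    rw [sum_antidiagonal_assoc
      (fun a b c => schur D ε b (D a.succPNat (schur D (-ε) c x))), sum_antidiagonal_left_comm
      (fun a b c => schur D ε b (D a.succPNat (schur D (-ε) c x)))]
    refine sum_congr rfl fun p _ => sum_congr rfl fun q _ => ?_
    rw [schur_comm (D q.1.succPNat) (fun l x => hD _ _ _)]

open Finset in
/-- Adding the powers of a commuting operator `q` to the derivations multiplies the exponential by
`exp(-∑_l x^l q^l / l) = 1 - x q`. -/
lemma schur_twist {D D' : ℕ+ → M →ₗ[K] M} {q : M →ₗ[K] M} {s ε : K}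
    (hq : ∀ l x, q (D l x) = D l (q x)) (hD' : ∀ l x, D' l x = D l x + s • (q ^ (l : ℕ)) x)
    (hs : ε * s = -1) (k : ℕ) :
    ∀ x, schur D' ε (k + 1) x = schur D ε (k + 1) x - q (schur D ε k x) := by
  have hpow : ∀ (i j : ℕ) (x : M), schur D ε j ((q ^ i) x) = (q ^ i) (schur D ε j x) := by
    intro i j x
    refine (schur_comm (q ^ i) (fun l x => ?_) ε j x).symm
    induction i generalizing x with
    | zero => simp
    | succ i ih => rw [pow_succ', Module.End.mul_apply, Module.End.mul_apply, ih, hq]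
  induction k using Nat.strong_induction_on with
  | _ k ih =>
    intro x
    have hk : (k : K) + 1 ≠ 0 := Nat.cast_add_one_ne_zero k
    refine smul_right_injective M hk ?_
    simp only
    rw [smul_sub, succ_smul_schur, succ_smul_schur]
    have T : ∀ j, ∑ p ∈ antidiagonal j, schur D ε p.2 (D' p.1.succPNat x)
        = ∑ p ∈ antidiagonal j, schur D ε p.2 (D p.1.succPNat x)
          + s • ∑ p ∈ antidiagonal j, (q ^ (p.1 + 1)) (schur D ε p.2 x) := by
      intro j
      rw [smul_sum, ← sum_add_distrib]
      refine sum_congr rfl fun p _ => ?_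
      rw [hD', map_add, map_smul, Nat.succPNat_coe, hpow]
    have hq1 : ∀ y : M, ε • s • y = -y := fun y => by rw [smul_smul, hs, neg_one_smul]
    cases k with
    | zero =>
      simp [hD', hq1, sub_eq_add_neg]
    | succ k =>
      have h1 : ∑ p ∈ antidiagonal (k + 1), schur D' ε p.2 (D' p.1.succPNat x)
          = ∑ p ∈ antidiagonal (k + 1), schur D ε p.2 (D' p.1.succPNat x)
            - q (∑ p ∈ antidiagonal k, schur D ε p.2 (D' p.1.succPNat x)) := by
        rw [Nat.sum_antidiagonal_succ', Nat.sum_antidiagonal_succ', map_sum, add_sub_assoc,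
          ← sum_sub_distrib]
        simp only [schur_zero]
        congr 1
        refine sum_congr rfl fun p hp => ?_
        have := snd_le_of_mem_antidiagonal hp
        rw [ih _ (by omega)]
      -- In the difference of `T (k + 1)` and `q` applied to `T k`, the powers of `q` cancel except
      -- for the first one, split off here.
      have h2 : ∑ p ∈ antidiagonal (k + 1), (q ^ (p.1 + 1)) (schur D ε p.2 x)
          = q (schur D ε (k + 1) x)
            + q (∑ p ∈ antidiagonal k, (q ^ (p.1 + 1)) (schur D ε p.2 x)) := by
        rw [Nat.sum_antidiagonal_succ, map_sum]
        simp only [zero_add, pow_one, pow_succ' q (_ + 1), Module.End.mul_apply]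
      have h3 := succ_smul_schur D ε k x
      rw [h1, T, T, h2, smul_sub, smul_add, map_add, smul_add, map_smul, smul_add, hq1, smul_add, hq1,
        ← map_smul q ε, ← h3, map_smul]
      push_cast
      module

end Schur

end DMKP

end

noncomputable section

namespace DMKP

/-! ### Difference operators, their adjoints and residues on coefficient functions -/

section ActionOnFunctions

variable {K : Type*} [Field K]

open OpSeries PDO

lemma mulOp_add (f g : Coef K) : mulOp (f + g) = mulOp f + mulOp g := by
  ext1; funext m
  rw [coeff_add, coeff_mulOp, coeff_mulOp, coeff_mulOp]
  split_ifs <;> simp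

lemma mulOp_smul (c : K) (f : Coef K) : mulOp (c • f) = c • mulOp f := by
  ext1; funext m
  rw [coeff_smul, coeff_mulOp, coeff_mulOp]
  split_ifs <;> simp

lemma dtOp_mulOp (i : ℕ+) (f : Coef K) : dtOp i (mulOp f) = mulOp (dt i f) := by
  ext1; funext m
  rw [coeff_dtOp, coeff_mulOp, coeff_mulOp]
  split_ifs <;> simp

/-- The residue sees only the term `k = -1`: lower powers of `Δ` never rise to `-1`, and
non-negative powers never fall below 0. -/
lemma coeff_neg_one_mul_mulOp (A : PDO K) (g : Coef K) :
    (A * mulOp g).coeff (-1) = A.coeff (-1) * shift (-1) g := by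
  change (∑ᶠ k : ℤ, ∑ᶠ i : ℕ, _) = _
  have h : ∀ k : ℤ, ∀ i : ℕ, i ≠ 0 ∨ k ≠ -1 → Ring.choose k i •
      (A.coeff k * diff^[i] (shift (k - i) ((mulOp g).coeff (-1 - k + i)))) = 0 := by
    intro k i hki
    by_cases hm : -1 - k + i = 0
    · have hi : i ≠ 0 := by omega
      obtain ⟨j, rfl⟩ := Nat.exists_eq_succ_of_ne_zero hi
      have hk : k = j := by push_cast at hm; omega
      rw [hk, ringChoose_natCast, Nat.choose_eq_zero_of_lt (Nat.lt_succ_self j)]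
      simp
    · rw [coeff_mulOp, if_neg hm, shift_zero, diff_iterate_zero, mul_zero, smul_zero]
  rw [finsum_eq_single _ (-1), finsum_eq_single _ 0]
  · simp [coeff_mulOp]
  · intro i hi
    exact h _ _ (Or.inl hi)
  · intro k hk
    rw [← finsum_zero (α := ℕ)]
    exact finsum_congr fun i => h _ _ (Or.inr hk)

/-- The function `B(φ)`, for a difference operator `B` with non-negative powers; the negative
powers are disregarded. -/
def actN : PDO K →ₗ[K] Coef K →ₗ[K] Coef K :=
  LinearMap.mk₂ K (fun B φ => (B * mulOp φ).coeff 0)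
    (fun A B φ => by rw [add_mul, coeff_add])
    (fun c A φ => by rw [smul_mul_assoc, coeff_smul])
    (fun A f g => by rw [mulOp_add, mul_add, coeff_add])
    (fun c A f => by rw [mulOp_smul, mul_smul_comm, coeff_smul])

lemma actN_apply (B : PDO K) (φ : Coef K) : actN B φ = (B * mulOp φ).coeff 0 := rfl

lemma actN_mulOp (g φ : Coef K) : actN (mulOp g) φ = g * φ := by
  rw [actN_apply, mulOp_mul_mulOp, coeff_mulOp, if_pos rfl]

lemma actN_mul_delta {A : PDO K} (hA : A.OrdGE 0) (φ : Coef K) :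
    actN (A * delta 1) φ = actN A (diff φ) := by
  have h : (A * mulOp (shift 1 φ)).coeff (-1) = 0 := hA.mul (ordGE_mulOp _) (-1) (by omega)
  rw [actN_apply, mul_assoc, delta_one_mul_mulOp, mul_add, coeff_add, ← mul_assoc,
    coeff_mul_delta, zero_sub, h, zero_add, actN_apply]

lemma actN_mono_one (g φ : Coef K) : actN (mono g 1) φ = g * diff φ := by
  rw [← mulOp_mul_delta, actN_mul_delta (ordGE_mulOp g), actN_mulOp]

/-- Non-negativity matters: `actN` is extraction of the `Δ^0` coefficient, and negative powers in
`A` could mix with positive ones in `B`. -/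
lemma actN_mul {A B : PDO K} (hA : A.OrdGE 0) (hB : B.OrdGE 0) (φ : Coef K) :
    actN (A * B) φ = actN A (actN B φ) := by
  refine nonneg_induction (P := fun B => ∀ φ, actN (A * B) φ = actN A (actN B φ))
    (fun B C hB hC φ => ?_) (fun g φ => ?_) (fun B hB ih φ => ?_) B hB φ
  · rw [mul_add, map_add, map_add, LinearMap.add_apply, LinearMap.add_apply, map_add, hB, hC]
  · rw [actN_mulOp, actN_apply, actN_apply, mul_assoc, mulOp_mul_mulOp]
  · rw [← mul_assoc, actN_mul_delta (hA.mul hB), actN_mul_delta hB, ih]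

lemma dt_actN (i : ℕ+) (B : PDO K) (φ : Coef K) :
    dt i (actN B φ) = actN (dtOp i B) φ + actN B (dt i φ) := by
  rw [actN_apply, ← coeff_dtOp, dtOp_mul, dtOp_mulOp, coeff_add]
  rfl

/-- The coefficient `b_m` of an operator which is written as `∑ Δ^m ∘ b_m`. -/
def rcoeff (m : ℤ) : PDO K →ₗ[K] Coef K where
  toFun A := shift 1 ((delta (-1 - m) * A).coeff (-1))
  map_add' A B := by rw [mul_add, coeff_add, shift_add]
  map_smul' c A := by rw [mul_smul_comm, coeff_smul]; rfl

lemma rcoeff_apply (m : ℤ) (A : PDO K) :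
    rcoeff m A = shift 1 ((delta (-1 - m) * A).coeff (-1)) := rfl

lemma shift_rcoeff (m : ℤ) (A : PDO K) :
    shift (-1) (rcoeff m A) = (delta (-1 - m) * A).coeff (-1) := by
  rw [rcoeff_apply, shift_shift]; simp

lemma rcoeff_delta_mul (m j : ℤ) (A : PDO K) : rcoeff m (delta j * A) = rcoeff (m - j) A := by
  rw [rcoeff_apply, rcoeff_apply, ← mul_assoc, delta_mul_delta]
  congr 4; ring

lemma rcoeff_mul_mulOp (m : ℤ) (A : PDO K) (g : Coef K) :
    rcoeff m (A * mulOp g) = rcoeff m A * g := by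
  rw [rcoeff_apply, rcoeff_apply, ← mul_assoc, coeff_neg_one_mul_mulOp, shift_mul, shift_shift]
  simp

/-- Comes from `b ∘ Δ = Δ ∘ (Γ⁻¹ b) + Γ⁻¹ b - b`, which moves the new factor to the left of the
coefficients. -/
lemma rcoeff_mul_delta (m : ℤ) (A : PDO K) :
    rcoeff m (A * delta 1)
      = shift (-1) (rcoeff (m - 1) A + rcoeff m A) - rcoeff m A := by
  have h := coeff_delta_one_mul (delta (-1 - m) * A) (-1)
  rw [← mul_assoc, delta_mul_delta] at h
  rw [shift_add, shift_rcoeff, shift_rcoeff, rcoeff_apply, rcoeff_apply, ← mul_assoc,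
    coeff_mul_delta, show (-1 : ℤ) - (m - 1) = 1 + (-1 - m) by ring, h, diff_eq]
  ring

lemma dt_rcoeff (i : ℕ+) (m : ℤ) (A : PDO K) : dt i (rcoeff m A) = rcoeff m (dtOp i A) := by
  rw [rcoeff_apply, rcoeff_apply, dt_shift, ← coeff_dtOp, dtOp_mul, dtOp_delta, zero_mul, zero_add]

lemma rcoeff_eq_zero {A : PDO K} {N m : ℤ} (hA : A.OrdLE N) (hm : N < m) : rcoeff m A = 0 := by
  rw [rcoeff_apply, (ordLE_delta _).mul hA _ (by omega), shift_zero]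

lemma rcoeff_eq_zero_of_ordGE {A : PDO K} (hA : A.OrdGE 0) : rcoeff (-1) A = 0 := by
  have h : (-1 : ℤ) - -1 = 0 := by norm_num
  rw [rcoeff_apply, h, ← one_def, one_mul, hA _ (by omega), shift_zero]

lemma diffAdj_eq (f : Coef K) : diffAdj f = -shift (-1) (diff f) := by
  funext n; simp [sub_eq_add_neg]

lemma diffAdj_iterate (i : ℕ) (f : Coef K) :
    diffAdj^[i] f = (-1 : ℤ) ^ i • shift (-i) (diff^[i] f) := by
  induction i with
  | zero => simp
  | succ i ih =>
    have h : ∀ (c : ℤ) (g : Coef K), diffAdj (c • g) = c • diffAdj g := by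
      intro c g; funext n; simp [mul_sub]
    rw [Function.iterate_succ_apply', ih, h, diffAdj_eq, diff_shift, shift_shift,
      Function.iterate_succ_apply', pow_succ, mul_smul, neg_smul, one_smul]
    congr 3
    push_cast; ring

/-- Since `(Δ^m ∘ b)^* = b (Δ^*)^m`, the adjoint is determined by the right coefficients. The two
Leibniz expansions match through `binom(-1-m, i) = (-1)^i binom(m+i, i)`. -/
lemma coeff_adjoint (A : PDO K) (m : ℤ) : (adjoint A).coeff m = rcoeff m A := by
  have comm : ∀ (i : ℕ) (j : ℤ) (f : Coef K), diff^[i] (shift j f) = shift j (diff^[i] f) := by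
    intro i j f
    have c : Function.Commute (diff (K := K)) (shift j) := fun h => diff_shift j h
    exact (c.iterate_left i) f
  have e : (delta (-1 - m) * A).coeff (-1) = shift (-1) ((adjoint A).coeff m) := by
    rw [delta, mul_def, coeff_comp_mono]
    change _ = (shiftHom (-1) : Coef K →+* Coef K).toAddMonoidHom (∑ᶠ i : ℕ, _)
    rw [AddMonoidHom.map_finsum_of_injective]
    · refine finsum_congr fun i => ?_
      have hc : Ring.choose (-1 - m) i = (-1) ^ i * Ring.choose (m + i) i := by
        rw [show (-1 - m : ℤ) = -(m + 1) by ring, Ring.choose_neg, Units.smul_def, smul_eq_mul]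
        congr 2; ring
      have hs : ∀ (c : ℤ) (g : Coef K),
          (shiftHom (-1) : Coef K →+* Coef K).toAddMonoidHom (c • g) = c • shift (-1) g := fun c g => rfl
      rw [one_mul, diffShift_apply, diffAdj_iterate, smul_smul, hs, comm, comm, shift_shift,
        shift_shift, hc, mul_comm]
      congr 2
      · ring
      · congr 2; ring
    · intro f g hfg
      have := congrArg (shift 1) (show shift (-1) f = shift (-1) g from hfg)
      rwa [shift_shift, shift_shift, add_neg_cancel, shift_zero_left, shift_zero_left] at this
  rw [rcoeff_apply, e, shift_shift]
  simp

/-- The function `B^*(f)`, for a difference operator `B` with non-negative powers. -/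
def radj : PDO K →ₗ[K] Coef K →ₗ[K] Coef K :=
  LinearMap.mk₂ K (fun B f => rcoeff 0 (mulOp f * B))
    (fun A B φ => by rw [mul_add, map_add])
    (fun c A φ => by rw [mul_smul_comm, map_smul])
    (fun A f g => by rw [mulOp_add, add_mul, map_add])
    (fun c A f => by rw [mulOp_smul, smul_mul_assoc, map_smul])

lemma radj_apply (B : PDO K) (f : Coef K) : radj B f = rcoeff 0 (mulOp f * B) := rfl

lemma radj_mulOp (g f : Coef K) : radj (mulOp g) f = f * g := by
  rw [radj_apply, rcoeff_mul_mulOp, rcoeff_apply, coeff_neg_one_mul_mulOp, coeff_delta,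
    if_pos (by norm_num), one_mul, shift_shift]
  simp

lemma radj_mul_delta {A : PDO K} (hA : A.OrdGE 0) (f : Coef K) :
    radj (A * delta 1) f = diffAdj (radj A f) := by
  rw [radj_apply, ← mul_assoc, rcoeff_mul_delta, zero_sub,
    rcoeff_eq_zero_of_ordGE ((ordGE_mulOp f).mul hA), zero_add]
  rfl

lemma radj_mono_one (g f : Coef K) : radj (mono g 1) f = diffAdj (f * g) := by
  rw [← mulOp_mul_delta, radj_mul_delta (ordGE_mulOp g), radj_mulOp]

lemma radj_mul {A B : PDO K} (hA : A.OrdGE 0) (hB : B.OrdGE 0) (f : Coef K) :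
    radj (A * B) f = radj B (radj A f) := by
  refine nonneg_induction (P := fun B => ∀ f, radj (A * B) f = radj B (radj A f))
    (fun B C hB hC f => ?_) (fun g f => ?_) (fun B hB ih f => ?_) B hB f
  · rw [mul_add, map_add, map_add, LinearMap.add_apply, LinearMap.add_apply, hB, hC]
  · rw [radj_mulOp, radj_apply, radj_apply, ← mul_assoc, rcoeff_mul_mulOp]
  · rw [← mul_assoc, radj_mul_delta (hA.mul hB), radj_mul_delta hB, ih]

lemma dt_radj (i : ℕ+) (B : PDO K) (f : Coef K) :
    dt i (radj B f) = radj (dtOp i B) f + radj B (dt i f) := by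
  rw [radj_apply, dt_rcoeff, dtOp_mul, dtOp_mulOp, map_add, add_comm]
  rfl

/-- Compare the coefficients of `Δ^{-1}` in `Δ ∘ R = C Δ^{-1}` for `R = Δ^{-1} C Δ^{-1}`: the
leading part of `Δ ∘ R` contributes the right coefficient of `C`, the remainder is `Δ (res R)`. -/
lemma diff_res (C : PDO K) :
    diff (res (delta (-1) * (C * delta (-1)))) = C.coeff 0 - rcoeff 0 C := by
  have h := coeff_delta_one_mul (delta (-1) * (C * delta (-1))) (-1)
  rw [← mul_assoc, delta_mul_delta, add_neg_cancel, ← one_def, one_mul, coeff_mul_delta,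
    ← mul_assoc, coeff_mul_delta] at h
  norm_num at h
  have h2 : rcoeff 0 C = shift 1 ((delta (-1) * C).coeff (-1)) := by
    rw [rcoeff_apply]; norm_num
  rw [h, h2, res, ← mul_assoc]
  ring

/-- The compatibility of the two defining equations of a potential: the right side is `∂_i(φ θ)`
when `φ` evolves by `B` and `θ` by `-B^*`. -/
lemma diff_res_potential (B : PDO K) (θ φ : Coef K) :
    diff (res (delta (-1) * (mulOp θ * (B * (mulOp φ * delta (-1))))))
      = θ * actN B φ - φ * radj B θ := by
  have e : mulOp θ * (B * (mulOp φ * delta (-1)))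
      = (mulOp θ * (B * mulOp φ)) * delta (-1) := by simp only [mul_assoc]
  rw [e, diff_res, coeff_mulOp_mul, ← mul_assoc, rcoeff_mul_mulOp, ← actN_apply, ← radj_apply,
    mul_comm φ]

end ActionOnFunctions

/-! ### Miwa shifts of the dressing operator and of eigenfunctions -/

section Dressing

variable {K : Type*} [Field K]

open OpSeries PDO

lemma schur_coeff [CharZero K] (ε : K) (k : ℕ) (A : PDO K) (m : ℤ) :
    (schur dtOp ε k A).coeff m = schur dtHom ε k (A.coeff m) :=
  schur_map (D := dtOp) (D' := dtHom) (coeffHom m) (p := fun _ => True) (fun _ _ _ => trivial) (fun _ _ _ => rfl) ε k A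
    trivial

lemma schur_apply [CharZero K] (ε : K) (k : ℕ) (f : Coef K) (n : ℤ) :
    schur dtHom ε k f n = timeShiftCoeff ε k (f n) := by
  rw [timeShiftCoeff_eq_schur]
  exact schur_map (LinearMap.proj n : Coef K →ₗ[K] MvPowerSeries ℕ+ K) (p := fun _ => True)
    (fun _ _ _ => trivial) (fun _ _ _ => rfl) ε k f trivial

lemma diff_schur [CharZero K] (ε : K) (k : ℕ) (f : Coef K) :
    diff (schur dtHom ε k f) = schur dtHom ε k (diff f) :=
  schur_comm diffHom (fun l x => (dt_diff l x).symm) ε k f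

lemma dt_dt (i j : ℕ+) (f : Coef K) : dt i (dt j f) = dt j (dt i f) := by
  funext n
  ext d
  simp only [dt, MvPowerSeries.coeff_pderiv, Finsupp.add_apply, Nat.cast_add]
  rw [add_right_comm]
  by_cases h : i = j
  · subst h; rfl
  · rw [Finsupp.single_eq_of_ne h, Finsupp.single_eq_of_ne (Ne.symm h)]
    push_cast
    ring

lemma schur_mul [CharZero K] (ε : K) (k : ℕ) (f g : Coef K) :
    schur dtHom ε k (f * g)
      = ∑ p ∈ Finset.HasAntidiagonal.antidiagonal k, schur dtHom ε p.1 f * schur dtHom ε p.2 g :=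
  schur_pairing (LinearMap.mul K (Coef K)) (fun l x y => dt_mul l x y) ε k f g

/-- The time shift is multiplicative and inverse to the shift with opposite sign, so shifting `f^-
g` forward gives `f g^+`. -/
lemma sum_schur_schur_neg_mul [CharZero K] (ε : K) (k : ℕ) (f g : Coef K) :
    ∑ p ∈ Finset.HasAntidiagonal.antidiagonal k, schur dtHom ε p.1 (schur dtHom (-ε) p.2 f * g)
      = f * schur dtHom ε k g := by
  have h1 : ∀ p ∈ Finset.HasAntidiagonal.antidiagonal k, schur dtHom ε p.1 (schur dtHom (-ε) p.2 f * g)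
      = ∑ q ∈ Finset.HasAntidiagonal.antidiagonal p.1,
        schur dtHom ε q.2 (schur dtHom (-ε) p.2 f) * schur dtHom ε q.1 g := by
    intro p _
    rw [schur_mul, ← Finset.Nat.sum_antidiagonal_swap]
    rfl
  rw [Finset.sum_congr rfl h1, sum_antidiagonal_assoc
    (fun a b c => schur dtHom ε b (schur dtHom (-ε) c f) * schur dtHom ε a g)]
  have h2 : ∀ p ∈ Finset.HasAntidiagonal.antidiagonal k, ∑ q ∈ Finset.HasAntidiagonal.antidiagonal p.2,
      schur dtHom ε q.1 (schur dtHom (-ε) q.2 f) * schur dtHom ε p.1 g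
      = if p.2 = 0 then f * schur dtHom ε p.1 g else 0 := by
    intro p _
    rw [← Finset.sum_mul, sum_schur_schur_neg (fun l l' x => dt_dt l l' x)]
    split_ifs <;> simp
  rw [Finset.sum_congr rfl h2, Finset.sum_eq_single_of_mem (k, 0)]
  · simp
  · rw [Finset.HasAntidiagonal.mem_antidiagonal]; simp
  · rintro ⟨a, b⟩ hp hne
    rw [Finset.HasAntidiagonal.mem_antidiagonal] at hp
    rw [if_neg]
    rintro rfl
    exact hne (by simp_all)

variable {Z Zinv L : PDO K}

namespace IsDressing

lemma ordLE (h : IsDressing Z Zinv L) : Z.OrdLE 0 := h.order_le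

lemma mul_inv' (h : IsDressing Z Zinv L) : Z * Zinv = 1 := h.mul_inv

lemma inv_mul' (h : IsDressing Z Zinv L) : Zinv * Z = 1 := h.inv_mul

lemma lax' (h : IsDressing Z Zinv L) : L = Z * delta 1 * Zinv := h.lax

/-- As `z_0` is a unit, a leading term of `Z⁻¹` of positive order would survive in `Z Z⁻¹ = 1`; such
terms are removed one order at a time. -/
lemma inv_ordLE (h : IsDressing Z Zinv L) : Zinv.OrdLE 0 := by
  obtain ⟨N, hN⟩ := Zinv.bdd
  have key : ∀ b : ℕ, Zinv.OrdLE b → Zinv.OrdLE 0 := by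
    intro b
    induction b with
    | zero => exact fun h => h
    | succ b ih =>
      intro hb
      refine ih fun m hm => ?_
      rcases lt_or_ge ((b + 1 : ℕ) : ℤ) m with hm' | hm'
      · exact hb m hm'
      · have hm'' : m = ((b + 1 : ℕ) : ℤ) := by push_cast at hm' ⊢; omega
        have := coeff_mul_top h.ordLE hb
        rw [h.mul_inv', one_def, coeff_delta, if_neg (by push_cast; omega),
          shift_zero_left, ← hm''] at this
        exact (h.isUnit_lead.mul_right_eq_zero).mp this.symm
  exact key N.toNat fun m hm => hN m (by omega)

lemma pow_mul (h : IsDressing Z Zinv L) (i : ℕ) : L ^ i * Z = Z * delta i := by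
  induction i with
  | zero => rw [pow_zero, one_mul, Nat.cast_zero, ← one_def, mul_one]
  | succ i ih =>
    rw [pow_succ', mul_assoc, ih, h.lax', ← mul_assoc, mul_assoc _ Zinv, h.inv_mul', mul_one,
      mul_assoc, delta_mul_delta]
    push_cast
    rw [add_comm]

/-- The operator `(L^i)_{≥ 1}` determines the other part of `L^i`. -/
lemma nonposPart_npow (i : ℕ+) :
    nonposPart (npow L i) = L ^ (i : ℕ) - PDO.posPart (npow L i) := by
  rw [nonposPart_eq, npow_eq_pow]

/-- Uses `L^i Z = Z Δ^i` to trade the part `(L^i)_{≤0}` of the Sato equation for the difference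
operator `(L^i)_{≥1}`, which can be applied to functions. -/
lemma dtOp_dressing (h : IsDressing Z Zinv L) (i : ℕ+) :
    dtOp i Z = PDO.posPart (npow L i) * Z - Z * delta i := by
  have : dtOp i Z = -(nonposPart (npow L i) * Z) := by
    ext1; funext m; exact h.sato i m
  rw [this, nonposPart_npow, sub_mul, h.pow_mul, neg_sub]

lemma dtOp_inv (h : IsDressing Z Zinv L) (i : ℕ+) :
    dtOp i Zinv = delta i * Zinv - Zinv * PDO.posPart (npow L i) := by
  have h1 := dtOp_mul i Zinv Z
  rw [h.inv_mul', dtOp_one, h.dtOp_dressing] at h1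
  have h2 := congrArg (fun X => X * Zinv) h1
  simp only [zero_mul, add_mul, mul_sub, sub_mul, mul_assoc, h.mul_inv', mul_one] at h2
  rw [← mul_assoc Zinv Z, h.inv_mul', one_mul] at h2
  exact eq_sub_of_add_eq (by
    have := h2.symm
    rw [← add_sub_assoc, sub_eq_zero] at this
    exact this)

end IsDressing

/-- The operators with powers `Δ^m`, `m ≥ 1`, only. -/
def posSubmodule (K : Type*) [Field K] : Submodule K (PDO K) where
  carrier := {A | A.OrdGE 1}
  zero_mem' := fun _ _ => rfl
  add_mem' hA hB := hA.add hB
  smul_mem' c A hA m hm := by rw [coeff_smul, hA m hm, smul_zero]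

/-- The derivations `R ↦ ∂R/∂t_i + R B_i`. -/
def derivRight (B : ℕ+ → PDO K) (i : ℕ+) : PDO K →ₗ[K] PDO K :=
  dtOp i + LinearMap.mulRight K (B i)

/-- The derivations `R ↦ ∂R/∂t_i - B_i R`. -/
def derivLeft (B : ℕ+ → PDO K) (i : ℕ+) : PDO K →ₗ[K] PDO K :=
  dtOp i - LinearMap.mulLeft K (B i)

lemma derivRight_apply (B : ℕ+ → PDO K) (i : ℕ+) (R : PDO K) :
    derivRight B i R = dtOp i R + R * B i := rfl

lemma derivLeft_apply (B : ℕ+ → PDO K) (i : ℕ+) (R : PDO K) :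
    derivLeft B i R = dtOp i R - B i * R := rfl

lemma eq_mono_one {A : PDO K} (h₁ : A.OrdLE 1) (h₂ : A.OrdGE 1) : A = mono (A.coeff 1) 1 := by
  ext1; funext m
  rw [coeff_mono]
  split_ifs with h
  · rw [h]
  · rcases lt_or_gt_of_ne h with h | h
    · exact h₂ m h
    · exact h₁ m h

variable [CharZero K]

lemma schur_ordLE {A : PDO K} {N : ℤ} (hA : A.OrdLE N) (ε : K) (k : ℕ) :
    (schur dtOp ε k A).OrdLE N := fun m hm => by
  rw [schur_coeff, hA m hm, map_zero]

lemma schur_deriv_pos {D : ℕ+ → PDO K →ₗ[K] PDO K}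
    (hD : ∀ i, ∀ R : PDO K, R.OrdGE 1 → (D i R).OrdGE 1) (h1 : ∀ i, (D i 1).OrdGE 1) (ε : K)
    (k : ℕ) : (schur D ε (k + 1) 1).OrdGE 1 := by
  rw [schur_succ]
  exact (posSubmodule K).smul_mem _ ((posSubmodule K).sum_mem fun p _ =>
    schur_mem (S := posSubmodule K) hD _ _ _ (h1 _))

namespace IsDressing

/-- The evolution operators of the wave function. -/
abbrev evol (L : PDO K) (i : ℕ+) : PDO K := PDO.posPart (npow L i)

/-- Right multiplication by `Z` intertwines `R ↦ ∂R + R B_i` with `R ↦ ∂R + R Δ^i`. The latter adds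
powers of right multiplication by `Δ`, which commutes with `∂`, so `schur_twist` produces the factor
`1 - xΔ`. -/
lemma schur_sub (h : IsDressing Z Zinv L) (k : ℕ) :
    schur dtOp (-1) (k + 1) Z - schur dtOp (-1) k Z * delta 1
      = schur (derivRight (evol L)) (-1) (k + 1) 1 * Z := by
  have h1 := schur_map (D := derivRight (evol L)) (D' := derivRight (fun i => delta i))
    (LinearMap.mulRight K Z)
    (p := fun _ => True) (fun _ _ _ => trivial) (fun l R _ => by
      simp only [LinearMap.mulRight_apply, derivRight_apply]
      rw [dtOp_mul, h.dtOp_dressing, add_mul, mul_sub]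
      simp only [mul_assoc]
      abel) (-1) (k + 1) 1 trivial
  rw [LinearMap.mulRight_apply, LinearMap.mulRight_apply, one_mul] at h1
  rw [h1, schur_twist (D := dtOp) (D' := derivRight (fun i => delta i)) (q := LinearMap.mulRight K (delta 1)) (s := 1)
    (fun l x => by
      simp only [LinearMap.mulRight_apply]
      rw [dtOp_mul, dtOp_delta, mul_zero, add_zero])
    (fun l x => by
      rw [LinearMap.pow_mulRight, LinearMap.mulRight_apply, one_smul, delta_pow]; rfl)
    (by ring)]
  rfl

/-- The operator is squeezed between two bounds: as `T Z⁻¹` it has order at most 1, and as an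
expression in the `B_i` it has only powers at least 1. What remains is its coefficient at `Δ`, a
product of leading coefficients. -/
lemma schur_evol (h : IsDressing Z Zinv L) (k : ℕ) :
    schur (derivRight (evol L)) (-1) (k + 1) 1
      = mono (-(schur dtHom (-1) k (Z.coeff 0) * shift 1 (Zinv.coeff 0))) 1 := by
  have hs := h.schur_sub k
  set W := schur (derivRight (evol L)) (-1) (k + 1) 1 with hW
  set T := schur dtOp (-1) (k + 1) Z - schur dtOp (-1) k Z * delta 1 with hT
  have hWT : W = T * Zinv := by rw [hs, mul_assoc, h.mul_inv', mul_one]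
  have hT1 : T.OrdLE 1 := ((schur_ordLE h.ordLE _ _).mono zero_le_one).sub
    ((schur_ordLE h.ordLE _ _).mul (ordLE_delta 1))
  have hW1 : W.OrdLE 1 := by rw [hWT]; exact hT1.mul h.inv_ordLE
  -- The derivation sends 1 to `B_i` and preserves the operators with powers at least 1.
  have hpos : W.OrdGE 1 := schur_deriv_pos
    (fun i R hR => (hR.deriv i).add ((hR.mono zero_le_one).mul (ordGE_posPart _)))
    (fun i => by
      rw [derivRight_apply, dtOp_one, zero_add, one_mul]; exact ordGE_posPart _) _ _
  rw [eq_mono_one hW1 hpos]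
  congr 1
  have := coeff_mul_top hT1 h.inv_ordLE
  rw [add_zero] at this
  rw [hWT, this, hT, coeff_sub, coeff_mul_delta, schur_ordLE h.ordLE _ _ 1 zero_lt_one, sub_self,
    schur_coeff, zero_sub, neg_mul]

lemma schur_inv_sub (h : IsDressing Z Zinv L) (k : ℕ) :
    schur dtOp 1 (k + 1) Zinv - delta 1 * schur dtOp 1 k Zinv
      = Zinv * schur (derivLeft (evol L)) 1 (k + 1) 1 := by
  have h1 := schur_map (D := derivLeft (evol L)) (D' := derivLeft (fun i => delta i))
    (LinearMap.mulLeft K Zinv)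
    (p := fun _ => True) (fun _ _ _ => trivial) (fun l R _ => by
      simp only [LinearMap.mulLeft_apply, derivLeft_apply]
      rw [dtOp_mul, h.dtOp_inv, sub_mul, mul_sub]
      simp only [mul_assoc]
      abel) 1 (k + 1) 1 trivial
  rw [LinearMap.mulLeft_apply, LinearMap.mulLeft_apply, mul_one] at h1
  rw [h1, schur_twist (D := dtOp) (D' := derivLeft (fun i => delta i)) (q := LinearMap.mulLeft K (delta 1)) (s := -1)
    (fun l x => by
      simp only [LinearMap.mulLeft_apply]
      rw [dtOp_mul, dtOp_delta, zero_mul, zero_add])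
    (fun l x => by
      rw [LinearMap.pow_mulLeft, LinearMap.mulLeft_apply, delta_pow, neg_one_smul,
        ← sub_eq_add_neg]; rfl)
    (by ring)]
  rfl

/-- The mirror image of `schur_evol`: the same squeeze for `Z (Z⁻¹)^+`, with `1 - xΔ` now acting
from the left. -/
lemma schur_evol_left (h : IsDressing Z Zinv L) (k : ℕ) :
    schur (derivLeft (evol L)) 1 (k + 1) 1
      = mono (-(Z.coeff 0 * shift 1 (schur dtHom 1 k (Zinv.coeff 0)))) 1 := by
  have hs := h.schur_inv_sub k
  set W := schur (derivLeft (evol L)) 1 (k + 1) 1 with hW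
  set T := schur dtOp 1 (k + 1) Zinv - delta 1 * schur dtOp 1 k Zinv with hT
  have hWT : W = Z * T := by rw [hs, ← mul_assoc, h.mul_inv', one_mul]
  have hT1 : T.OrdLE 1 := ((schur_ordLE h.inv_ordLE _ _).mono zero_le_one).sub
    ((ordLE_delta 1).mul (schur_ordLE h.inv_ordLE _ _))
  have hW1 : W.OrdLE 1 := by rw [hWT, ← zero_add (1 : ℤ)]; exact h.ordLE.mul hT1
  have hpos : W.OrdGE 1 := schur_deriv_pos
    (fun i R hR => (hR.deriv i).sub (((ordGE_posPart _).mono zero_le_one).mul hR))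
    (fun i => by
      rw [derivLeft_apply, dtOp_one, zero_sub, mul_one]
      exact (posSubmodule K).neg_mem (ordGE_posPart _)) _ _
  rw [eq_mono_one hW1 hpos]
  congr 1
  have := coeff_mul_top h.ordLE hT1
  rw [zero_add] at this
  rw [hWT, this, hT, coeff_sub, coeff_delta_one_mul, schur_ordLE h.inv_ordLE _ _ 1 zero_lt_one,
    schur_ordLE h.inv_ordLE _ _ 1 zero_lt_one, sub_self, schur_coeff, diff_zero, zero_sub, add_zero, shift_zero_left, mul_neg]

/-- The time shift of an eigenfunction. -/
lemma schur_eigenfunction (h : IsDressing Z Zinv L) {φ : Coef K}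
    (hφ : ∀ i, dt i φ = actN (evol L i) φ) (k : ℕ) :
    schur dtHom (-1) (k + 1) φ
      = -(schur dtHom (-1) k (Z.coeff 0) * shift 1 (Zinv.coeff 0)) * diff φ := by
  -- Evaluation at `φ` intertwines, because `∂(R φ) = (∂R + R B_i) φ`. The predicate restricts to
  -- non-negative powers, where evaluation is multiplicative.
  have h1 := schur_map (D := derivRight (evol L)) (D' := dtHom) (actN.flip φ)
    (p := fun R => R.OrdGE 0)
    (fun l R hR => (hR.deriv l).add (hR.mul ((ordGE_posPart _).mono zero_le_one)))
    (fun l R hR => by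
      simp only [LinearMap.flip_apply, derivRight_apply, dtHom_apply]
      rw [dt_actN, hφ, map_add, LinearMap.add_apply,
        actN_mul hR ((ordGE_posPart _).mono zero_le_one)]) (-1) (k + 1) 1 (ordGE_delta 0)
  rw [h.schur_evol, LinearMap.flip_apply, LinearMap.flip_apply, actN_mono_one, one_def,
    delta_zero_eq, actN_mulOp, one_mul] at h1
  exact h1.symm

/-- The time shift of an adjoint eigenfunction. -/
lemma schur_adjoint_eigenfunction (h : IsDressing Z Zinv L) {θ : Coef K}
    (hθ : ∀ i, dt i θ = -radj (evol L i) θ) (k : ℕ) :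
    schur dtHom 1 (k + 1) θ
      = diffAdj (θ * -(Z.coeff 0 * shift 1 (schur dtHom 1 k (Zinv.coeff 0)))) := by
  have h1 := schur_map (D := derivLeft (evol L)) (D' := dtHom) (radj.flip θ)
    (p := fun R => R.OrdGE 0)
    (fun l R hR => (hR.deriv l).sub (((ordGE_posPart _).mono zero_le_one).mul hR))
    (fun l R hR => by
      simp only [LinearMap.flip_apply, derivLeft_apply, dtHom_apply]
      rw [dt_radj, hθ, map_sub, LinearMap.sub_apply, map_neg,
        radj_mul ((ordGE_posPart _).mono zero_le_one) hR, sub_eq_add_neg]) 1 (k + 1) 1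
    (ordGE_delta 0)
  rw [h.schur_evol_left, LinearMap.flip_apply, LinearMap.flip_apply, radj_mono_one, one_def,
    delta_zero_eq, radj_mulOp, mul_one] at h1
  exact h1.symm

end IsDressing

end Dressing

end DMKP

end

noncomputable section

namespace DMKP

/-! ### Extension of scalars -/

section ScalarExtension

open OpSeries PDO

variable {K K' : Type*} [Field K] [Field K']

/-- Extension of scalars of coefficient functions. -/
def mapCoef (f : K →+* K') : Coef K →+* Coef K' where
  toFun g n := MvPowerSeries.map f (g n)
  map_zero' := by funext n; exact map_zero _
  map_one' := by funext n; exact map_one _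
  map_add' _ _ := by funext n; exact map_add _ _ _
  map_mul' _ _ := by funext n; exact map_mul _ _ _

lemma mapCoef_apply (f : K →+* K') (g : Coef K) (n : ℤ) :
    mapCoef f g n = MvPowerSeries.map f (g n) := rfl

lemma mapCoef_shift (f : K →+* K') (k : ℤ) (g : Coef K) :
    mapCoef f (shift k g) = shift k (mapCoef f g) := rfl

lemma mapCoef_diff (f : K →+* K') (g : Coef K) : mapCoef f (diff g) = diff (mapCoef f g) := by
  rw [diff_eq, map_sub, mapCoef_shift, ← diff_eq]

lemma mapCoef_diffShift (f : K →+* K') (i : ℕ) (j : ℤ) (g : Coef K) :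
    mapCoef f (diffShift i j g) = diffShift i j (mapCoef f g) := by
  rw [diffShift_apply, diffShift_apply, ← mapCoef_shift]
  generalize shift j g = g
  induction i generalizing g with
  | zero => rfl
  | succ i ih =>
    rw [Function.iterate_succ_apply, Function.iterate_succ_apply, ih, mapCoef_diff]

lemma mapCoef_dt (f : K →+* K') (i : ℕ+) (g : Coef K) :
    mapCoef f (dt i g) = dt i (mapCoef f g) := by
  funext n
  ext d
  simp [mapCoef_apply, dt, MvPowerSeries.coeff_pderiv]

@[simp] lemma coeff_mapScalars (f : K →+* K') (A : PDO K) (m : ℤ) :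
    (mapScalars f A).coeff m = mapCoef f (A.coeff m) := rfl

lemma mapScalars_ordLE (f : K →+* K') {A : PDO K} {N : ℤ} (h : A.OrdLE N) :
    (mapScalars f A).OrdLE N := fun m hm => by rw [coeff_mapScalars, h m hm, map_zero]

lemma mapScalars_ordGE (f : K →+* K') {A : PDO K} {N : ℤ} (h : A.OrdGE N) :
    (mapScalars f A).OrdGE N := fun m hm => by rw [coeff_mapScalars, h m hm, map_zero]

lemma mapScalars_mono (f : K →+* K') (g : Coef K) (k : ℤ) :
    mapScalars f (mono g k) = mono (mapCoef f g) k := by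
  ext1; funext m
  rw [coeff_mapScalars, coeff_mono, coeff_mono]
  split_ifs <;> simp

lemma mapScalars_mulOp (f : K →+* K') (g : Coef K) :
    mapScalars f (mulOp g) = mulOp (mapCoef f g) := mapScalars_mono f g 0

lemma mapScalars_delta (f : K →+* K') (k : ℤ) : mapScalars f (delta k) = delta k := by
  rw [delta, mapScalars_mono, map_one, delta]

lemma mapScalars_mul (f : K →+* K') (A B : PDO K) :
    mapScalars f (A * B) = mapScalars f A * mapScalars f B := by
  obtain ⟨N, hA, hB⟩ := exists_ordLE₂ A B
  ext1; funext m
  obtain ⟨I, hI⟩ : ∃ I : ℕ, N - m + N < I := ⟨(N - m + N + 1).toNat, by omega⟩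
  simp only [mul_def, coeff_mapScalars,
    comp_coeff_diffShift hA hB (k₀ := m - N) le_rfl le_rfl hI,
    comp_coeff_diffShift (mapScalars_ordLE f hA) (mapScalars_ordLE f hB) (k₀ := m - N)
      le_rfl le_rfl hI, map_sum, map_zsmul, map_mul, mapCoef_diffShift]

lemma mapScalars_add (f : K →+* K') (A B : PDO K) :
    mapScalars f (A + B) = mapScalars f A + mapScalars f B := by
  ext1; funext m; exact map_add (mapCoef f) _ _

lemma mapScalars_npow (f : K →+* K') (A : PDO K) (i : ℕ) :
    mapScalars f (npow A i) = npow (mapScalars f A) i := by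
  rw [npow_eq_pow, npow_eq_pow]
  induction i with
  | zero => rw [pow_zero, pow_zero, one_def, mapScalars_delta, one_def]
  | succ i ih => rw [pow_succ, pow_succ, mapScalars_mul, ih]

lemma mapScalars_posPart (f : K →+* K') (A : PDO K) :
    mapScalars f (PDO.posPart A) = PDO.posPart (mapScalars f A) := by
  ext1; funext m
  change mapCoef f (if 1 ≤ m then A.coeff m else 0) = if 1 ≤ m then mapCoef f (A.coeff m) else 0
  split_ifs <;> simp

lemma mapScalars_nonposPart (f : K →+* K') (A : PDO K) :
    mapScalars f (nonposPart A) = nonposPart (mapScalars f A) := by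
  ext1; funext m
  change mapCoef f (if m ≤ 0 then A.coeff m else 0) = if m ≤ 0 then mapCoef f (A.coeff m) else 0
  split_ifs <;> simp

lemma IsDressing.mapScalars {Z Zinv L : PDO K} (h : IsDressing Z Zinv L) (f : K →+* K') :
    IsDressing (mapScalars f Z) (mapScalars f Zinv) (mapScalars f L) where
  order_le := mapScalars_ordLE f h.ordLE
  isUnit_lead := h.isUnit_lead.map (mapCoef f)
  mul_inv := by
    have := congrArg (PDO.mapScalars f) h.mul_inv'
    rwa [mapScalars_mul, one_def, mapScalars_delta] at this
  inv_mul := by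
    have := congrArg (PDO.mapScalars f) h.inv_mul'
    rwa [mapScalars_mul, one_def, mapScalars_delta] at this
  lax := by
    have := congrArg (PDO.mapScalars f) h.lax'
    rwa [mapScalars_mul, mapScalars_mul, mapScalars_delta] at this
  sato i m := by
    rw [coeff_mapScalars, ← mapCoef_dt, h.sato, map_neg, ← mapScalars_npow,
      ← mapScalars_nonposPart, ← mul_def, ← mul_def, ← mapScalars_mul, coeff_mapScalars]

lemma mapScalars_evol (f : K →+* K') (L : PDO K) (i : ℕ+) :
    mapScalars f (IsDressing.evol L i) = IsDressing.evol (mapScalars f L) i := by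
  rw [IsDressing.evol, mapScalars_posPart, mapScalars_npow]

lemma mapCoef_actN (f : K →+* K') (B : PDO K) (φ : Coef K) :
    mapCoef f (actN B φ) = actN (mapScalars f B) (mapCoef f φ) := by
  rw [actN_apply, actN_apply, ← coeff_mapScalars, mapScalars_mul, mapScalars_mulOp]

lemma mapCoef_rcoeff (f : K →+* K') (m : ℤ) (A : PDO K) :
    mapCoef f (rcoeff m A) = rcoeff m (mapScalars f A) := by
  rw [rcoeff_apply, rcoeff_apply, mapCoef_shift, ← coeff_mapScalars, mapScalars_mul,
    mapScalars_delta]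

lemma mapCoef_radj (f : K →+* K') (B : PDO K) (θ : Coef K) :
    mapCoef f (radj B θ) = radj (mapScalars f B) (mapCoef f θ) := by
  rw [radj_apply, radj_apply, mapCoef_rcoeff, mapScalars_mul, mapScalars_mulOp]

end ScalarExtension

/-! ### Generating series, time shifts and left and right symbols -/

section Symbols

open OpSeries PDO

variable {K : Type*} [Field K]

/-- The constants as a ring homomorphism. -/
def constHom : K →+* Coef K where
  toFun := const
  map_zero' := by funext n; exact map_zero _
  map_one' := by funext n; exact map_one _
  map_add' _ _ := by funext n; exact map_add _ _ _
  map_mul' _ _ := by funext n; exact map_mul _ _ _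

lemma const_mul (a b : K) : const (a * b) = const a * const b := (constHom (K := K)).map_mul a b
lemma const_add (a b : K) : const (a + b) = const a + const b := (constHom (K := K)).map_add a b
lemma const_neg (a : K) : const (-a) = -const a := (constHom (K := K)).map_neg a
@[simp] lemma const_one : const (1 : K) = 1 := (constHom (K := K)).map_one
@[simp] lemma const_zero : const (0 : K) = 0 := (constHom (K := K)).map_zero
lemma shift_const (k : ℤ) (c : K) : shift k (const c) = const c := rfl
@[simp] lemma diff_const (c : K) : diff (const c) = 0 := by rw [diff_eq, shift_const, sub_self]
lemma diff_const_mul (c : K) (f : Coef K) : diff (const c * f) = const c * diff f := by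
  rw [diff_mul, diff_const, zero_mul, add_zero, shift_const]
lemma const_mul_eq_smul (c : K) (f : Coef K) : const c * f = c • f := by
  funext n
  exact (MvPowerSeries.smul_eq_C_mul (f n) c).symm

lemma const_injective_mul {c : K} (hc : c ≠ 0) {f g : Coef K} (h : const c * f = const c * g) :
    f = g := by
  have := congrArg (fun f => const c⁻¹ * f) h
  simpa only [← mul_assoc, ← const_mul, inv_mul_cancel₀ hc, const_one, one_mul] using this

/-- Power series in the inverse spectral variable with coefficient functions as coefficients,
regarded as coefficient functions over the Laurent series. -/
def expandFun (F : PowerSeries (Coef K)) : Coef (LaurentSeries K) :=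
  fun n α => HahnSeries.ofPowerSeries ℤ K
    (PowerSeries.mk fun k => MvPowerSeries.coeff α (PowerSeries.coeff k F n))

lemma coeff_expandFun (F : PowerSeries (Coef K)) (n : ℤ) (α : ℕ+ →₀ ℕ) :
    MvPowerSeries.coeff α (expandFun F n) = HahnSeries.ofPowerSeries ℤ K
    (PowerSeries.mk fun k => MvPowerSeries.coeff α (PowerSeries.coeff k F n)) := rfl

/-- The ring homomorphism `expandFun`. -/
def expand : PowerSeries (Coef K) →+* Coef (LaurentSeries K) where
  toFun := expandFun
  map_zero' := by
    funext n; ext1 α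
    rw [coeff_expandFun, Pi.zero_apply, map_zero, ← map_zero (HahnSeries.ofPowerSeries ℤ K)]
    refine congrArg _ (PowerSeries.ext fun k => ?_)
    simp
  map_one' := by
    classical
    funext n; ext1 α
    rw [coeff_expandFun, Pi.one_apply, MvPowerSeries.coeff_one]
    have : (if α = 0 then (1 : LaurentSeries K) else 0)
        = HahnSeries.ofPowerSeries ℤ K (if α = 0 then 1 else 0) := by split_ifs <;> simp
    rw [this]
    refine congrArg _ (PowerSeries.ext fun k => ?_)
    rw [PowerSeries.coeff_mk, PowerSeries.coeff_one]
    split_ifs with h1 h2 h2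
    · simp [h1, h2]
    · simp [h1, MvPowerSeries.coeff_one, h2]
    · simp [h2, PowerSeries.coeff_one, h1]
    · simp
  map_add' F G := by
    funext n; ext1 α
    rw [Pi.add_apply, map_add, coeff_expandFun, coeff_expandFun, coeff_expandFun, ← map_add]
    refine congrArg _ (PowerSeries.ext fun k => ?_)
    simp
  map_mul' F G := by
    classical
    funext n; ext1 α
    rw [Pi.mul_apply, MvPowerSeries.coeff_mul, coeff_expandFun]
    simp only [coeff_expandFun, ← map_mul, ← map_sum]
    refine congrArg _ (PowerSeries.ext fun k => ?_)
    simp only [PowerSeries.coeff_mk, PowerSeries.coeff_mul, map_sum, Finset.sum_apply,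
      Pi.mul_apply, MvPowerSeries.coeff_mul]
    rw [Finset.sum_comm]

lemma coeff_expand (F : PowerSeries (Coef K)) (n : ℤ) (α : ℕ+ →₀ ℕ) :
    MvPowerSeries.coeff α (expand F n) = HahnSeries.ofPowerSeries ℤ K
    (PowerSeries.mk fun k => MvPowerSeries.coeff α (PowerSeries.coeff k F n)) := rfl

lemma ofPowerSeries_coeff_natCast (F : PowerSeries K) (k : ℕ) :
    (HahnSeries.ofPowerSeries ℤ K F).coeff k = PowerSeries.coeff k F :=
  HahnSeries.ofPowerSeries_apply_coeff F k

lemma ofPowerSeries_coeff_neg (F : PowerSeries K) {j : ℤ} (hj : j < 0) :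
    (HahnSeries.ofPowerSeries ℤ K F).coeff j = 0 := by
  rw [HahnSeries.ofPowerSeries_apply]
  refine HahnSeries.embDomain_of_notMem_range ?_
  rintro ⟨k, rfl⟩
  simp at hj
  omega

lemma coeff_single_mul' (N j : ℤ) (x : LaurentSeries K) :
    (HahnSeries.single N 1 * x).coeff j = x.coeff (j - N) := by
  rw [HahnSeries.coeff_single_mul, one_mul]

/-- The functions which do not depend on the spectral variable. -/
abbrev emb : Coef K →+* Coef (LaurentSeries K) := mapCoef HahnSeries.C

lemma expand_C (g : Coef K) : expand (PowerSeries.C g) = emb g := by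
  funext n; ext1 α
  rw [coeff_expand, mapCoef_apply, MvPowerSeries.coeff_map, ← HahnSeries.ofPowerSeries_C]
  congr 1; ext k
  rw [PowerSeries.coeff_mk, PowerSeries.coeff_C, PowerSeries.coeff_C]
  split_ifs <;> simp

lemma expand_map_shift (k : ℤ) (F : PowerSeries (Coef K)) :
    expand (PowerSeries.map (shiftHom k) F) = shift k (expand F) := rfl

/-- The generating series of a time shift. -/
def schurSeries (ε : K) (f : Coef K) : PowerSeries (Coef K) :=
  PowerSeries.mk fun k => schur dtHom ε k f

variable [CharZero K]

/-- The time shift of a coefficient function. -/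
def tshift (ε : K) : Coef K →+* Coef (LaurentSeries K) where
  toFun f := expand (schurSeries ε f)
  map_zero' := by
    rw [← map_zero expand]; congr 1; ext1 k
    rw [schurSeries, PowerSeries.coeff_mk, map_zero, map_zero]
  map_one' := by
    rw [← map_one expand]; congr 1; ext1 k
    rw [schurSeries, PowerSeries.coeff_mk, PowerSeries.coeff_one]
    cases k with
    | zero => simp
    | succ k =>
      rw [schur_succ, if_neg (Nat.succ_ne_zero k)]
      simp [dtHom_apply]
  map_add' f g := by
    rw [← map_add expand]; congr 1; ext1 k
    simp only [schurSeries, PowerSeries.coeff_mk, map_add]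
  map_mul' f g := by
    rw [← map_mul expand]; congr 1; ext1 k
    simp only [schurSeries, PowerSeries.coeff_mk, PowerSeries.coeff_mul, schur_mul]

lemma tshift_eq (ε : K) (f : Coef K) : tshift ε f = expand (schurSeries ε f) := rfl

lemma tshift_apply (ε : K) (f : Coef K) (n : ℤ) : tshift ε f n = timeShift ε (f n) := by
  change (fun α => HahnSeries.ofPowerSeries ℤ K (PowerSeries.mk fun k => MvPowerSeries.coeff α
    (PowerSeries.coeff k (schurSeries ε f) n))) = _
  simp only [schurSeries, PowerSeries.coeff_mk, schur_apply]
  rfl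

lemma tshift_shift (ε : K) (k : ℤ) (f : Coef K) :
    tshift ε (shift k f) = shift k (tshift ε f) := by
  funext n; rw [tshift_apply, shift_apply, shift_apply, tshift_apply]

lemma tshift_diff (ε : K) (f : Coef K) : tshift ε (diff f) = diff (tshift ε f) := by
  rw [diff_eq, map_sub, tshift_shift, ← diff_eq]

omit [CharZero K]

/-- The symbol of an operator as a coefficient function. -/
def sym (A : OpSeries K) : Coef (LaurentSeries K) := symbol A

lemma coeff_sym (A : OpSeries K) (n : ℤ) (α : ℕ+ →₀ ℕ) (j : ℤ) :
    (MvPowerSeries.coeff α (sym A n)).coeff j = MvPowerSeries.coeff α (A.coeff (-j) n) := rfl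

lemma sym_add (A B : OpSeries K) : sym (A + B) = sym A + sym B := by
  funext n; ext α j
  rw [coeff_sym, Pi.add_apply, map_add, HahnSeries.coeff_add, coeff_sym, coeff_sym]
  simp

lemma sym_neg (A : OpSeries K) : sym (-A) = -sym A := by
  funext n; ext α j
  rw [coeff_sym, Pi.neg_apply, map_neg, HahnSeries.coeff_neg, coeff_sym]
  simp

lemma sym_sub (A B : OpSeries K) : sym (A - B) = sym A - sym B := by
  rw [sub_eq_add_neg, sym_add, sym_neg, ← sub_eq_add_neg]

lemma sym_translate (k : ℤ) (A : OpSeries K) : sym (PDO.translate k A) = shift k (sym A) := rfl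

lemma spec_zpow (N : ℤ) : (spec : LaurentSeries K) ^ N = HahnSeries.single (-N) 1 := by
  have h : (spec : LaurentSeries K) = (HahnSeries.single (1 : ℤ) 1)⁻¹ := by
    rw [HahnSeries.inv_single, inv_one, spec]
  rw [h, inv_zpow']
  exact (RatFunc.single_zpow (-N)).symm

lemma spec_ne_zero : (spec : LaurentSeries K) ≠ 0 := by simp [spec]

/-- Reduces identities between symbols to identities between power series in `λ⁻¹`; the freedom in
`N` allows the same operator to be expanded from different starting orders. -/
lemma sym_eq_expand {A : OpSeries K} {N : ℤ} (hA : A.OrdLE N) :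
    sym A = const (spec ^ N) * expand (PowerSeries.mk fun j => A.coeff (N - j)) := by
  funext n; ext α j
  rw [coeff_sym, Pi.mul_apply, const, MvPowerSeries.coeff_C_mul, spec_zpow, coeff_single_mul',
    sub_neg_eq_add, coeff_expand]
  rcases lt_or_ge (j + N) 0 with h | h
  · rw [ofPowerSeries_coeff_neg _ h, hA _ (by omega)]
    simp
  · obtain ⟨k, hk⟩ := Int.eq_ofNat_of_zero_le h
    rw [hk, ofPowerSeries_coeff_natCast, PowerSeries.coeff_mk, PowerSeries.coeff_mk]
    congr 3; omega

lemma sym_mulOp_mul (g : Coef K) (A : OpSeries K) : sym (mulOp g * A) = emb g * sym A := by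
  obtain ⟨N, hN⟩ := A.bdd
  have h : (mulOp g * A : PDO K).OrdLE N := fun m hm => by
    rw [coeff_mulOp_mul, hN m hm, mul_zero]
  rw [sym_eq_expand hN, sym_eq_expand h, ← expand_C, mul_left_comm, ← map_mul]
  congr 2; ext1 k
  rw [PowerSeries.coeff_C_mul, PowerSeries.coeff_mk, PowerSeries.coeff_mk, coeff_mulOp_mul]

lemma sym_mul_delta (A : OpSeries K) (i : ℕ) :
    sym (A * delta i) = const (spec ^ i) * sym A := by
  funext n; ext α j
  rw [coeff_sym, Pi.mul_apply, const, MvPowerSeries.coeff_C_mul, ← zpow_natCast, spec_zpow,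
    coeff_single_mul', coeff_sym, coeff_mul_delta]
  congr 3; ring

lemma sym_mul_delta_one (A : OpSeries K) :
    sym (A * delta 1) = const spec * sym A := by
  simpa using sym_mul_delta A 1

lemma delta_one_mul (A : PDO K) :
    delta 1 * A = PDO.translate 1 A * delta 1 + PDO.translate 1 A - A := by
  ext1; funext m
  rw [coeff_delta_one_mul, coeff_sub, coeff_add, coeff_mul_delta, diff_eq]
  simp only [PDO.translate]
  ring

/-- `Δ = Γ - 1`, and `Γ` multiplies `(1+λ)^n` by `1+λ`. -/
lemma sym_delta_one_mul (A : PDO K) :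
    sym (delta 1 * A) = const (1 + spec) * shift 1 (sym A) - sym A := by
  rw [delta_one_mul, sym_sub, sym_add, sym_mul_delta_one, sym_translate, const_add, const_one]
  ring

lemma dt_sym (i : ℕ+) (A : OpSeries K) : dt i (sym A) = sym (dtOp i A) := by
  funext n; ext α j
  rw [coeff_sym, coeff_dtOp]
  simp only [dt, MvPowerSeries.coeff_pderiv]
  have : ∀ (x : LaurentSeries K) (c : ℕ), (x * ((c : LaurentSeries K) + 1)).coeff j
      = x.coeff j * ((c : K) + 1) := by
    intro x c
    have e : x * ((c : LaurentSeries K) + 1) = (c + 1) • x := by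
      rw [nsmul_eq_mul, mul_comm]; push_cast; rfl
    rw [e, HahnSeries.coeff_nsmul, Pi.smul_apply, nsmul_eq_mul, mul_comm]; push_cast; rfl
  rw [this, coeff_sym]

/-- The right symbol of an operator `∑ Δ^m ∘ b_m`. -/
def rsym (A : PDO K) : Coef (LaurentSeries K) := sym (adjoint A)

lemma rsym_add (A B : PDO K) : rsym (A + B) = rsym A + rsym B := by
  rw [rsym, rsym, rsym, ← sym_add]
  congr 1; ext1; funext m
  simp only [coeff_add, coeff_adjoint, map_add]

lemma rsym_sub (A B : PDO K) : rsym (A - B) = rsym A - rsym B := by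
  rw [rsym, rsym, rsym, ← sym_sub]
  congr 1; ext1; funext m
  simp only [coeff_sub, coeff_adjoint, map_sub]

lemma rsym_mul_mulOp (A : PDO K) (g : Coef K) : rsym (A * mulOp g) = emb g * rsym A := by
  rw [rsym, rsym, ← sym_mulOp_mul]
  congr 1; ext1; funext m
  rw [coeff_adjoint, rcoeff_mul_mulOp, coeff_mulOp_mul, coeff_adjoint, mul_comm]

lemma rsym_delta_mul (A : PDO K) (i : ℕ) :
    rsym (delta i * A) = const (spec ^ i) * rsym A := by
  rw [rsym, rsym, ← sym_mul_delta]
  congr 1; ext1; funext m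
  rw [coeff_adjoint, rcoeff_delta_mul, coeff_mul_delta, coeff_adjoint]

lemma rsym_mul_delta_one (A : PDO K) :
    rsym (A * delta 1) = const (1 + spec) * shift (-1) (rsym A) - rsym A := by
  have : adjoint (A * delta 1)
      = PDO.translate (-1) (adjoint A) * delta 1 + PDO.translate (-1) (adjoint A) - adjoint A := by
    ext1; funext m
    rw [coeff_sub, coeff_add, coeff_mul_delta, coeff_adjoint, coeff_adjoint, rcoeff_mul_delta,
      shift_add]
    simp only [PDO.translate, coeff_adjoint]
  rw [rsym, rsym, this, sym_sub, sym_add, sym_mul_delta_one, sym_translate, const_add, const_one]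
  ring

lemma dt_rsym (i : ℕ+) (A : PDO K) : dt i (rsym A) = rsym (dtOp i A) := by
  rw [rsym, rsym, dt_sym]
  congr 1; ext1; funext m
  rw [coeff_dtOp, coeff_adjoint, coeff_adjoint, dt_rcoeff]

lemma adjoint_ordLE {A : PDO K} {N : ℤ} (hA : A.OrdLE N) : (adjoint A).OrdLE N :=
  fun m hm => by rw [coeff_adjoint, rcoeff_eq_zero hA hm]

lemma rcoeff_translate (m k : ℤ) (A : PDO K) :
    rcoeff m (PDO.translate k A) = shift k (rcoeff m A) := by
  have e : (delta (-1 - m) * PDO.translate k A).coeff (-1)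
      = shift k ((delta (-1 - m) * A).coeff (-1)) := by
    rw [delta, mul_def, mul_def, coeff_comp_mono, coeff_comp_mono]
    change _ = (shiftHom k : Coef K →+* Coef K).toAddMonoidHom (∑ᶠ i : ℕ, _)
    rw [AddMonoidHom.map_finsum_of_injective]
    · refine finsum_congr fun i => ?_
      have hs : ∀ (c : ℤ) (g : Coef K),
          (shiftHom k : Coef K →+* Coef K).toAddMonoidHom (c • g) = c • shift k g :=
        fun c g => rfl
      have comm : ∀ (j : ℤ) (f : Coef K),
          diffShift i j (shift k f) = shift k (diffShift i j f) := by
        intro j f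
        have c : Function.Commute (diff (K := K)) (shift k) := fun h => diff_shift k h
        rw [diffShift_apply, diffShift_apply, shift_shift, add_comm, ← shift_shift]
        exact (c.iterate_left i) _
      rw [hs, one_mul, one_mul, ← comm]
      rfl
    · intro f g hfg
      have := congrArg (shift (-k)) (show shift k f = shift k g from hfg)
      rwa [shift_shift, shift_shift, neg_add_cancel, shift_zero_left, shift_zero_left] at this
  rw [rcoeff_apply, rcoeff_apply, e, shift_shift, shift_shift, add_comm]

lemma rsym_translate (k : ℤ) (A : PDO K) : rsym (PDO.translate k A) = shift k (rsym A) := by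
  rw [rsym, rsym, ← sym_translate]
  congr 1; ext1; funext m
  rw [coeff_adjoint, rcoeff_translate]
  simp only [PDO.translate, coeff_adjoint]

end Symbols

end DMKP

end

noncomputable section

namespace DMKP

/-! ### Exponential type in the spectral variable -/

section Growth

open OpSeries PDO

variable {K : Type*} [Field K]

/-- The Laurent series has no terms below the `p`-th. -/
def VanishBelow (x : LaurentSeries K) (p : ℤ) : Prop := ∀ j < p, x.coeff j = 0

lemma VanishBelow.mono {x : LaurentSeries K} {p q : ℤ} (h : VanishBelow x p) (hq : q ≤ p) :
    VanishBelow x q := fun j hj => h j (by omega)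

lemma VanishBelow.add {x y : LaurentSeries K} {p : ℤ} (hx : VanishBelow x p)
    (hy : VanishBelow y p) : VanishBelow (x + y) p := fun j hj => by
  rw [HahnSeries.coeff_add, hx j hj, hy j hj, add_zero]

lemma VanishBelow.mul {x y : LaurentSeries K} {p q : ℤ} (hx : VanishBelow x p)
    (hy : VanishBelow y q) : VanishBelow (x * y) (p + q) := fun j hj => by
  rw [HahnSeries.coeff_mul]
  refine Finset.sum_eq_zero fun ij hij => ?_
  have hs := (Finset.mem_antidiagonal.mp hij).2.2
  rcases lt_or_ge ij.1 p with h | h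
  · rw [hx _ h, zero_mul]
  · rw [hy _ (by omega), mul_zero]

lemma VanishBelow.sum {ι : Type*} {s : Finset ι} {x : ι → LaurentSeries K} {p : ℤ}
    (h : ∀ i ∈ s, VanishBelow (x i) p) : VanishBelow (∑ i ∈ s, x i) p := fun j hj => by
  rw [HahnSeries.coeff_sum]
  exact Finset.sum_eq_zero fun i hi => h i hi j hj

lemma vanishBelow_C (c : K) : VanishBelow (HahnSeries.C c) 0 := fun j hj => by
  rw [HahnSeries.C_apply, HahnSeries.coeff_single_of_ne (by omega)]

lemma vanishBelow_one : VanishBelow (1 : LaurentSeries K) 0 := by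
  rw [← map_one HahnSeries.C]; exact vanishBelow_C 1

lemma VanishBelow.pow {x : LaurentSeries K} {p : ℤ} (h : VanishBelow x p) (m : ℕ) :
    VanishBelow (x ^ m) (m * p) := by
  induction m with
  | zero => simpa using vanishBelow_one
  | succ m ih =>
    rw [pow_succ]
    refine (ih.mul h).mono (le_of_eq ?_)
    push_cast; ring

lemma VanishBelow.prod {ι : Type*} {s : Finset ι} {x : ι → LaurentSeries K} {p : ι → ℤ}
    (h : ∀ i ∈ s, VanishBelow (x i) (p i)) : VanishBelow (∏ i ∈ s, x i) (∑ i ∈ s, p i) := by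
  classical
  induction s using Finset.induction_on with
  | empty => simpa using vanishBelow_one
  | insert a s ha ih =>
    rw [Finset.prod_insert ha, Finset.sum_insert ha]
    exact (h a (Finset.mem_insert_self _ _)).mul
      (ih fun i hi => h i (Finset.mem_insert_of_mem hi))

lemma vanishBelow_spec : VanishBelow (spec : LaurentSeries K) (-1) := fun j hj => by
  rw [spec, HahnSeries.coeff_single_of_ne (by omega)]

lemma vanishBelow_one_add_spec : VanishBelow (1 + spec : LaurentSeries K) (-1) :=
  (vanishBelow_one.mono (by norm_num)).add vanishBelow_spec

lemma one_add_spec_ne_zero : (1 + spec : LaurentSeries K) ≠ 0 := fun h => by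
  have := congrArg (fun x => HahnSeries.coeff x (-1)) h
  simp [spec, HahnSeries.coeff_one] at this

lemma vanishBelow_inv : VanishBelow ((1 + spec : LaurentSeries K)⁻¹) 1 := by
  have hne := one_add_spec_ne_zero (K := K)
  have h1 : (1 + spec : LaurentSeries K).order ≤ -1 := by
    refine HahnSeries.order_le_of_coeff_ne_zero ?_
    simp [spec, HahnSeries.coeff_one]
  have h2 := HahnSeries.order_mul hne (inv_ne_zero hne)
  rw [mul_inv_cancel₀ hne, HahnSeries.order_one] at h2
  exact fun j hj => HahnSeries.coeff_eq_zero_of_lt_order (by omega)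

lemma vanishBelow_zpow (n : ℤ) : VanishBelow ((1 + spec : LaurentSeries K) ^ n) (-n) := by
  obtain ⟨m, rfl | rfl⟩ := n.eq_nat_or_neg
  · rw [zpow_natCast]
    exact (vanishBelow_one_add_spec.pow m).mono (by omega)
  · rw [zpow_neg, ← inv_zpow, zpow_natCast]
    exact (vanishBelow_inv.pow m).mono (by omega)

/-- The weight of a monomial in the times, where `t_l` has weight `l`. -/
def wt : (ℕ+ →₀ ℕ) →+ ℕ := Finsupp.weight fun l : ℕ+ => (l : ℕ)

/-- Coefficient functions which are of the form `g (1 + λ)^{ε n} e^{± ξ(t, λ)}` with `g` bounded in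
`λ`; a bound for the order at `λ = ∞` is all that is recorded. -/
def Growth (ε : ℤ) (f : Coef (LaurentSeries K)) : Prop :=
  ∃ N : ℤ, ∀ n α, VanishBelow (MvPowerSeries.coeff α (f n)) (-N - wt α - ε * n)

namespace Growth

variable {ε ε' : ℤ} {f g : Coef (LaurentSeries K)}

lemma zero : Growth ε (0 : Coef (LaurentSeries K)) :=
  ⟨0, fun n α j _ => by rw [Pi.zero_apply, map_zero, HahnSeries.coeff_zero]⟩

lemma add (hf : Growth ε f) (hg : Growth ε g) : Growth ε (f + g) := by
  obtain ⟨N, hN⟩ := hf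
  obtain ⟨M, hM⟩ := hg
  refine ⟨max N M, fun n α => ?_⟩
  rw [Pi.add_apply, map_add]
  exact ((hN n α).mono (by omega)).add ((hM n α).mono (by omega))

lemma mul (hf : Growth ε f) (hg : Growth ε' g) : Growth (ε + ε') (f * g) := by
  classical
  obtain ⟨N, hN⟩ := hf
  obtain ⟨M, hM⟩ := hg
  refine ⟨N + M, fun n α => ?_⟩
  rw [Pi.mul_apply, MvPowerSeries.coeff_mul]
  refine VanishBelow.sum fun p hp => ?_
  refine ((hN n p.1).mul (hM n p.2)).mono (le_of_eq ?_)
  rw [Finset.HasAntidiagonal.mem_antidiagonal] at hp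
  rw [← hp, map_add]
  push_cast
  ring

lemma shift (hf : Growth ε f) (k : ℤ) : Growth ε (shift k f) := by
  obtain ⟨N, hN⟩ := hf
  refine ⟨N + ε * k, fun n α => (hN (n + k) α).mono (le_of_eq ?_)⟩
  ring

lemma const (c : LaurentSeries K) : Growth 0 (const c) := by
  refine ⟨-c.order, fun n α => ?_⟩
  classical
  rw [DMKP.const, MvPowerSeries.coeff_C]
  split_ifs
  · exact fun j hj => HahnSeries.coeff_eq_zero_of_lt_order (by omega)
  · exact fun j _ => HahnSeries.coeff_zero

lemma const_mul (hf : Growth ε f) (c : LaurentSeries K) : Growth ε (DMKP.const c * f) := by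
  simpa using (const c).mul hf

lemma neg (hf : Growth ε f) : Growth ε (-f) := by
  have := hf.const_mul (-1)
  rwa [const_neg, const_one, neg_one_mul] at this

lemma sub (hf : Growth ε f) (hg : Growth ε g) : Growth ε (f - g) := by
  rw [sub_eq_add_neg]; exact hf.add hg.neg

lemma zsmul (hf : Growth ε f) (c : ℤ) : Growth ε (c • f) := by
  have := hf.const_mul (c : LaurentSeries K)
  rw [const_mul_eq_smul, Int.cast_smul_eq_zsmul] at this
  exact this

lemma diff (hf : Growth ε f) : Growth ε (diff f) := (hf.shift 1).sub hf

/-- Differentiation in `t_i` reads the coefficient at a monomial whose weight is larger by `i`; the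
loss is absorbed in the constant. -/
lemma dt (hf : Growth ε f) (i : ℕ+) : Growth ε (dt i f) := by
  obtain ⟨N, hN⟩ := hf
  refine ⟨N + i, fun n α => ?_⟩
  have hi : wt (Finsupp.single i 1) = i := by
    rw [wt, Finsupp.weight_single, one_smul]
  rw [DMKP.dt, MvPowerSeries.coeff_pderiv]
  refine ((hN n (α + Finsupp.single i 1)).mul (q := 0) ?_).mono (le_of_eq ?_)
  · have : ((α i : LaurentSeries K) + 1) = HahnSeries.C ((α i : K) + 1) := by
      rw [map_add, map_natCast, map_one]
    rw [this]
    exact vanishBelow_C _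
  · rw [map_add, hi]
    push_cast
    ring

lemma emb (g : Coef K) : Growth 0 (emb g) := by
  refine ⟨0, fun n α => ?_⟩
  rw [mapCoef_apply, MvPowerSeries.coeff_map]
  exact (vanishBelow_C _).mono (by omega)

lemma expand (F : PowerSeries (Coef K)) : Growth 0 (expand F) :=
  ⟨0, fun n α j hj => by rw [coeff_expand, ofPowerSeries_coeff_neg _ (by omega)]⟩

lemma sym (A : OpSeries K) : Growth 0 (sym A) := by
  obtain ⟨N, hN⟩ := A.bdd
  refine ⟨N, fun n α j hj => ?_⟩
  rw [coeff_sym, hN _ (by omega)]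
  simp

lemma coeff_mul {A B : PDO (LaurentSeries K)} (hA : ∀ m, Growth ε (A.coeff m))
    (hB : ∀ m, Growth ε' (B.coeff m)) (m : ℤ) : Growth (ε + ε') ((A * B).coeff m) := by
  change Growth _ (∑ᶠ k : ℤ, ∑ᶠ i : ℕ, _)
  refine finsum_induction _ zero (fun _ _ => add) fun k => ?_
  refine finsum_induction _ zero (fun _ _ => add) fun i => ?_
  refine zsmul ((hA k).mul ?_) _
  generalize m - k + i = l
  have h0 : Growth ε' (DMKP.shift (k - i) (B.coeff l)) := (hB l).shift _
  induction i with
  | zero => exact (hB l).shift _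
  | succ i ih =>
    have key : ∀ (j : ℕ) (f : Coef (LaurentSeries K)), Growth ε' f → Growth ε' (DMKP.diff^[j] f) := by
      intro j
      induction j with
      | zero => exact fun f hf => hf
      | succ j ih => exact fun f hf => ih _ hf.diff
    exact key _ _ h0

lemma coeff_mono (hf : Growth ε f) (k m : ℤ) : Growth ε ((PDO.mono f k).coeff m) := by
  rw [DMKP.coeff_mono]
  split_ifs
  exacts [hf, zero]

lemma one : Growth 0 (1 : Coef (LaurentSeries K)) := by
  rw [← const_one]; exact const 1

/-- A function of exponential type which does not depend on `n` vanishes. -/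
lemma eq_zero (hf : Growth ε f) (hε : ε * ε = 1) (h : DMKP.diff f = 0) : f = 0 := by
  obtain ⟨N, hN⟩ := hf
  have hstep : ∀ n, f (n + 1) = f n := fun n => sub_eq_zero.mp (congrFun h n)
  have hconst : ∀ n m, f n = f m := by
    have h0 : ∀ n, f n = f 0 := by
      intro n
      induction n using Int.induction_on with
      | zero => rfl
      | succ i ih => rw [hstep, ih]
      | pred i ih => rw [← ih, ← hstep (-(i : ℤ) - 1), sub_add_cancel]
    exact fun n m => (h0 n).trans (h0 m).symm
  funext n; ext α j
  -- As `ε² = 1`, this choice of `n` turns the bound `-N - wt α - ε n` into `j + 1`, just above the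
  -- coefficient at `j`.
  have hb := hN (-ε * (N + wt α + j + 1)) α j (by
    rw [show ε * (-ε * (N + wt α + j + 1)) = -(ε * ε) * (N + wt α + j + 1) by ring, hε]
    omega)
  rw [hconst n, hb]
  simp

lemma eq_of_diff_eq (hf : Growth ε f) (hg : Growth ε g) (hε : ε * ε = 1)
    (h : DMKP.diff f = DMKP.diff g) : f = g := by
  have := (hf.sub hg).eq_zero hε (by rw [diff_sub, h, sub_self])
  exact sub_eq_zero.mp this

end Growth

end Growth

/-! ### The bare exponentials and operators acting on them -/

section Exponential

open OpSeries PDO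

variable {K : Type*} [Field K]

instance [CharZero K] : CharZero (LaurentSeries K) :=
  charZero_of_injective_ringHom (f := (HahnSeries.C : K →+* LaurentSeries K))
    HahnSeries.C_injective

lemma pderiv_expXi [CharZero K] (ε : LaurentSeries K) (i : ℕ+) :
    MvPowerSeries.pderiv (LaurentSeries K) i (expXi ε)
      = MvPowerSeries.C (ε * spec ^ (i : ℕ)) * expXi ε := by
  classical
  ext1 d
  rw [MvPowerSeries.coeff_pderiv, MvPowerSeries.coeff_C_mul]
  set g : ℕ+ → ℕ → LaurentSeries K := fun l m =>
    (ε * spec ^ (l : ℕ)) ^ m / (Nat.factorial m : LaurentSeries K) with hg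
  have hc : ∀ γ, MvPowerSeries.coeff γ (expXi ε) = γ.prod g := fun γ => rfl
  have hg0 : ∀ l, g l 0 = 1 := fun l => by simp [hg]
  have herase : (d + Finsupp.single i 1).erase i = d.erase i := by
    rw [Finsupp.erase_add, Finsupp.erase_single, add_zero]
  rw [hc, hc, ← Finsupp.mul_prod_erase' _ i g (hg0),
    ← Finsupp.mul_prod_erase' d i g (hg0), herase, Finsupp.add_apply,
    Finsupp.single_eq_same]
  have h1 : g i (d i + 1) * ((d i : LaurentSeries K) + 1) = ε * spec ^ (i : ℕ) * g i (d i) := by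
    have hf : (Nat.factorial (d i) : LaurentSeries K) ≠ 0 :=
      Nat.cast_ne_zero.mpr (Nat.factorial_ne_zero _)
    have hd : ((d i : LaurentSeries K) + 1) ≠ 0 := Nat.cast_add_one_ne_zero _
    simp only [hg, Nat.factorial_succ]
    push_cast
    rw [pow_succ]
    field_simp
  rw [mul_right_comm, h1, mul_assoc]

lemma vanishBelow_expXi {ε : LaurentSeries K} (hε : VanishBelow ε 0) (α : ℕ+ →₀ ℕ) :
    VanishBelow (MvPowerSeries.coeff α (expXi ε)) (-wt α) := by
  have hw : (-(wt α : ℤ)) = ∑ l ∈ α.support, -((α l : ℤ) * (l : ℕ)) := by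
    rw [wt, Finsupp.weight_apply, Finsupp.sum, Finset.sum_neg_distrib]
    push_cast
    simp
  rw [hw]
  change VanishBelow (α.prod fun l m =>
    (ε * spec ^ (l : ℕ)) ^ m / (Nat.factorial m : LaurentSeries K)) _
  refine VanishBelow.prod fun l _ => ?_
  have h1 : VanishBelow (ε * spec ^ (l : ℕ)) (-(l : ℕ)) :=
    (hε.mul (vanishBelow_spec.pow _)).mono (by omega)
  have h2 : VanishBelow ((Nat.factorial (α l) : LaurentSeries K)⁻¹) 0 := by
    have : (Nat.factorial (α l) : LaurentSeries K)⁻¹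
        = HahnSeries.C ((Nat.factorial (α l) : K)⁻¹) := by rw [map_inv₀, map_natCast]
    rw [this]
    exact vanishBelow_C _
  simp only [div_eq_mul_inv]
  refine ((h1.pow (α l)).mul h2).mono (le_of_eq ?_)
  ring

/-- The function `(1 + λ)^n e^{ξ(t, λ)}`. -/
def chi : Coef (LaurentSeries K) := fun n => MvPowerSeries.C ((1 + spec) ^ n) * expXi 1

/-- The function `(1 + λ)^{-n} e^{-ξ(t, λ)}`. -/
def chiAdj : Coef (LaurentSeries K) := fun n => MvPowerSeries.C ((1 + spec) ^ (-n)) * expXi (-1)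

lemma chi_apply (n : ℤ) :
    (chi : Coef (LaurentSeries K)) n = MvPowerSeries.C ((1 + spec) ^ n) * expXi 1 := rfl

lemma chiAdj_apply (n : ℤ) :
    (chiAdj : Coef (LaurentSeries K)) n = MvPowerSeries.C ((1 + spec) ^ (-n)) * expXi (-1) := rfl

lemma growth_chi : Growth 1 (chi : Coef (LaurentSeries K)) :=
  ⟨0, fun n α => by
    rw [chi, MvPowerSeries.coeff_C_mul]
    exact ((vanishBelow_zpow n).mul (vanishBelow_expXi vanishBelow_one α)).mono (by omega)⟩

lemma growth_chiAdj : Growth (-1) (chiAdj : Coef (LaurentSeries K)) :=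
  ⟨0, fun n α => by
    have h : VanishBelow (-1 : LaurentSeries K) 0 := by
      have := vanishBelow_C (-1 : K)
      rwa [map_neg, map_one] at this
    rw [chiAdj, MvPowerSeries.coeff_C_mul]
    exact ((vanishBelow_zpow (-n)).mul (vanishBelow_expXi h α)).mono (by omega)⟩

lemma shift_chi : shift 1 (chi : Coef (LaurentSeries K)) = const (1 + spec) * chi := by
  funext n
  rw [shift_apply, Pi.mul_apply, chi_apply, chi_apply, const,
    zpow_add_one₀ one_add_spec_ne_zero, map_mul]
  ring

lemma shift_chiAdj :
    shift (-1) (chiAdj : Coef (LaurentSeries K)) = const (1 + spec) * chiAdj := by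
  funext n
  rw [shift_apply, Pi.mul_apply, chiAdj_apply, chiAdj_apply, const,
    show -(n + -1) = -n + 1 by ring, zpow_add_one₀ one_add_spec_ne_zero, map_mul]
  ring

lemma dt_chi [CharZero K] (i : ℕ+) :
    dt i (chi : Coef (LaurentSeries K)) = const (spec ^ (i : ℕ)) * chi := by
  funext n
  rw [dt, Pi.mul_apply, chi_apply, const,
    Derivation.leibniz, pderiv_expXi, MvPowerSeries.pderiv_C, one_mul, smul_zero, add_zero,
    smul_eq_mul]
  ring

lemma dt_chiAdj [CharZero K] (i : ℕ+) :
    dt i (chiAdj : Coef (LaurentSeries K)) = -(const (spec ^ (i : ℕ)) * chiAdj) := by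
  funext n
  rw [dt, Pi.neg_apply, Pi.mul_apply, chiAdj_apply, const,
    Derivation.leibniz, pderiv_expXi, MvPowerSeries.pderiv_C, neg_one_mul, smul_zero, add_zero,
    smul_eq_mul, map_neg]
  ring

lemma diff_sym_mul_chi (A : PDO K) : diff (sym A * chi) = sym (delta 1 * A) * chi := by
  rw [diff_eq, shift_mul, shift_chi, sym_delta_one_mul]
  ring

lemma diffAdj_rsym_mul_chiAdj (A : PDO K) :
    diffAdj (rsym A * chiAdj) = rsym (A * delta 1) * chiAdj := by
  rw [diffAdj, shift_mul, shift_chiAdj, rsym_mul_delta_one]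
  ring

lemma mapScalars_mul_delta_one (A : PDO K) :
    mapScalars (HahnSeries.C : K →+* LaurentSeries K) (A * delta 1)
      = mapScalars HahnSeries.C A * delta 1 := by
  rw [mapScalars_mul, mapScalars_delta]

/-- Makes precise that applying `B` to the function `A χ` gives `(BA) χ`; by induction on `B` only
multiplications and `Δ` have to be checked. -/
lemma sym_mul_mul_chi {B : PDO K} (hB : B.OrdGE 0) (A : PDO K) :
    sym (B * A) * chi = actN (mapScalars HahnSeries.C B) (sym A * chi) := by
  revert A
  refine nonneg_induction (P := fun B : PDO K => ∀ A : PDO K, sym (B * A) * chi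
      = actN (mapScalars (HahnSeries.C : K →+* LaurentSeries K) B) (sym A * chi))
    ?_ ?_ ?_ B hB
  · intro B C hB hC A
    have e : sym ((B + C) * A) = sym (B * A) + sym (C * A) := by
      rw [← sym_add]
      exact congrArg sym (add_mul B C A)
    rw [e, add_mul, hB A, hC A, mapScalars_add, map_add, LinearMap.add_apply]
  · intro g A
    rw [mapScalars_mulOp, actN_mulOp, sym_mulOp_mul, mul_assoc]
  · intro B hB ih A
    rw [mul_assoc B, ih, mapScalars_mul_delta_one, actN_mul_delta (mapScalars_ordGE _ hB),
      diff_sym_mul_chi]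

lemma rsym_mul_mul_chiAdj {B : PDO K} (hB : B.OrdGE 0) (A : PDO K) :
    rsym (A * B) * chiAdj = radj (mapScalars HahnSeries.C B) (rsym A * chiAdj) := by
  revert A
  refine nonneg_induction (P := fun B : PDO K => ∀ A : PDO K, rsym (A * B) * chiAdj
      = radj (mapScalars (HahnSeries.C : K →+* LaurentSeries K) B) (rsym A * chiAdj))
    ?_ ?_ ?_ B hB
  · intro B C hB hC A
    have e : rsym (A * (B + C)) = rsym (A * B) + rsym (A * C) := by
      rw [← rsym_add]
      exact congrArg rsym (mul_add A B C)
    rw [e, add_mul, hB A, hC A, mapScalars_add, map_add, LinearMap.add_apply]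
  · intro g A
    rw [mapScalars_mulOp, radj_mulOp, rsym_mul_mulOp]
    ring
  · intro B hB ih A
    rw [← mul_assoc A B, ← diffAdj_rsym_mul_chiAdj, ih, mapScalars_mul_delta_one,
      radj_mul_delta (mapScalars_ordGE _ hB)]

end Exponential

end DMKP

end

noncomputable section

namespace DMKP

/-! ### Linear equations and time shifts of the wave functions -/

section Waves

open OpSeries PDO IsDressing

variable {K : Type*} [Field K] {Z Zinv L : PDO K}

lemma wave_eq (Z : PDO K) : wave Z = sym Z * chi := by
  funext n
  rw [Pi.mul_apply, chi_apply, ← mul_assoc]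
  rfl

lemma waveAdj_eq (Zinv : PDO K) :
    waveAdj Zinv = rsym (PDO.translate (-1) Zinv * delta (-1)) * chiAdj := by
  funext n
  rw [Pi.mul_apply, chiAdj_apply, ← mul_assoc]
  rfl

lemma growth_wave (Z : PDO K) : Growth 1 (wave Z) := by
  rw [wave_eq]; simpa using (Growth.sym Z).mul growth_chi

lemma growth_waveAdj (Zinv : PDO K) : Growth (-1) (waveAdj Zinv) := by
  rw [waveAdj_eq, rsym]; simpa using (Growth.sym (adjoint _)).mul growth_chiAdj

/-- Applying `Δ^*` removes the factor `Δ⁻¹` from the definition of `w^*`. Then `Δ = -Γ Δ^*` undoes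
the translation by `-1`, and the factor `1+λ` compensates the shift of the exponential. -/
lemma const_mul_diff_waveAdj (Zinv : PDO K) :
    const (1 + spec) * diff (waveAdj Zinv) = -(rsym Zinv * chiAdj) := by
  have h1 : diffAdj (waveAdj Zinv) = shift (-1) (rsym Zinv) * chiAdj := by
    have e : PDO.translate (-1) Zinv * delta (-1) * delta 1 = PDO.translate (-1) Zinv := by
      rw [mul_assoc, delta_mul_delta, neg_add_cancel, ← one_def, mul_one]
    rw [waveAdj_eq, diffAdj_rsym_mul_chiAdj, e, rsym_translate]
  have h2 : diff (waveAdj Zinv) = -(rsym Zinv * shift 1 chiAdj) := by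
    have := congrArg (shift 1) h1
    rw [diffAdj_eq, shift_neg, shift_shift, add_neg_cancel, shift_zero_left, shift_mul,
      shift_shift, add_neg_cancel, shift_zero_left] at this
    rw [← this, neg_neg]
  have h3 : const (1 + spec) * shift 1 chiAdj = (chiAdj : Coef (LaurentSeries K)) := by
    have := congrArg (shift 1) (shift_chiAdj (K := K))
    rwa [shift_shift, add_neg_cancel, shift_zero_left, shift_mul, shift_const, eq_comm] at this
  rw [h2, mul_neg, mul_left_comm, h3]

variable [CharZero K]

lemma dt_wave (h : IsDressing Z Zinv L) (i : ℕ+) :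
    dt i (wave Z) = actN (evol (mapScalars HahnSeries.C L) i) (wave Z) := by
  rw [wave_eq, dt_mul, dt_sym, dt_chi, h.dtOp_dressing, sym_sub, sym_mul_delta,
    ← mapScalars_evol, ← sym_mul_mul_chi ((ordGE_posPart _).mono zero_le_one)]
  ring

lemma dt_diff_waveAdj (h : IsDressing Z Zinv L) (i : ℕ+) :
    dt i (diff (waveAdj Zinv))
      = -radj (evol (mapScalars HahnSeries.C L) i) (diff (waveAdj Zinv)) := by
  have h1 : dt i (rsym Zinv * chiAdj)
      = -radj (evol (mapScalars HahnSeries.C L) i) (rsym Zinv * chiAdj) := by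
    rw [dt_mul, dt_rsym, dt_chiAdj, h.dtOp_inv, rsym_sub, rsym_delta_mul, ← mapScalars_evol,
      ← rsym_mul_mul_chiAdj ((ordGE_posPart _).mono zero_le_one)]
    ring
  have h2 : rsym Zinv * chiAdj = -(const (1 + spec) * diff (waveAdj Zinv)) := by
    rw [const_mul_diff_waveAdj, neg_neg]
  refine const_injective_mul one_add_spec_ne_zero ?_
  rw [h2, map_neg, dt_neg, dt_mul, dt_const, zero_mul, zero_add, const_mul_eq_smul _ (diff _),
    map_smul, ← const_mul_eq_smul] at h1
  linear_combination -h1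

lemma const_spec_mul_expand_X :
    const spec * expand PowerSeries.X = (1 : Coef (LaurentSeries K)) := by
  have h0 := sym_eq_expand (A := (1 : PDO K)) (ordLE_delta 0)
  have h1 := sym_eq_expand (A := (1 : PDO K)) ((ordLE_delta 0).mono zero_le_one)
  have e0 : (PowerSeries.mk fun j : ℕ => (1 : PDO K).coeff (0 - j)) = 1 := by
    ext1 j
    rw [PowerSeries.coeff_mk, PowerSeries.coeff_one, one_def, coeff_delta]
    exact if_congr (by omega) rfl rfl
  have e1 : (PowerSeries.mk fun j : ℕ => (1 : PDO K).coeff (1 - j)) = PowerSeries.X := by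
    ext1 j
    rw [PowerSeries.coeff_mk, PowerSeries.coeff_X, one_def, coeff_delta]
    exact if_congr (by omega) rfl rfl
  rw [e0, zpow_zero, const_one, map_one, one_mul] at h0
  rw [e1, zpow_one, h0] at h1
  exact h1.symm

/-- Inversion of a time shift. -/
lemma const_spec_mul_emb {ε : K} {φ f g : Coef K}
    (h : ∀ k, schur dtHom (-ε) (k + 1) φ = -(schur dtHom (-ε) k f * g)) :
    const spec * emb φ = const spec * tshift ε φ - emb f * tshift ε g := by
  -- The hypothesis says `φ(t - ε[x]) = φ - x f(t - ε[x]) g`; shifting by `ε[x]` gives `φ = φ(t +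
  -- ε[x]) - x f g(t + ε[x])`.
  have hser : PowerSeries.C φ = schurSeries ε φ
      - PowerSeries.X * (PowerSeries.C f * schurSeries ε g) := by
    ext1 k
    cases k with
    | zero => simp [schurSeries]
    | succ k =>
      have h1 := sum_schur_schur_neg (D := dtHom) (fun l l' x => dt_dt l l' x) ε (k + 1) φ
      rw [if_neg (Nat.succ_ne_zero k), Finset.Nat.sum_antidiagonal_succ'] at h1
      simp only [h, map_neg, Finset.sum_neg_distrib, sum_schur_schur_neg_mul, schur_zero] at h1
      rw [map_sub, PowerSeries.coeff_succ_X_mul, PowerSeries.coeff_C_mul, schurSeries,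
        schurSeries, PowerSeries.coeff_mk, PowerSeries.coeff_mk, PowerSeries.coeff_C,
        if_neg (Nat.succ_ne_zero k), ← h1]
      ring
  rw [← expand_C, ← expand_C, tshift_eq, tshift_eq, hser, map_sub, map_mul, map_mul]
  linear_combination (-(expand (PowerSeries.C f) * expand (schurSeries ε g)))
    * const_spec_mul_expand_X (K := K)

open Finset in
lemma sum_antidiagonal_telescope {M : Type*} [AddCommGroup M] (G : ℕ → ℕ → M) (j : ℕ) :
    ∑ p ∈ antidiagonal j, (G p.1 (p.2 + 1) - G (p.1 + 1) p.2) = G 0 (j + 1) - G (j + 1) 0 := by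
  have h1 := Nat.sum_antidiagonal_succ (n := j) (f := fun p => G p.1 p.2)
  have h2 := Nat.sum_antidiagonal_succ' (n := j) (f := fun p => G p.1 p.2)
  simp only at h1 h2
  rw [h1] at h2
  rw [sum_sub_distrib, sub_eq_sub_iff_add_eq_add, add_comm _ (G (j + 1) 0), ← h2]

/-- The wave function and the time shift in the same spectral variable. -/
lemma const_spec_mul_wave (h : IsDressing Z Zinv L) :
    const spec * wave Z
      = tshift (-1) (Z.coeff 0) * shift 1 (emb (Zinv.coeff 0)) * diff (wave Z) := by
  -- The value of the shift formula at `x = λ⁻¹`, where `1 - xλ = 0`, taken coefficientwise: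
  -- `schur_sub` writes each product as a difference of neighbours on the antidiagonal, so the sum
  -- telescopes.
  have hser : (PowerSeries.mk fun j : ℕ => Z.coeff (0 - j))
      = schurSeries (-1) (Z.coeff 0) * (PowerSeries.C (shift 1 (Zinv.coeff 0))
        * PowerSeries.mk fun j : ℕ => (delta 1 * Z).coeff (1 + 0 - j)) := by
    ext1 j
    rw [PowerSeries.coeff_mul, PowerSeries.coeff_mk]
    have hterm : ∀ p ∈ Finset.HasAntidiagonal.antidiagonal j,
        PowerSeries.coeff p.1 (schurSeries (-1) (Z.coeff 0)) *
          PowerSeries.coeff p.2 (PowerSeries.C (shift 1 (Zinv.coeff 0))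
          * PowerSeries.mk fun j : ℕ => (delta 1 * Z).coeff (1 + 0 - j))
        = schur dtHom (-1) p.1 (Z.coeff (1 - (p.2 + 1 : ℕ)))
          - schur dtHom (-1) (p.1 + 1) (Z.coeff (1 - p.2)) := by
      intro p _
      have hs := congrArg (fun A => A.coeff (1 - p.2)) (h.schur_sub p.1)
      rw [h.schur_evol, ← mulOp_mul_delta, mul_assoc, coeff_mulOp_mul, coeff_sub, coeff_mul_delta,
        schur_coeff, schur_coeff] at hs
      rw [schurSeries, PowerSeries.coeff_mk, PowerSeries.coeff_C_mul, PowerSeries.coeff_mk,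
        add_zero, show (1 : ℤ) - ((p.2 + 1 : ℕ) : ℤ) = 1 - p.2 - 1 by push_cast; ring]
      linear_combination hs
    rw [Finset.sum_congr rfl hterm, sum_antidiagonal_telescope
      (fun a b => schur dtHom (-1) a (Z.coeff (1 - b)))]
    -- One end of the telescope is the coefficient of `Δ` in `Z`, which is absent; the other end is
    -- the coefficient sought.
    have hZ1 : Z.coeff (1 - (0 : ℕ)) = 0 := h.ordLE _ (by norm_num)
    rw [hZ1, map_zero, sub_zero, schur_zero]
    congr 1; push_cast; ring
  rw [wave_eq, diff_sym_mul_chi, sym_eq_expand h.ordLE, hser,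
    sym_eq_expand ((ordLE_delta 1).mul h.ordLE), map_mul, map_mul, expand_C, ← tshift_eq,
    mapCoef_shift, add_zero, zpow_zero, zpow_one, const_one]
  ring

lemma schur_rcoeff (ε : K) (k : ℕ) (A : PDO K) (m : ℤ) :
    rcoeff m (schur dtOp ε k A) = schur dtHom ε k (rcoeff m A) :=
  schur_map (D := dtOp) (D' := dtHom) (rcoeff m) (p := fun _ => True) (fun _ _ _ => trivial)
    (fun l x _ => (dt_rcoeff l m x).symm) ε k A trivial

/-- The same evaluation at `x = λ⁻¹` for `Z⁻¹`, written with coefficients on the right since `w^*`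
is defined by the adjoint. Moving the `Δ` of `schur_evol_left` past them produces the two shifted
terms. -/
lemma const_spec_mul_rsym_inv (h : IsDressing Z Zinv L) :
    const spec * rsym Zinv
      = tshift 1 (Zinv.coeff 0) * (const (1 + spec) * shift (-1) (rsym Zinv * emb (Z.coeff 0)))
        - shift 1 (tshift 1 (Zinv.coeff 0)) * (rsym Zinv * emb (Z.coeff 0)) := by
  set V : ℤ → Coef K := fun m => rcoeff m Zinv with hV
  set F₀ : PowerSeries (Coef K) := PowerSeries.mk fun j : ℕ => V (0 - j) with hF₀
  set F₁ : PowerSeries (Coef K) := PowerSeries.mk fun j : ℕ => V (1 - j) with hF₁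
  have e₀ : rsym Zinv = expand F₀ := by
    rw [rsym, sym_eq_expand (adjoint_ordLE h.inv_ordLE), zpow_zero, const_one, one_mul]
    simp only [coeff_adjoint, hF₀, hV]
  have e₁ : rsym Zinv = const spec * expand F₁ := by
    rw [rsym, sym_eq_expand ((adjoint_ordLE h.inv_ordLE).mono zero_le_one), zpow_one]
    simp only [coeff_adjoint, hF₁, hV]
  set E := schurSeries (1 : K) (Zinv.coeff 0) with hE
  -- `F₁` is the same expansion as `F₀` started one order higher, so it equals `X F₀`; the pair
  -- encodes the neighbouring coefficients `V (m - 1)` and `V m` of `rcoeff_mul_delta`.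
  have hser : F₀ = E * PowerSeries.map (shiftHom (-1)) ((F₀ + F₁) * PowerSeries.C (Z.coeff 0))
      - PowerSeries.map (shiftHom 1) E * (F₁ * PowerSeries.C (Z.coeff 0)) := by
    ext1 j
    rw [map_sub, PowerSeries.coeff_mul, PowerSeries.coeff_mul, ← Finset.sum_sub_distrib]
    have hterm : ∀ p ∈ Finset.HasAntidiagonal.antidiagonal j,
        PowerSeries.coeff p.1 E * PowerSeries.coeff p.2
          (PowerSeries.map (shiftHom (-1)) ((F₀ + F₁) * PowerSeries.C (Z.coeff 0)))
        - PowerSeries.coeff p.1 (PowerSeries.map (shiftHom 1) E) *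
          PowerSeries.coeff p.2 (F₁ * PowerSeries.C (Z.coeff 0))
        = schur dtHom 1 p.1 (V (1 - (p.2 + 1 : ℕ)))
          - schur dtHom 1 (p.1 + 1) (V (1 - p.2)) := by
      intro p _
      have hs := congrArg (rcoeff (1 - p.2)) (h.schur_inv_sub p.1)
      have hm : (1 : ℤ) - ((p.2 + 1 : ℕ) : ℤ) = 1 - p.2 - 1 := by push_cast; ring
      have hm' : (0 : ℤ) - (p.2 : ℤ) = 1 - p.2 - 1 := by ring
      have hsh : ∀ f g : Coef K, shift (-1) (f * -(g * shift 1 (schur dtHom 1 p.1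
          (Zinv.coeff 0)))) = -(shift (-1) (f * g) * schur dtHom 1 p.1 (Zinv.coeff 0)) := by
        intro f g
        rw [mul_neg, shift_neg, ← mul_assoc, shift_mul, shift_shift, neg_add_cancel,
          shift_zero_left]
      rw [h.schur_evol_left, ← mulOp_mul_delta, ← mul_assoc, rcoeff_mul_delta, rcoeff_mul_mulOp,
        rcoeff_mul_mulOp, map_sub, rcoeff_delta_mul, schur_rcoeff, schur_rcoeff, shift_add, hsh,
        hsh] at hs
      have hsm : ∀ f : Coef K, shiftHom (-1) f = shift (-1) f := fun _ => rfl
      have hsm' : ∀ f : Coef K, shiftHom 1 f = shift 1 f := fun _ => rfl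
      rw [PowerSeries.coeff_map, PowerSeries.coeff_map, PowerSeries.coeff_mul_C,
        PowerSeries.coeff_mul_C, map_add, hsm, hsm', hE, schurSeries, PowerSeries.coeff_mk,
        hF₀, hF₁, PowerSeries.coeff_mk, PowerSeries.coeff_mk, hm, hm', add_mul, shift_add]
      simp only [hV]
      linear_combination hs
    rw [Finset.sum_congr rfl hterm, sum_antidiagonal_telescope
      (fun a b => schur dtHom 1 a (V (1 - b)))]
    have hV1 : V (1 - (0 : ℕ)) = 0 := rcoeff_eq_zero h.inv_ordLE (by norm_num)
    rw [hV1, map_zero, sub_zero, schur_zero, hF₀, PowerSeries.coeff_mk]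
    congr 1; push_cast; ring
  have hser' := congrArg expand hser
  rw [map_sub, map_mul, expand_map_shift, map_mul expand (F₀ + F₁), map_add,
    map_mul expand (PowerSeries.map _ _), expand_map_shift, map_mul expand F₁,
    expand_C, ← e₀, hE, ← tshift_eq] at hser'
  have h1 : const spec * shift (-1) (expand F₁) = shift (-1) (rsym Zinv) := by
    rw [e₁, shift_mul, shift_const]
  rw [const_add, const_one, shift_mul]
  rw [shift_mul, shift_add] at hser'
  generalize rsym Zinv = v at hser' e₁ h1 ⊢
  generalize expand F₁ = v₁ at hser' e₁ h1
  generalize shift 1 (tshift 1 (Zinv.coeff 0)) = T₁ at hser' ⊢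
  generalize tshift 1 (Zinv.coeff 0) = T at hser' ⊢
  generalize shift (-1) (emb (Z.coeff 0)) = z₁ at hser' ⊢
  generalize emb (Z.coeff 0) = z at hser' ⊢
  linear_combination const spec * hser' + T * z₁ * h1 + T₁ * z * e₁

/-- The adjoint wave function and the time shift in the same spectral variable. -/
lemma const_spec_mul_shift_waveAdj (h : IsDressing Z Zinv L) :
    const spec * shift 1 (waveAdj Zinv)
      = -(emb (Z.coeff 0) * shift 1 (tshift 1 (Zinv.coeff 0)) * diff (waveAdj Zinv)) := by
  have hg : Growth (-1) (waveAdj Zinv) := growth_waveAdj Zinv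
  have hT0 : Growth 0 (shift 1 (tshift 1 (Zinv.coeff 0))) := (Growth.expand _).shift 1
  have hz0 : Growth 0 (emb (Z.coeff 0)) := Growth.emb _
  have hu : (1 + spec : LaurentSeries K) ≠ 0 := one_add_spec_ne_zero
  have hθ := const_mul_diff_waveAdj Zinv
  have h1 := const_spec_mul_rsym_inv h
  generalize rsym Zinv = v at hθ h1
  generalize waveAdj Zinv = ψ at hg hθ ⊢
  generalize tshift 1 (Zinv.coeff 0) = T at hT0 h1 ⊢
  generalize emb (Z.coeff 0) = z at hz0 h1 ⊢
  have h2 : const spec * (v * chiAdj)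
      = T * shift (-1) (v * z * chiAdj) - shift 1 T * z * (v * chiAdj) := by
    have hc : shift (-1) (v * z * chiAdj) = shift (-1) (v * z) * (const (1 + spec) * chiAdj) := by
      rw [shift_mul _ (v * z), shift_chiAdj]
    rw [hc]
    linear_combination chiAdj * h1
  have h3 : const spec * diff ψ = T * shift (-1) (z * diff ψ) - shift 1 T * z * diff ψ := by
    refine const_injective_mul hu ?_
    have hc : const (1 + spec) * shift (-1) (z * diff ψ) = -shift (-1) (v * z * chiAdj) := by
      rw [← shift_const (-1), ← shift_mul, ← shift_neg]
      congr 1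
      linear_combination z * hθ
    linear_combination (const spec + shift 1 T * z) * hθ - h2 - T * hc
  -- The right side of `h3` is a total difference, so `Δ` can be cancelled: both functions have
  -- exponential type `-1`.
  have h4 : diff (const spec * ψ) = diff (-(shift (-1) (shift 1 T * z * diff ψ))) := by
    rw [diff_const_mul, h3, diff_neg, diff_shift, diff_eq (shift 1 T * _ * _), shift_sub,
      shift_shift, neg_add_cancel, shift_zero_left, mul_assoc (shift 1 T), shift_mul _ (shift 1 T), shift_shift,
      neg_add_cancel, shift_zero_left]
    ring
  have h5 := Growth.eq_of_diff_eq (ε := -1) (hg.const_mul spec)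
    (by simpa using ((hT0.mul hz0).mul hg.diff).shift (-1) |>.neg) (by norm_num) h4
  have h6 := congrArg (shift 1) h5
  rw [shift_mul, shift_const, shift_neg, shift_shift, add_neg_cancel, shift_zero_left] at h6
  rw [h6]
  ring

/-- The functions of a given exponential type. -/
def growthSubmodule (K : Type*) [Field K] (ε : ℤ) :
    Submodule (LaurentSeries K) (Coef (LaurentSeries K)) where
  carrier := {f | Growth ε f}
  zero_mem' := Growth.zero
  add_mem' hf hg := hf.add hg
  smul_mem' c f hf := by
    have := Growth.const_mul hf c
    rwa [const_mul_eq_smul] at this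

lemma Growth.schur {ε : ℤ} {f : Coef (LaurentSeries K)} (hf : Growth ε f) (s : LaurentSeries K)
    (k : ℕ) : Growth ε (schur dtHom s k f) :=
  schur_mem (S := growthSubmodule K ε) (fun l _ hx => Growth.dt hx l) s k f hf

/-- The time shift of the adjoint wave function. -/
lemma schur_waveAdj (h : IsDressing Z Zinv L) (k : ℕ) :
    schur dtHom 1 (k + 1) (waveAdj Zinv)
      = -(schur dtHom 1 k (emb (Zinv.coeff 0))
        * -shift (-1) (emb (Z.coeff 0) * diff (waveAdj Zinv))) := by
  have hd := (h.mapScalars (HahnSeries.C : K →+* LaurentSeries K)).schur_adjoint_eigenfunction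
    (fun i => dt_diff_waveAdj h i) k
  have hg := growth_waveAdj Zinv
  -- The shift formula for adjoint eigenfunctions concerns `Δw^*`. Its right side is a difference
  -- because `Δ^* = -Δ Γ⁻¹`, and the exponential type excludes a constant of summation.
  refine Growth.eq_of_diff_eq (ε := -1) (hg.schur _ _) ?_ (by norm_num) ?_
  · rw [mul_neg, neg_neg]
    simpa using ((Growth.emb (Zinv.coeff 0)).schur 1 k).mul
      (((Growth.emb (Z.coeff 0)).mul hg.diff).shift (-1))
  · rw [diff_schur, hd, diffAdj_eq, ← diff_shift, ← diff_neg]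
    congr 1
    rw [coeff_mapScalars, coeff_mapScalars, mul_neg, shift_neg, shift_mul, shift_mul, shift_mul,
      shift_shift, neg_add_cancel, shift_zero_left]
    ring

end Waves

/-! ### Construction and uniqueness of the potentials -/

section Potentials

open OpSeries PDO IsDressing

variable {K : Type*} [Field K] {Z Zinv L : PDO K}

/-- Potentials of functions with exponential behaviour are determined by the difference
equation. -/
lemma isPotential_of_diff_eq {a b : ℤ} (hab : (a + b) * (a + b) = 1)
    {φ ψ S : Coef (LaurentSeries K)} (hφ : Growth a φ) (hψ : Growth b (diff ψ))
    (hS : Growth (a + b) S)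
    (hdφ : ∀ i, dt i φ = actN (evol (mapScalars HahnSeries.C L) i) φ)
    (hdψ : ∀ i, dt i (diff ψ) = -radj (evol (mapScalars HahnSeries.C L) i) (diff ψ))
    (h : diff S = φ * diff ψ) : IsPotential (mapScalars HahnSeries.C L) φ ψ S where
  diff_eq := h
  dt_eq i := by
    have hB : ∀ m, Growth 0 ((evol (mapScalars (HahnSeries.C : K →+* LaurentSeries K) L) i).coeff m) := by
      intro m
      rw [← mapScalars_evol, coeff_mapScalars]
      exact Growth.emb _
    -- Both sides of the time equation have type `a + b = ±1`, so comparing their differences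
    -- suffices.
    refine Growth.eq_of_diff_eq (hS.dt i) ?_ hab ?_
    · have h1 := Growth.coeff_mul (Growth.coeff_mono Growth.one (-1))
        (Growth.coeff_mul (hψ.coeff_mono 0) (Growth.coeff_mul hB
          (Growth.coeff_mul (hφ.coeff_mono 0) (Growth.coeff_mono Growth.one (-1))))) (-1)
      rw [show 0 + (b + (0 + (a + 0))) = a + b by ring] at h1
      exact h1
    · have h2 := diff_res_potential (evol (mapScalars (HahnSeries.C : K →+* LaurentSeries K) L) i)
        (diff ψ) φ
      refine Eq.trans ?_ h2.symm
      rw [← dt_diff, h, dt_mul, hdφ, hdψ]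
      ring

variable [CharZero K]

/-- The potential with an eigenfunction and the adjoint wave function. -/
lemma isPotential_tshift_mul_waveAdj (h : IsDressing Z Zinv L) {φ : Coef K}
    (hφ : ∀ i, dt i φ = actN (evol L i) φ) :
    IsPotential (mapScalars HahnSeries.C L) (emb φ) (waveAdj Zinv)
      (tshift 1 φ * waveAdj Zinv) := by
  have hg := growth_waveAdj Zinv
  have hT : Growth 0 (tshift 1 φ) := Growth.expand _
  refine isPotential_of_diff_eq (a := 0) (b := -1) (by norm_num) (Growth.emb φ) hg.diff
    (hT.mul hg) (fun i => ?_) (dt_diff_waveAdj h) ?_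
  · rw [← mapCoef_dt, hφ, mapCoef_actN, mapScalars_evol]
  -- With `f = φ^+` and `c = z_0 (Γ z_0^{-1})^+`, the two relations are `λ(f - φ) = c Δf` and `λ
  -- Γw^* = -c Δw^*`. They cancel `Δ(f w^*) - φ Δw^* = (f - φ) Δw^* + (Δf) Γw^*`.
  · have h1 := const_spec_mul_emb (ε := 1) (φ := φ) (f := Z.coeff 0)
      (g := shift 1 (Zinv.coeff 0) * diff φ) (fun k => by
        rw [h.schur_eigenfunction hφ]; ring)
    rw [map_mul, tshift_shift, tshift_diff] at h1
    have h2 := const_spec_mul_shift_waveAdj h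
    refine const_injective_mul spec_ne_zero ?_
    simp only [diff_eq, shift_mul] at h1 h2 ⊢
    linear_combination (-(shift 1 (waveAdj Zinv) - waveAdj Zinv)) * h1
      + (shift 1 (tshift 1 φ) - tshift 1 φ) * h2

/-- The potential with the wave function and an adjoint eigenfunction. -/
lemma isPotential_wave_mul_sub (h : IsDressing Z Zinv L) {ψ : Coef K}
    (hdψ : ∀ i, dt i (diff ψ) = -radj (evol L i) (diff ψ))
    (hψ : ∀ k, schur dtHom 1 (k + 1) ψ = -(schur dtHom 1 k (Zinv.coeff 0)
        * -shift (-1) (Z.coeff 0 * diff ψ))) :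
    IsPotential (mapScalars HahnSeries.C L) (wave Z) (emb ψ)
      (wave Z * emb ψ - wave Z * tshift (-1) ψ) := by
  have hg := growth_wave Z
  have hT : Growth 0 (tshift (-1) ψ) := Growth.expand _
  refine isPotential_of_diff_eq (a := 1) (b := 0) (by norm_num) hg (Growth.emb ψ).diff
    ((hg.mul (Growth.emb ψ)).sub (hg.mul hT)) (dt_wave h) (fun i => ?_) ?_
  · rw [← mapCoef_diff, ← mapCoef_dt, hdψ, map_neg, mapCoef_radj, mapScalars_evol]
  -- Here `c = z_0^- (Γ z_0^{-1})`, and the relations `μ Γ(ψ - ψ^-) = c Δψ^-` and `μ w = c Δw`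
  -- cancel `ΔS - w Δψ = (Δw) Γ(ψ - ψ^-) - w Δψ^-`. The shift by one brings the first relation to
  -- this form.
  · have h1 := const_spec_mul_emb (ε := -1) (φ := ψ) (f := Zinv.coeff 0)
      (g := -shift (-1) (Z.coeff 0 * diff ψ)) (fun k => by rw [neg_neg]; exact hψ k)
    rw [map_neg, tshift_shift, map_mul, tshift_diff] at h1
    have h1' := congrArg (shift 1) h1
    rw [shift_mul, shift_sub, shift_mul, shift_mul, shift_neg, shift_shift, add_neg_cancel,
      shift_zero_left, shift_const] at h1'
    have h2 := const_spec_mul_wave h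
    refine const_injective_mul spec_ne_zero ?_
    simp only [diff_eq, shift_mul, shift_sub] at h1' h2 ⊢
    linear_combination (shift 1 (wave Z) - wave Z) * h1'
      + (-(shift 1 (tshift (-1) ψ) - tshift (-1) ψ)) * h2

/-- In characteristic 0 a power series is constant once all its partial derivatives vanish: any
nonconstant monomial is seen by the derivative in one of its variables. -/
lemma exists_eq_const {D : Coef K} (h : diff D = 0) (hdt : ∀ i, dt i D = 0) :
    ∃ c, D = const c := by
  have hstep : ∀ n, D (n + 1) = D n := fun n => sub_eq_zero.mp (congrFun h n)
  have h0 : ∀ n, D n = D 0 := by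
    intro n
    induction n using Int.induction_on with
    | zero => rfl
    | succ i ih => rw [hstep, ih]
    | pred i ih => rw [← ih, ← hstep (-(i : ℤ) - 1), sub_add_cancel]
  refine ⟨MvPowerSeries.coeff 0 (D 0), funext fun n => ?_⟩
  classical
  rw [h0, const]
  ext d
  rw [MvPowerSeries.coeff_C]
  split_ifs with hd
  · rw [hd]
  · obtain ⟨i, hi⟩ := Finsupp.ne_iff.mp hd
    have h1 := congrArg (MvPowerSeries.coeff (d - Finsupp.single i 1)) (congrFun (hdt i) 0)
    have hle : Finsupp.single i 1 ≤ d := by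
      rw [Finsupp.single_le_iff]
      exact Nat.one_le_iff_ne_zero.mpr hi
    rw [dt, MvPowerSeries.coeff_pderiv, tsub_add_cancel_of_le hle, Pi.zero_apply, map_zero] at h1
    exact (mul_eq_zero.mp h1).resolve_right (Nat.cast_add_one_ne_zero _)

lemma isPotential_iff {L : PDO K} {φ ψ S₀ S : Coef K} (h₀ : IsPotential L φ ψ S₀) :
    IsPotential L φ ψ S ↔ ∃ c, S = S₀ + const c := by
  constructor
  · intro h
    obtain ⟨c, hc⟩ := exists_eq_const (D := S - S₀)
      (by rw [diff_sub, h.diff_eq, h₀.diff_eq, sub_self])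
      (fun i => by rw [dt_sub, h.dt_eq, h₀.dt_eq, sub_self])
    exact ⟨c, by rw [← hc]; ring⟩
  · rintro ⟨c, rfl⟩
    exact ⟨by rw [diff_add, diff_const, add_zero, h₀.diff_eq],
      fun i => by rw [dt_add, dt_const, add_zero, h₀.dt_eq]⟩

lemma isPotentialHat_iff {L : PDO K} {φ ψ T₀ T : Coef K}
    (h₀ : IsPotential L φ ψ (φ * ψ - T₀)) :
    IsPotentialHat L φ ψ T ↔ ∃ c, T = T₀ + const c := by
  constructor
  · rintro ⟨S, hS, rfl⟩
    obtain ⟨c, rfl⟩ := (isPotential_iff h₀).mp hS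
    exact ⟨-c, by rw [const_neg]; ring⟩
  · rintro ⟨c, rfl⟩
    refine ⟨φ * ψ - T₀ + const (-c), (isPotential_iff h₀).mpr ⟨-c, rfl⟩, ?_⟩
    rw [const_neg]; ring

end Potentials

/-! ### Two spectral variables as iterated scalar extension -/

section TwoVariables

open OpSeries PDO IsDressing

variable {K K' : Type*} [Field K] [Field K']

/-- Extension of scalars of Laurent series. -/
def mapLaurent (f : K →+* K') : LaurentSeries K →+* LaurentSeries K' where
  toFun x := x.map f
  map_zero' := by ext j; simp
  map_one' := by
    ext j
    simp only [HahnSeries.map_coeff, HahnSeries.coeff_one]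
    split_ifs <;> simp
  map_add' x y := by ext j; simp
  map_mul' x y := HahnSeries.map_mul (f : K →ₙ+* K')

lemma coeff_mapLaurent (f : K →+* K') (x : LaurentSeries K) (j : ℤ) :
    (mapLaurent f x).coeff j = f (x.coeff j) := rfl

lemma mapLaurent_spec (f : K →+* K') : mapLaurent f spec = spec := by
  ext j
  rw [coeff_mapLaurent, spec, spec, HahnSeries.coeff_single, HahnSeries.coeff_single]
  split_ifs <;> simp

lemma map_expXi (f : K →+* K') (ε : LaurentSeries K) :
    MvPowerSeries.map (mapLaurent f) (expXi ε) = expXi (mapLaurent f ε) := by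
  ext1 γ
  rw [MvPowerSeries.coeff_map]
  change mapLaurent f (∏ l ∈ γ.support, _) = ∏ l ∈ γ.support, _
  rw [map_prod]
  refine Finset.prod_congr rfl fun l _ => ?_
  rw [map_div₀, map_pow, map_mul, map_pow, mapLaurent_spec, map_natCast]

lemma mapCoef_chiAdj (f : K →+* K') : mapCoef (mapLaurent f) chiAdj = chiAdj := by
  funext n
  rw [mapCoef_apply, chiAdj_apply, chiAdj_apply, map_mul, MvPowerSeries.map_C, map_zpow₀,
    map_add, map_one, mapLaurent_spec, map_expXi, map_neg, map_one]

lemma mapCoef_chi (f : K →+* K') : mapCoef (mapLaurent f) chi = chi := by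
  funext n
  rw [mapCoef_apply, chi_apply, chi_apply, map_mul, MvPowerSeries.map_C, map_zpow₀,
    map_add, map_one, mapLaurent_spec, map_expXi, map_one]

lemma mapCoef_sym (f : K →+* K') (A : OpSeries K) :
    mapCoef (mapLaurent f) (sym A) = sym (mapScalars f A) := by
  funext n; ext α j
  rw [mapCoef_apply, MvPowerSeries.coeff_map, coeff_mapLaurent, coeff_sym, coeff_sym]
  rfl

lemma mapCoef_rsym (f : K →+* K') (A : PDO K) :
    mapCoef (mapLaurent f) (rsym A) = rsym (mapScalars f A) := by
  rw [rsym, mapCoef_sym, rsym]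
  congr 1; ext1; funext m
  rw [coeff_mapScalars, coeff_adjoint, coeff_adjoint, mapCoef_rcoeff]

lemma mapCoef_wave (f : K →+* K') (Z : PDO K) :
    mapCoef (mapLaurent f) (wave Z) = wave (mapScalars f Z) := by
  rw [wave_eq, map_mul, mapCoef_sym, mapCoef_chi, wave_eq]

lemma mapCoef_waveAdj (f : K →+* K') (Zinv : PDO K) :
    mapCoef (mapLaurent f) (waveAdj Zinv) = waveAdj (mapScalars f Zinv) := by
  rw [waveAdj_eq, map_mul, mapCoef_rsym, mapCoef_chiAdj, waveAdj_eq, mapScalars_mul,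
    mapScalars_delta]
  rfl

lemma inner_eq (g : Coef (LaurentSeries K)) : inner g = emb g := by
  funext n; ext1 α
  rw [mapCoef_apply, MvPowerSeries.coeff_map]
  rfl

lemma outer_eq (g : Coef (LaurentSeries K)) : outer g = mapCoef (mapLaurent HahnSeries.C) g := by
  funext n; ext1 α
  rw [mapCoef_apply, MvPowerSeries.coeff_map]
  rfl

lemma shiftedInner_eq [CharZero K] (ε : LaurentSeries K) (g : Coef (LaurentSeries K)) :
    shiftedInner ε g = tshift ε g := by
  funext n
  rw [tshift_apply]
  rfl

lemma mapScalars_scalar (A : PDO K) :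
    mapScalars scalar A = mapScalars HahnSeries.C (mapScalars HahnSeries.C A) := by
  ext1; funext m
  rw [coeff_mapScalars, coeff_mapScalars, coeff_mapScalars]
  funext n; ext1 α
  rw [mapCoef_apply, mapCoef_apply, mapCoef_apply, MvPowerSeries.coeff_map,
    MvPowerSeries.coeff_map, MvPowerSeries.coeff_map]
  rfl

end TwoVariables

end DMKP

end

theorem theorem3p2 {k : Type*} [Field k] [CharZero k] (Z Zinv L : DMKP.PDO k)
    (hZ : DMKP.IsDressing Z Zinv L) :
    -- `S(w(n,t,μ), Δw^*(n,t,λ))`, with `μ` inner and `λ` outer, i.e. for `|μ| < |λ|`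
    (∀ S : DMKP.Coef (DMKP.Laurent2 k),
      DMKP.IsPotential (DMKP.PDO.mapScalars DMKP.scalar L)
          (DMKP.inner (DMKP.wave Z)) (DMKP.outer (DMKP.waveAdj Zinv)) S ↔
        ∃ c : DMKP.Laurent2 k,
          S = DMKP.shiftedInner 1 (DMKP.wave Z) * DMKP.outer (DMKP.waveAdj Zinv)
            + DMKP.const c) ∧
    -- `Ŝ(Δw(n,t,μ), w^*(n+1,t,λ))`, with `λ` inner and `μ` outer, i.e. for `|λ| < |μ|`
    (∀ T : DMKP.Coef (DMKP.Laurent2 k),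
      DMKP.IsPotentialHat (DMKP.PDO.mapScalars DMKP.scalar L)
          (DMKP.outer (DMKP.wave Z)) (DMKP.inner (DMKP.waveAdj Zinv)) T ↔
        ∃ c : DMKP.Laurent2 k,
          T = DMKP.outer (DMKP.wave Z) * DMKP.shiftedInner (-1) (DMKP.waveAdj Zinv)
            + DMKP.const c) := by
  -- Laurent series in the inner variable serve as the ground field. Over it the inner function is
  -- an ordinary coefficient function, and the outer one is the wave function of the extended
  -- dressing operator, so the one-variable results apply.
  have h := hZ.mapScalars (HahnSeries.C : k →+* LaurentSeries k)
  rw [DMKP.inner_eq, DMKP.inner_eq, DMKP.outer_eq, DMKP.outer_eq, DMKP.shiftedInner_eq,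
    DMKP.shiftedInner_eq, DMKP.mapCoef_wave, DMKP.mapCoef_waveAdj, DMKP.mapScalars_scalar]
  refine ⟨fun S => DMKP.isPotential_iff
    (DMKP.isPotential_tshift_mul_waveAdj h (DMKP.dt_wave hZ)), fun T =>
    DMKP.isPotentialHat_iff ?_⟩
  exact DMKP.isPotential_wave_mul_sub h (DMKP.dt_diff_waveAdj hZ) (DMKP.schur_waveAdj hZ)
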